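/- Let $N$ be a nonempty closed smooth manifold of dimension $n\ge 2$, let $S^1=\mathbb R/2\pi\mathbb Z$ with angular coordinate $t$, and let $M=S^1\times N$. A metric has signature $(r,s)$ if at every point it is diagonal in some basis with $r$ entries $-1$ and $s$ entries $+1$. Let $p+q=n$, and suppose that $N$ carries a smooth metric of signature $(p,q)$ (no assumption when $p=0$ or $q=0$). Let $\sigma\in\{1,-1\}$, and let $(r,s)=(p,q+1)$ if $\sigma=1$ and $(r,s)=(p+1,q)$ if $\sigma=-1$. Then there is a family $\gamma(t)$, $t\in S^1$, of smooth metrics of signature $(p,q)$ on $N$ such that $$g_\epsilon=\sigma\,\epsilon^2\,dt\otimes dt+\gamma(t),\qquad \epsilon\in(0,1],$$ are smooth metrics of signature $(r,s)$ on $M$ with the following properties. 1. The $g_\epsilon$ are uniformly bounded in $C^\infty$: in every smooth chart of $M$, on every compact subset of it, and for every $k$, the partial derivatives of order $k$ of the components of $g_\epsilon$ are bounded by a constant independent of $\epsilon\in(0,1]$. 2. The Einstein–Hilbert density is integrable on $M$ for every $\epsilon\in(0,1]$, and there are real constants $c_{-1}<0$ and $c_1$ with $$\int_M R[g_\epsilon]\,|\det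 (g_\epsilon)_{\mu\nu}|^{1/2}\,dx=\frac{c_{-1}}{\epsilon}+c_1\,\epsilon\qquad\text{for all }\epsilon\in(0,1].$$ In particular the action is $O(\epsilon^{-1})$ and tends to $-\infty$ as $\epsilon\to0^+$. This covers in particular the Riemannian signature $(0,n+1)$ and the Lorentzian signature $(1,n)$, with no assumption on $N$ beyond those of the first sentence. -/

import Mathlib

open scoped Manifold ContDiff Bundle Topology
open MeasureTheory Set Filter

noncomputable section

section Curvature

variable {E : Type*} [NormedAddCommGroup E] [NormedSpace ℝ E]
  {ι : Type*} [Fintype ι] [DecidableEq ι]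

/-- The partial derivative `∂ᵢ f`, in the linear coordinates on `E` given by the basis `b`. -/
def pderiv (b : Module.Basis ι ℝ E) (i : ι) (f : E → ℝ) (u : E) : ℝ :=
  fderiv ℝ f u (b i)

/-- Christoffel symbols of the metric with components `G`:
`Γᵏᵢⱼ = ½ Gᵏˡ (∂ᵢ Gⱼₗ + ∂ⱼ Gᵢₗ - ∂ₗ Gᵢⱼ)`. -/
def christoffel (b : Module.Basis ι ℝ E) (G : E → Matrix ι ι ℝ) (k i j : ι) (u : E) : ℝ :=
  (1 / 2) * ∑ l, (G u)⁻¹ k l *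
    (pderiv b i (fun v => G v j l) u + pderiv b j (fun v => G v i l) u
      - pderiv b l (fun v => G v i j) u)

/-- Ricci tensor: `Rᵢⱼ = ∂ₖ Γᵏᵢⱼ - ∂ⱼ Γᵏᵢₖ + Γᵏₖₗ Γˡᵢⱼ - Γᵏⱼₗ Γˡᵢₖ`. -/
def coordRicci (b : Module.Basis ι ℝ E) (G : E → Matrix ι ι ℝ) (i j : ι) (u : E) : ℝ :=
  (∑ k, (pderiv b k (christoffel b G k i j) u - pderiv b j (christoffel b G k i k) u))
    + ∑ k, ∑ l, (christoffel b G k k l u * christoffel b G l i j u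
        - christoffel b G k j l u * christoffel b G l i k u)

/-- Scalar curvature `Gⁱʲ Rᵢⱼ`. -/
def coordScalarCurvature (b : Module.Basis ι ℝ E) (G : E → Matrix ι ι ℝ) (u : E) : ℝ :=
  ∑ i, ∑ j, (G u)⁻¹ i j * coordRicci b G i j u

end Curvature

section Manifold

variable {E : Type*} [NormedAddCommGroup E] [NormedSpace ℝ E]
  {H : Type*} [TopologicalSpace H] (I : ModelWithCorners ℝ E H)
  (M : Type*) [TopologicalSpace M] [ChartedSpace H M]

/-- Fields of bilinear forms on the tangent spaces, i.e. `(0,2)`-tensor fields. -/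
abbrev BilinField : Type _ :=
  ∀ x : M, TangentSpace I x →L[ℝ] TangentSpace I x →L[ℝ] ℝ

variable {I M}

/-- The bilinear form `B` is diagonal in some basis, with `r` entries `-1` and `s` entries `1`. -/
def HasSignature {V : Type*} [AddCommGroup V] [Module ℝ V] [TopologicalSpace V]
    (B : V →L[ℝ] V →L[ℝ] ℝ) (r s : ℕ) : Prop :=
  ∃ v : Module.Basis (Fin r ⊕ Fin s) ℝ V, ∀ i j,
    B (v i) (v j) = if i = j then Sum.elim (fun _ => (-1 : ℝ)) (fun _ => (1 : ℝ)) i else 0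

/-- `g` is a smooth (pseudo-Riemannian) metric of signature `(r,s)` (`r` minus signs and `s`
plus signs). -/
structure IsSmoothMetric [IsManifold I ∞ M] (g : BilinField I M) (r s : ℕ) : Prop where
  contMDiff : ContMDiff I (I.prod 𝓘(ℝ, E →L[ℝ] E →L[ℝ] ℝ)) ∞
    (fun x => Bundle.TotalSpace.mk' (E →L[ℝ] E →L[ℝ] ℝ)
      (E := fun x : M => TangentSpace I x →L[ℝ] TangentSpace I x →L[ℝ] ℝ) x (g x))
  hasSignature : ∀ x, HasSignature (g x) r s

variable {ι : Type*} [Fintype ι] [DecidableEq ι]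

/-- The components `gᵢⱼ` in the chart `e`, as functions on the image of the chart: the pullback of
`g` by the inverse of the chart, evaluated on the basis `b`. -/
def chartComponents (b : Module.Basis ι ℝ E) (g : BilinField I M) (e : OpenPartialHomeomorph M H)
    (u : E) : Matrix ι ι ℝ :=
  Matrix.of fun i j => g ((e.extend I).symm u)
    (mfderiv 𝓘(ℝ, E) I (e.extend I).symm u (b i)) (mfderiv 𝓘(ℝ, E) I (e.extend I).symm u (b j))

/-- The scalar curvature of `g` at `x`, computed in the preferred chart at `x`. -/
def scalarCurvature (b : Module.Basis ι ℝ E) (g : BilinField I M) (x : M) : ℝ :=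
  coordScalarCurvature b (chartComponents b g (chartAt H x)) (extChartAt I x x)

/-- The measure `|det gᵢⱼ|^{1/2} dx` on the domain of the chart `e`, extended by zero to `M`. -/
def chartVolume [MeasurableSpace E] [BorelSpace E] [MeasurableSpace M]
    (b : Module.Basis ι ℝ E) (g : BilinField I M) (e : OpenPartialHomeomorph M H) : Measure M :=
  ((b.addHaar.restrict (e.extend I).target).withDensity
    (fun u => ENNReal.ofReal (Real.sqrt |(chartComponents b g e u).det|))).map (e.extend I).symm

/-- The volume measure of `g`. On overlaps of charts the measures `chartVolume` agree, so that
the measure on `M` obtained by gluing them is their least upper bound. -/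
def volumeMeasure [MeasurableSpace E] [BorelSpace E] [MeasurableSpace M]
    (b : Module.Basis ι ℝ E) (g : BilinField I M) : Measure M :=
  ⨆ e ∈ atlas H M, chartVolume b g e

/-- The Einstein-Hilbert action `∫_M R[g] |det gᵢⱼ|^{1/2} dx`. -/
def einsteinHilbert [MeasurableSpace E] [BorelSpace E] [MeasurableSpace M]
    (b : Module.Basis ι ℝ E) (g : BilinField I M) : ℝ :=
  ∫ x, scalarCurvature b g x ∂(volumeMeasure b g)

/-- The family `g ε`, `ε ∈ S`, of tensor fields is bounded in `C^∞`: in every smooth chart, on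
every compact part of it, the derivatives of each order of the components are bounded uniformly
in `ε`. -/
def UniformlyBoundedSmooth (b : Module.Basis ι ℝ E) (S : Set ℝ) (g : ℝ → BilinField I M) : Prop :=
  ∀ e ∈ IsManifold.maximalAtlas I ∞ M, ∀ K : Set E, IsCompact K → K ⊆ (e.extend I).target →
    ∀ (k : ℕ) (i j : ι), ∃ C : ℝ, ∀ ε ∈ S, ∀ u ∈ K,
      ‖iteratedFDeriv ℝ k (fun v => chartComponents b (g ε) e v i j) u‖ ≤ C

end Manifold

section Collapsing

/-- The circle carries its Borel sets. -/
instance circleMeasurableSpace : MeasurableSpace Circle := borel Circle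

instance circleBorelSpace : BorelSpace Circle := ⟨rfl⟩

/-- The `1`-form `dt` on the unit circle, `t` being the angular coordinate: at `z = exp (i t)` the
tangent vector with image `w` in `ℂ` is mapped to `Im (z̄ w)`. -/
def circleDt (z : Circle) : TangentSpace (𝓡 1) z →L[ℝ] ℝ :=
  (Complex.imCLM ∘L ((starRingEnd ℂ (z : ℂ)) • ContinuousLinearMap.id ℝ ℂ)) ∘L
    (mfderiv (𝓡 1) 𝓘(ℝ, ℂ) (fun y : Circle => (y : ℂ)) z :
      TangentSpace (𝓡 1) z →L[ℝ] ℂ)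

variable {n : ℕ} {N : Type*} [TopologicalSpace N] [ChartedSpace (EuclideanSpace ℝ (Fin n)) N]

/-- The tensor field `a dt ⊗ dt + γ(t)` on `S¹ × N`. -/
def circleProductMetric (a : ℝ) (γ : Circle → BilinField (𝓡 n) N) :
    BilinField ((𝓡 1).prod (𝓡 n)) (Circle × N) := fun y =>
  let dfst : TangentSpace ((𝓡 1).prod (𝓡 n)) y →L[ℝ] TangentSpace (𝓡 1) y.1 :=
    mfderiv ((𝓡 1).prod (𝓡 n)) (𝓡 1) Prod.fst y
  let dsnd : TangentSpace ((𝓡 1).prod (𝓡 n)) y →L[ℝ] TangentSpace (𝓡 n) y.2 :=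
    mfderiv ((𝓡 1).prod (𝓡 n)) (𝓡 n) Prod.snd y
  a • (circleDt y.1 ∘L dfst).smulRight (circleDt y.1 ∘L dfst)
    + (ContinuousLinearMap.precomp ℝ dsnd) ∘L (γ y.1 y.2 ∘L dsnd)

/-- The standard coordinates on the model space of `S¹ × N`. -/
def productBasis (n : ℕ) :
    Module.Basis (Fin 1 ⊕ Fin n) ℝ (EuclideanSpace ℝ (Fin 1) × EuclideanSpace ℝ (Fin n)) :=
  (EuclideanSpace.basisFun (Fin 1) ℝ).toBasis.prod (EuclideanSpace.basisFun (Fin n) ℝ).toBasis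

/-- The formula for `circleProductMetric` on pairs of tangent vectors. -/
theorem circleProductMetric_apply (a : ℝ) (γ : Circle → BilinField (𝓡 n) N) (y : Circle × N)
    (v w : TangentSpace ((𝓡 1).prod (𝓡 n)) y) :
    circleProductMetric a γ y v w =
      a * (circleDt y.1 (mfderiv ((𝓡 1).prod (𝓡 n)) (𝓡 1) Prod.fst y v)
        * circleDt y.1 (mfderiv ((𝓡 1).prod (𝓡 n)) (𝓡 1) Prod.fst y w))
      + γ y.1 y.2 (mfderiv ((𝓡 1).prod (𝓡 n)) (𝓡 n) Prod.snd y v)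
          (mfderiv ((𝓡 1).prod (𝓡 n)) (𝓡 n) Prod.snd y w) :=
  rfl

end Collapsing

end

noncomputable section

set_option linter.unusedSectionVars false

section CoordinateFree

variable {E : Type*} [NormedAddCommGroup E] [NormedSpace ℝ E]
  {ι : Type*} [Fintype ι] [DecidableEq ι]

/-- The matrix of a field of bilinear forms in the basis `b`. -/
def formMatrix (b : Module.Basis ι ℝ E) (B : E → E →L[ℝ] E →L[ℝ] ℝ) (u : E) : Matrix ι ι ℝ :=
  Matrix.of fun i j => B u (b i) (b j)

/-- A field of bilinear forms which is a smooth pseudo-Riemannian metric on the open set `U`. -/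
structure IsMetricOn (b : Module.Basis ι ℝ E) (B : E → E →L[ℝ] E →L[ℝ] ℝ) (U : Set E) : Prop where
  isOpen : IsOpen U
  contDiffOn : ContDiffOn ℝ ∞ B U
  symm : ∀ u ∈ U, ∀ v w, B u v w = B u w v
  det_ne_zero : ∀ u ∈ U, (formMatrix b B u).det ≠ 0

/-- The basis coordinate as a continuous linear form. -/
def coordL (b : Module.Basis ι ℝ E) (i : ι) : E →L[ℝ] ℝ :=
  haveI : FiniteDimensional ℝ E := Module.Finite.of_basis b
  LinearMap.toContinuousLinearMap (b.coord i)

@[simp] theorem coordL_apply (b : Module.Basis ι ℝ E) (i : ι) (v : E) :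
    coordL b i v = b.repr v i := rfl

theorem basis_induction (b : Module.Basis ι ℝ E) {P : E → Prop} (h0 : P 0)
    (hb : ∀ i, P (b i)) (hadd : ∀ v w, P v → P w → P (v + w)) (hsmul : ∀ (c : ℝ) v, P v → P (c • v)) (v : E) : P v := by
  have hv : v ∈ Submodule.span ℝ (Set.range b) := by rw [b.span_eq]; trivial
  induction hv using Submodule.span_induction with
  | mem x hx => obtain ⟨i, rfl⟩ := hx; exact hb i
  | zero => exact h0
  | add x y _ _ hx hy => exact hadd x y hx hy
  | smul c x _ hx => exact hsmul c x hx

/-- The Christoffel symbols as a field of bilinear maps. -/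
def connectionForm (b : Module.Basis ι ℝ E) (G : E → Matrix ι ι ℝ) (u : E) : E →L[ℝ] E →L[ℝ] E :=
  ∑ k, ∑ i, ∑ j, christoffel b G k i j u •
    (coordL b i).smulRight ((coordL b j).smulRight (b k))

theorem connectionForm_basis (b : Module.Basis ι ℝ E) (G : E → Matrix ι ι ℝ) (u : E) (i j : ι) :
    connectionForm b G u (b i) (b j) = ∑ k, christoffel b G k i j u • b k := by
  simp [connectionForm, _root_.sum_apply, Finsupp.single_apply, ite_smul]

theorem repr_connectionForm (b : Module.Basis ι ℝ E) (G : E → Matrix ι ι ℝ) (u : E) (k i j : ι) :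
    b.repr (connectionForm b G u (b i) (b j)) k = christoffel b G k i j u := by
  simp [connectionForm_basis, Finsupp.single_apply]

variable {b : Module.Basis ι ℝ E} {B : E → E →L[ℝ] E →L[ℝ] ℝ} {U : Set E}

theorem IsMetricOn.differentiableAt (h : IsMetricOn b B U) {u : E} (hu : u ∈ U) :
    DifferentiableAt ℝ B u :=
  (h.contDiffOn.contDiffAt (h.isOpen.mem_nhds hu)).differentiableAt (by simp)

theorem pderiv_formMatrix {u : E} (h : DifferentiableAt ℝ B u) (l i j : ι) :
    pderiv b l (fun v => formMatrix b B v i j) u = fderiv ℝ B u (b l) (b i) (b j) := by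
  have h1 := (h.hasFDerivAt.clm_apply (hasFDerivAt_const (b i) u)).clm_apply
    (hasFDerivAt_const (b j) u)
  simp only [pderiv, formMatrix, Matrix.of_apply]
  rw [h1.fderiv]
  simp

theorem IsMetricOn.contDiffOn_entry (h : IsMetricOn b B U) (i j : ι) :
    ContDiffOn ℝ ∞ (fun v => formMatrix b B v i j) U :=
  (h.contDiffOn.clm_apply contDiffOn_const).clm_apply contDiffOn_const

theorem contDiffOn_det {κ : Type*} [Fintype κ] [DecidableEq κ] {G : E → Matrix κ κ ℝ}
    (h : ∀ i j, ContDiffOn ℝ ∞ (fun v => G v i j) U) : ContDiffOn ℝ ∞ (fun v => (G v).det) U := by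
  simp only [Matrix.det_apply]
  refine ContDiffOn.sum fun s _ => ContDiffOn.const_smul _ ?_
  exact contDiffOn_prod fun i _ => h _ _

theorem contDiffOn_inv_entry {κ : Type*} [Fintype κ] [DecidableEq κ] {G : E → Matrix κ κ ℝ}
    (h : ∀ i j, ContDiffOn ℝ ∞ (fun v => G v i j) U)
    (h0 : ∀ u ∈ U, (G u).det ≠ 0) (i j : κ) : ContDiffOn ℝ ∞ (fun v => (G v)⁻¹ i j) U := by
  simp only [Matrix.inv_def, Matrix.smul_apply, Ring.inverse_eq_inv', smul_eq_mul,
    Matrix.adjugate_apply]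
  refine ((contDiffOn_det h).inv h0).mul (contDiffOn_det fun k l => ?_)
  by_cases hk : k = j
  · subst hk; simpa using contDiffOn_const
  · simpa [Matrix.updateRow_ne hk] using h k l

theorem contDiffOn_pderiv {f : E → ℝ} (hU : IsOpen U) (hf : ContDiffOn ℝ ∞ f U)
    (b : Module.Basis ι ℝ E) (i : ι) : ContDiffOn ℝ ∞ (pderiv b i f) U :=
  (hf.fderiv_of_isOpen hU (by simp)).clm_apply contDiffOn_const

theorem contDiffOn_christoffel {G : E → Matrix ι ι ℝ} (hU : IsOpen U)
    (h : ∀ i j, ContDiffOn ℝ ∞ (fun v => G v i j) U)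
    (h0 : ∀ u ∈ U, (G u).det ≠ 0) (k i j : ι) : ContDiffOn ℝ ∞ (christoffel b G k i j) U := by
  unfold christoffel
  refine contDiffOn_const.mul (ContDiffOn.sum fun l _ => (contDiffOn_inv_entry h h0 k l).mul ?_)
  exact ((contDiffOn_pderiv hU (h _ _) b _).add (contDiffOn_pderiv hU (h _ _) b _)).sub
    (contDiffOn_pderiv hU (h _ _) b _)

theorem contDiffOn_coordScalarCurvature {G : E → Matrix ι ι ℝ} (hU : IsOpen U)
    (h : ∀ i j, ContDiffOn ℝ ∞ (fun v => G v i j) U)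
    (h0 : ∀ u ∈ U, (G u).det ≠ 0) : ContDiffOn ℝ ∞ (coordScalarCurvature b G) U := by
  unfold coordScalarCurvature coordRicci
  have hc := contDiffOn_christoffel (b := b) hU h h0
  refine ContDiffOn.sum fun i _ => ContDiffOn.sum fun j _ =>
    (contDiffOn_inv_entry h h0 i j).mul ((ContDiffOn.sum fun k _ => ?_).add
      (ContDiffOn.sum fun k _ => ContDiffOn.sum fun l _ => ?_))
  · exact (contDiffOn_pderiv hU (hc _ _ _) b _).sub (contDiffOn_pderiv hU (hc _ _ _) b _)
  · exact ((hc _ _ _).mul (hc _ _ _)).sub ((hc _ _ _).mul (hc _ _ _))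

theorem contDiffOn_smul_const {F : Type*} [NormedAddCommGroup F] [NormedSpace ℝ F] {f : E → ℝ}
    (hf : ContDiffOn ℝ ∞ f U) (c : F) : ContDiffOn ℝ ∞ (fun u => f u • c) U :=
  hf.smul contDiffOn_const

theorem IsMetricOn.contDiffOn_connectionForm (h : IsMetricOn b B U) :
    ContDiffOn ℝ ∞ (connectionForm b (formMatrix b B)) U := by
  unfold connectionForm
  refine ContDiffOn.sum fun k _ => ContDiffOn.sum fun i _ => ContDiffOn.sum fun j _ => ?_
  exact contDiffOn_smul_const
    (contDiffOn_christoffel h.isOpen h.contDiffOn_entry h.det_ne_zero k i j) _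

theorem IsMetricOn.eq_of_forall (h : IsMetricOn b B U) {u : E} (hu : u ∈ U) {v w : E}
    (hvw : ∀ z, B u v z = B u w z) : v = w := by
  have key : (b.repr (v - w) : ι → ℝ) = 0 := by
    refine Matrix.eq_zero_of_vecMul_eq_zero (h.det_ne_zero u hu) ?_
    ext j
    have h1 : B u (v - w) (b j) = 0 := by simp [hvw]
    rw [← b.sum_repr (v - w)] at h1
    simpa [Matrix.vecMul, dotProduct, formMatrix, _root_.sum_apply] using h1
  have : b.repr (v - w) = 0 := by ext i; exact congrFun key i
  simpa [sub_eq_zero] using this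

set_option maxHeartbeats 1000000 in
set_option synthInstance.maxHeartbeats 200000 in
/-- The Koszul formula. -/
theorem IsMetricOn.koszul (h : IsMetricOn b B U) {u : E} (hu : u ∈ U) (v w z : E) :
    B u (connectionForm b (formMatrix b B) u v w) z =
      (1 / 2) * (fderiv ℝ B u v w z + fderiv ℝ B u w v z - fderiv ℝ B u z v w) := by
  revert v w z
  refine basis_induction b (by simp) (fun i => ?_) (fun v w hv hw => ?_) (fun c v hv => ?_)
  · refine basis_induction b (by simp) (fun j => ?_) (fun v w hv hw => ?_) (fun c v hv => ?_)
    · refine basis_induction b (by simp) (fun l => ?_) (fun v w hv hw => ?_) (fun c v hv => ?_)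
      · have hd := h.differentiableAt hu
        have hinv : formMatrix b B u * (formMatrix b B u)⁻¹ = 1 :=
          Matrix.mul_nonsing_inv _ (h.det_ne_zero u hu).isUnit
        have hinv' : ∀ l m, ∑ k, (formMatrix b B u)⁻¹ k m * B u (b k) (b l)
            = if l = m then 1 else 0 := by
          intro l m
          have := congrFun (congrFun hinv l) m
          simp only [Matrix.mul_apply, Matrix.one_apply] at this
          rw [← this]
          refine Finset.sum_congr rfl fun k _ => ?_
          rw [h.symm u hu, mul_comm]; rfl
        rw [connectionForm_basis]
        simp only [christoffel, pderiv_formMatrix hd, map_sum, map_smul,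
          _root_.sum_apply, _root_.smul_apply, smul_eq_mul]
        simp only [mul_assoc, Finset.sum_mul, ← Finset.mul_sum]
        rw [Finset.sum_comm]
        have : ∀ m, ∑ k, (formMatrix b B u)⁻¹ k m *
            ((fderiv ℝ B u (b i) (b j) (b m) + fderiv ℝ B u (b j) (b i) (b m)
              - fderiv ℝ B u (b m) (b i) (b j)) * B u (b k) (b l)) =
            (fderiv ℝ B u (b i) (b j) (b m) + fderiv ℝ B u (b j) (b i) (b m)
              - fderiv ℝ B u (b m) (b i) (b j)) * if l = m then 1 else 0 := by
          intro m
          rw [← hinv', Finset.mul_sum]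
          exact Finset.sum_congr rfl fun k _ => by ring
        simp [this]
      · simp only [map_add, _root_.add_apply] at *; rw [hv, hw]; ring
      · simp only [map_smul, _root_.smul_apply, smul_eq_mul] at *; rw [hv]; ring
    · intro z
      have := hv z; have := hw z
      simp only [map_add, _root_.add_apply] at *; linarith
    · intro z
      have := hv z
      simp only [map_smul, _root_.smul_apply, smul_eq_mul] at *; rw [this]; ring
  · intro y z
    have := hv y z; have := hw y z
    simp only [map_add, _root_.add_apply] at *; linarith
  · intro y z
    have := hv y z
    simp only [map_smul, _root_.smul_apply, smul_eq_mul] at *; rw [this]; ring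

end CoordinateFree
end

noncomputable section
set_option linter.unusedSectionVars false

theorem HasFDerivAt.bilin_apply {E F G H : Type*} [NormedAddCommGroup E] [NormedSpace ℝ E]
    [NormedAddCommGroup F] [NormedSpace ℝ F] [NormedAddCommGroup G] [NormedSpace ℝ G]
    [NormedAddCommGroup H] [NormedSpace ℝ H] {A : E → F →L[ℝ] G →L[ℝ] H} {f : E → F} {g : E → G}
    {A' : E →L[ℝ] F →L[ℝ] G →L[ℝ] H} {f' : E →L[ℝ] F} {g' : E →L[ℝ] G} {u : E}
    (hA : HasFDerivAt A A' u) (hf : HasFDerivAt f f' u) (hg : HasFDerivAt g g' u) (v : E) :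
    fderiv ℝ (fun y => A y (f y) (g y)) u v
      = A' v (f u) (g u) + A u (f' v) (g u) + A u (f u) (g' v) := by
  rw [((hA.clm_apply hf).clm_apply hg).fderiv]
  simp
  abel

theorem HasFDerivAt.lin_apply {E F G : Type*} [NormedAddCommGroup E] [NormedSpace ℝ E]
    [NormedAddCommGroup F] [NormedSpace ℝ F] [NormedAddCommGroup G] [NormedSpace ℝ G]
    {A : E → F →L[ℝ] G} {f : E → F}
    {A' : E →L[ℝ] F →L[ℝ] G} {f' : E →L[ℝ] F} {u : E}
    (hA : HasFDerivAt A A' u) (hf : HasFDerivAt f f' u) (v : E) :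
    fderiv ℝ (fun y => A y (f y)) u v = A' v (f u) + A u (f' v) := by
  rw [(hA.clm_apply hf).fderiv]
  simp [add_comm]

theorem fderiv_bilin_const {E F G H : Type*} [NormedAddCommGroup E] [NormedSpace ℝ E]
    [NormedAddCommGroup F] [NormedSpace ℝ F] [NormedAddCommGroup G] [NormedSpace ℝ G]
    [NormedAddCommGroup H] [NormedSpace ℝ H] {A : E → F →L[ℝ] G →L[ℝ] H} {u : E}
    (hA : DifferentiableAt ℝ A u) (v : E) (f : F) (g : G) :
    fderiv ℝ (fun y => A y f g) u v = fderiv ℝ A u v f g := by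
  rw [hA.hasFDerivAt.bilin_apply (hasFDerivAt_const f u) (hasFDerivAt_const g u)]
  simp

section CoordinateFree

variable {E : Type*} [NormedAddCommGroup E] [NormedSpace ℝ E]
  {ι : Type*} [Fintype ι] [DecidableEq ι]

variable {b : Module.Basis ι ℝ E} {B B' : E → E →L[ℝ] E →L[ℝ] ℝ} {U V : Set E}

theorem IsMetricOn.fderiv_symm (h : IsMetricOn b B U) {u : E} (hu : u ∈ U) (v w z : E) :
    fderiv ℝ B u v w z = fderiv ℝ B u v z w := by
  have hd := h.differentiableAt hu
  rw [← fderiv_bilin_const hd, ← fderiv_bilin_const hd]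
  congr 1
  apply Filter.EventuallyEq.fderiv_eq
  filter_upwards [h.isOpen.mem_nhds hu] with y hy using h.symm y hy _ _

theorem IsMetricOn.connectionForm_symm (h : IsMetricOn b B U) {u : E} (hu : u ∈ U) (v w : E) :
    connectionForm b (formMatrix b B) u v w = connectionForm b (formMatrix b B) u w v := by
  refine h.eq_of_forall hu fun z => ?_
  rw [h.koszul hu, h.koszul hu, h.fderiv_symm hu z w v]
  ring

/-- The curvature operator `R(v, w) z` of the connection with Christoffel form `Γ`. -/
def curvatureForm (Γ : E → E →L[ℝ] E →L[ℝ] E) (u v w z : E) : E :=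
  fderiv ℝ Γ u v z w - fderiv ℝ Γ u w z v + (Γ u v (Γ u z w) - Γ u w (Γ u z v))

theorem coordRicci_eq (G : E → Matrix ι ι ℝ) {u : E}
    (h : DifferentiableAt ℝ (connectionForm b G) u) (i j : ι) :
    coordRicci b G i j u =
      ∑ k, b.repr (curvatureForm (connectionForm b G) u (b k) (b j) (b i)) k := by
  have hp : ∀ l k i j, pderiv b l (christoffel b G k i j) u
      = b.repr (fderiv ℝ (connectionForm b G) u (b l) (b i) (b j)) k := by
    intro l k i j
    have h1 : christoffel b G k i j
        = fun y => coordL b k (connectionForm b G y (b i) (b j)) := by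
      ext y; rw [coordL_apply, repr_connectionForm]
    have h2 : DifferentiableAt ℝ (fun y => connectionForm b G y (b i) (b j)) u :=
      (h.clm_apply (differentiableAt_const _)).clm_apply (differentiableAt_const _)
    rw [pderiv, h1, ← fderiv_bilin_const h]
    have := ((coordL b k).hasFDerivAt.comp u h2.hasFDerivAt).fderiv
    rw [Function.comp_def] at this
    rw [this]
    rfl
  have hq : ∀ k i j l, ∑ m, christoffel b G k l m u * christoffel b G m i j u
      = b.repr (connectionForm b G u (b l) (connectionForm b G u (b i) (b j))) k := by
    intro k i j l
    rw [connectionForm_basis b G u i j]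
    simp only [map_sum, map_smul, Finsupp.coe_finsetSum, Finset.sum_apply, Finsupp.smul_apply,
      smul_eq_mul, repr_connectionForm]
    exact Finset.sum_congr rfl fun m _ => mul_comm _ _
  simp only [coordRicci, hp, Finset.sum_sub_distrib, hq, curvatureForm, map_add, map_sub,
    Finsupp.add_apply, Finsupp.sub_apply, Finset.sum_add_distrib]

variable {φ : E → E}

/-- `B'` is the pullback of `B` by the smooth map `φ`. -/
structure IsPullback (B B' : E → E →L[ℝ] E →L[ℝ] ℝ) (φ : E → E) (U V : Set E) : Prop where
  contDiffOn : ContDiffOn ℝ ∞ φ V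
  mapsTo : MapsTo φ V U
  eq : ∀ u ∈ V, ∀ v w, B' u v w = B (φ u) (fderiv ℝ φ u v) (fderiv ℝ φ u w)

theorem ContDiffOn.isSymm_snd_fderiv {F : Type*} [NormedAddCommGroup F] [NormedSpace ℝ F]
    {φ : E → F} (hV : IsOpen V)
    (hφ : ContDiffOn ℝ ∞ φ V) {u : E} (hu : u ∈ V) (v w : E) :
    fderiv ℝ (fderiv ℝ φ) u v w = fderiv ℝ (fderiv ℝ φ) u w v :=
  ((hφ.contDiffAt (hV.mem_nhds hu)).isSymmSndFDerivAt
    (by rw [minSmoothness_of_isRCLikeNormedField]; exact WithTop.coe_le_coe.2 (le_top : (2 : ℕ∞) ≤ ⊤))).eq v w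

theorem IsPullback.injective (hp : IsPullback B B' φ U V) (h' : IsMetricOn b B' V) {u : E}
    (hu : u ∈ V) : Function.Injective (fderiv ℝ φ u) := by
  refine (injective_iff_map_eq_zero _).mpr fun x hx => h'.eq_of_forall hu fun z => ?_
  rw [hp.eq u hu, hx]; simp

theorem IsPullback.surjective (hp : IsPullback B B' φ U V) (h' : IsMetricOn b B' V) {u : E}
    (hu : u ∈ V) : Function.Surjective (fderiv ℝ φ u) := by
  have : FiniteDimensional ℝ E := Module.Finite.of_basis b
  exact (LinearMap.injective_iff_surjective (f := (fderiv ℝ φ u : E →ₗ[ℝ] E))).mp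
    (hp.injective h' hu)

set_option synthInstance.maxHeartbeats 200000 in
/-- Transformation law of the Christoffel symbols. -/
theorem IsPullback.connectionForm_eq (hp : IsPullback B B' φ U V) (h : IsMetricOn b B U)
    (h' : IsMetricOn b B' V) {u : E} (hu : u ∈ V) (v w : E) :
    fderiv ℝ φ u (connectionForm b (formMatrix b B') u v w) =
      connectionForm b (formMatrix b B) (φ u) (fderiv ℝ φ u v) (fderiv ℝ φ u w)
        + fderiv ℝ (fderiv ℝ φ) u v w := by
  have hφ : HasFDerivAt φ (fderiv ℝ φ u) u :=
    ((hp.contDiffOn.contDiffAt (h'.isOpen.mem_nhds hu)).differentiableAt (by simp)).hasFDerivAt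
  have hφ1 : ContDiffOn ℝ ∞ (fderiv ℝ φ) V := hp.contDiffOn.fderiv_of_isOpen h'.isOpen (by simp)
  have hφ2 : HasFDerivAt (fderiv ℝ φ) (fderiv ℝ (fderiv ℝ φ) u) u :=
    ((hφ1.contDiffAt (h'.isOpen.mem_nhds hu)).differentiableAt (by simp)).hasFDerivAt
  have hB : HasFDerivAt (fun y => B (φ y)) ((fderiv ℝ B (φ u)).comp (fderiv ℝ φ u)) u :=
    HasFDerivAt.comp (g := B) u (h.differentiableAt (hp.mapsTo hu)).hasFDerivAt hφ
  have hs := hp.contDiffOn.isSymm_snd_fderiv h'.isOpen hu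
  have hc : ∀ v, HasFDerivAt (fun y => fderiv ℝ φ y v) ((fderiv ℝ (fderiv ℝ φ) u).flip v) u := by
    intro v
    have := hφ2.clm_apply (hasFDerivAt_const v u)
    simpa using this
  have hd : ∀ v w z, fderiv ℝ B' u v w z =
      fderiv ℝ B (φ u) (fderiv ℝ φ u v) (fderiv ℝ φ u w) (fderiv ℝ φ u z)
      + B (φ u) (fderiv ℝ (fderiv ℝ φ) u v w) (fderiv ℝ φ u z)
      + B (φ u) (fderiv ℝ φ u w) (fderiv ℝ (fderiv ℝ φ) u v z) := by
    intro v w z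
    have := hB.bilin_apply (hc w) (hc z) v
    rw [← fderiv_bilin_const (h'.differentiableAt hu)]
    have he : (fun y => B' y w z) =ᶠ[𝓝 u]
        fun y => B (φ y) (fderiv ℝ φ y w) (fderiv ℝ φ y z) := by
      filter_upwards [h'.isOpen.mem_nhds hu] with y hy using hp.eq y hy w z
    rw [he.fderiv_eq, this]
    rfl
  have hsurj := hp.surjective h' hu
  refine h.eq_of_forall (hp.mapsTo hu) fun z' => ?_
  obtain ⟨z, rfl⟩ := hsurj z'
  rw [← hp.eq u hu, h'.koszul hu, map_add, _root_.add_apply, h.koszul (hp.mapsTo hu),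
    hd, hd, hd, hs w v, hs z v, hs z w,
    h.symm _ (hp.mapsTo hu) (fderiv ℝ φ u v) (fderiv ℝ (fderiv ℝ φ) u w z),
    h.symm _ (hp.mapsTo hu) (fderiv ℝ φ u w) (fderiv ℝ (fderiv ℝ φ) u v z)]
  ring

theorem IsMetricOn.hasFDerivAt_connectionForm (h : IsMetricOn b B U) {u : E} (hu : u ∈ U) :
    HasFDerivAt (connectionForm b (formMatrix b B)) (fderiv ℝ (connectionForm b (formMatrix b B)) u)
      u := by
  have h1 := h.contDiffOn_connectionForm.contDiffAt (h.isOpen.mem_nhds hu)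
  exact (ContDiffAt.differentiableAt (n := ∞) h1 (by simp)).hasFDerivAt

set_option synthInstance.maxHeartbeats 200000 in
/-- The curvature operator is a tensor. -/
theorem IsPullback.curvatureForm_eq (hp : IsPullback B B' φ U V) (h : IsMetricOn b B U)
    (h' : IsMetricOn b B' V) {u : E} (hu : u ∈ V) (v w z : E) :
    fderiv ℝ φ u (curvatureForm (connectionForm b (formMatrix b B')) u v w z) =
      curvatureForm (connectionForm b (formMatrix b B)) (φ u) (fderiv ℝ φ u v) (fderiv ℝ φ u w)
        (fderiv ℝ φ u z) := by
  have hn := h'.isOpen.mem_nhds hu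
  have hφ : HasFDerivAt φ (fderiv ℝ φ u) u :=
    ((hp.contDiffOn.contDiffAt hn).differentiableAt (by simp)).hasFDerivAt
  have hφ1 : ContDiffOn ℝ ∞ (fderiv ℝ φ) V := hp.contDiffOn.fderiv_of_isOpen h'.isOpen (by simp)
  have hφ2 : HasFDerivAt (fderiv ℝ φ) (fderiv ℝ (fderiv ℝ φ) u) u :=
    ((hφ1.contDiffAt hn).differentiableAt (by simp)).hasFDerivAt
  have hφ3' : ContDiffOn ℝ ∞ (fderiv ℝ (fderiv ℝ φ)) V :=
    hφ1.fderiv_of_isOpen h'.isOpen (by simp)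
  have hφ3 : DifferentiableAt ℝ (fderiv ℝ (fderiv ℝ φ)) u :=
    (ContDiffOn.contDiffAt (n := ∞) hφ3' hn).differentiableAt (by simp)
  have hs : ∀ y ∈ V, ∀ v w, fderiv ℝ (fderiv ℝ φ) y v w = fderiv ℝ (fderiv ℝ φ) y w v :=
    fun y hy => hp.contDiffOn.isSymm_snd_fderiv h'.isOpen hy
  have hs3 : ∀ v z w, fderiv ℝ (fderiv ℝ (fderiv ℝ φ)) u v z w
      = fderiv ℝ (fderiv ℝ (fderiv ℝ φ)) u w z v := by
    have h1 : ∀ v z w, fderiv ℝ (fderiv ℝ (fderiv ℝ φ)) u v z w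
        = fderiv ℝ (fderiv ℝ (fderiv ℝ φ)) u v w z := by
      intro v z w
      rw [← fderiv_bilin_const hφ3, ← fderiv_bilin_const hφ3]
      congr 1
      apply Filter.EventuallyEq.fderiv_eq
      filter_upwards [hn] with y hy using hs y hy _ _
    have h2 : ∀ v z w, fderiv ℝ (fderiv ℝ (fderiv ℝ φ)) u v z w
        = fderiv ℝ (fderiv ℝ (fderiv ℝ φ)) u z v w := by
      intro v z w
      rw [hφ1.isSymm_snd_fderiv h'.isOpen hu]
    intro v z w
    rw [h1, h2, h1]
  have hc : ∀ v, HasFDerivAt (fun y => fderiv ℝ φ y v) ((fderiv ℝ (fderiv ℝ φ) u).flip v) u := by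
    intro v
    have := hφ2.clm_apply (hasFDerivAt_const v u)
    simpa using this
  have hsym := h.connectionForm_symm (hp.mapsTo hu)
  have htr : ∀ y ∈ V, ∀ v w, fderiv ℝ φ y (connectionForm b (formMatrix b B') y v w) =
      connectionForm b (formMatrix b B) (φ y) (fderiv ℝ φ y v) (fderiv ℝ φ y w)
        + fderiv ℝ (fderiv ℝ φ) y v w := fun y hy v w => hp.connectionForm_eq h h' hy v w
  have hΓ := h.hasFDerivAt_connectionForm (hp.mapsTo hu)
  have hΓ' := h'.hasFDerivAt_connectionForm hu
  unfold curvatureForm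
  generalize connectionForm b (formMatrix b B) = Γ at *
  generalize connectionForm b (formMatrix b B') = Γ' at *
  have hΓφ : HasFDerivAt (fun y => Γ (φ y)) ((fderiv ℝ Γ (φ u)).comp (fderiv ℝ φ u)) u :=
    HasFDerivAt.comp (g := Γ) u hΓ hφ
  have key : ∀ v w z, fderiv ℝ φ u (fderiv ℝ Γ' u v z w) =
      fderiv ℝ Γ (φ u) (fderiv ℝ φ u v) (fderiv ℝ φ u z) (fderiv ℝ φ u w)
      + Γ (φ u) (fderiv ℝ (fderiv ℝ φ) u v z) (fderiv ℝ φ u w)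
      + Γ (φ u) (fderiv ℝ φ u z) (fderiv ℝ (fderiv ℝ φ) u v w)
      + fderiv ℝ (fderiv ℝ (fderiv ℝ φ)) u v z w
      - fderiv ℝ (fderiv ℝ φ) u v (Γ' u z w) := by
    intro v w z
    have hg : HasFDerivAt (fun y => Γ' y z w) ((fderiv ℝ Γ' u).flip z |>.flip w) u := by
      have := (hΓ'.clm_apply (hasFDerivAt_const z u)).clm_apply (hasFDerivAt_const w u)
      simpa using this
    have h1 := hφ2.lin_apply hg v
    have h2 := hΓφ.bilin_apply (hc z) (hc w) v
    have h3 : (fun y => fderiv ℝ φ y (Γ' y z w)) =ᶠ[𝓝 u]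
        (fun y => Γ (φ y) (fderiv ℝ φ y z) (fderiv ℝ φ y w))
          + fun y => fderiv ℝ (fderiv ℝ φ) y z w := by
      filter_upwards [hn] with y hy using htr y hy z w
    rw [h3.fderiv_eq, fderiv_add
      ((hΓφ.clm_apply (hc z)).clm_apply (hc w)).differentiableAt
      ((hφ3.clm_apply (differentiableAt_const _)).clm_apply (differentiableAt_const _)),
      _root_.add_apply, h2, fderiv_bilin_const hφ3] at h1
    simp only [ContinuousLinearMap.flip_apply, ContinuousLinearMap.comp_apply] at h1
    rw [eq_sub_iff_add_eq, h1]
    abel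
  rw [map_add, map_sub, map_sub, key, key, htr u hu, htr u hu, htr u hu, htr u hu, map_add, map_add,
    hs3 w z v, hs u hu w v, hs u hu v z, hs u hu w z,
    hsym _ (fderiv ℝ φ u w), hsym _ (fderiv ℝ φ u v)]
  rw [hsym (fderiv ℝ φ u v) (Γ (φ u) _ _), hsym (fderiv ℝ φ u w) (Γ (φ u) _ _)]
  abel

end CoordinateFree
end

noncomputable section
set_option synthInstance.maxHeartbeats 200000
set_option linter.unusedSectionVars false

section ScalarInvariance

variable {E : Type*} [NormedAddCommGroup E] [NormedSpace ℝ E]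
  {ι : Type*} [Fintype ι] [DecidableEq ι]

variable {b : Module.Basis ι ℝ E} {B B' : E → E →L[ℝ] E →L[ℝ] ℝ} {U V : Set E} {φ : E → E}

theorem clm_add_apply {F G : Type*} [NormedAddCommGroup F] [NormedSpace ℝ F]
    [NormedAddCommGroup G] [NormedSpace ℝ G] (T : E →L[ℝ] F →L[ℝ] G) (x y : E) (z : F) :
    T (x + y) z = T x z + T y z := by simp

theorem clm_smul_apply {F G : Type*} [NormedAddCommGroup F] [NormedSpace ℝ F]
    [NormedAddCommGroup G] [NormedSpace ℝ G] (T : E →L[ℝ] F →L[ℝ] G) (c : ℝ) (x : E) (z : F) :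
    T (c • x) z = c • T x z := by simp

theorem clm_add_apply' {F G : Type*} [NormedAddCommGroup F] [NormedSpace ℝ F]
    [NormedAddCommGroup G] [NormedSpace ℝ G] (S T : F →L[ℝ] G) (x : F) :
    (S + T) x = S x + T x := rfl

theorem clm_smul_apply' {F G : Type*} [NormedAddCommGroup F] [NormedSpace ℝ F]
    [NormedAddCommGroup G] [NormedSpace ℝ G] (c : ℝ) (T : F →L[ℝ] G) (x : F) :
    (c • T) x = c • T x := rfl

/-- The curvature operator as a linear map in its first argument. -/
def curvatureEnd (Γ : E → E →L[ℝ] E →L[ℝ] E) (u w z : E) : E →ₗ[ℝ] E where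
  toFun v := curvatureForm Γ u v w z
  map_add' x y := by
    simp only [curvatureForm, clm_add_apply, clm_add_apply']
    simp only [ContinuousLinearMap.map_add]
    abel
  map_smul' c x := by
    simp only [curvatureForm, clm_smul_apply, clm_smul_apply']
    simp only [ContinuousLinearMap.map_smul,
      RingHom.id_apply, smul_add, smul_sub]

theorem curvatureEnd_apply (Γ : E → E →L[ℝ] E →L[ℝ] E) (u v w z : E) :
    curvatureEnd Γ u w z v = curvatureForm Γ u v w z := rfl

/-- The Ricci form, `(w, z)` being mapped to the trace of `v ↦ R(v, w) z`. -/
def ricciForm (Γ : E → E →L[ℝ] E →L[ℝ] E) (u : E) : E →ₗ[ℝ] E →ₗ[ℝ] ℝ :=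
  LinearMap.mk₂ ℝ (fun w z => LinearMap.trace ℝ E (curvatureEnd Γ u w z))
    (fun w w' z => by
      rw [← map_add]; congr 1; ext v
      simp only [LinearMap.add_apply, curvatureEnd_apply]
      simp only [curvatureForm, clm_add_apply, clm_add_apply']
      simp only [ContinuousLinearMap.map_add]
      abel)
    (fun c w z => by
      rw [← map_smul]; congr 1; ext v
      simp only [LinearMap.smul_apply, curvatureEnd_apply]
      simp only [curvatureForm, clm_smul_apply, clm_smul_apply']
      simp only [ContinuousLinearMap.map_smul,
        smul_add, smul_sub])
    (fun w z z' => by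
      rw [← map_add]; congr 1; ext v
      simp only [LinearMap.add_apply, curvatureEnd_apply]
      simp only [curvatureForm, clm_add_apply, clm_add_apply']
      simp only [ContinuousLinearMap.map_add]
      abel)
    (fun c w z => by
      rw [← map_smul]; congr 1; ext v
      simp only [LinearMap.smul_apply, curvatureEnd_apply]
      simp only [curvatureForm, clm_smul_apply, clm_smul_apply']
      simp only [ContinuousLinearMap.map_smul,
        smul_add, smul_sub])

theorem IsMetricOn.coordRicci_eq_ricciForm (h : IsMetricOn b B U) {u : E} (hu : u ∈ U) (i j : ι) :
    coordRicci b (formMatrix b B) i j u =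
      ricciForm (connectionForm b (formMatrix b B)) u (b j) (b i) := by
  rw [coordRicci_eq _ (h.hasFDerivAt_connectionForm hu).differentiableAt]
  simp [ricciForm, LinearMap.trace_eq_matrix_trace ℝ b, Matrix.trace, LinearMap.toMatrix_apply,
    curvatureEnd_apply]

theorem IsPullback.ricciForm_eq (hp : IsPullback B B' φ U V) (h : IsMetricOn b B U)
    (h' : IsMetricOn b B' V) {u : E} (hu : u ∈ V) (w z : E) :
    ricciForm (connectionForm b (formMatrix b B')) u w z =
      ricciForm (connectionForm b (formMatrix b B)) (φ u) (fderiv ℝ φ u w) (fderiv ℝ φ u z) := by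
  let e : E ≃ₗ[ℝ] E := LinearEquiv.ofBijective (fderiv ℝ φ u : E →ₗ[ℝ] E)
    ⟨hp.injective h' hu, hp.surjective h' hu⟩
  simp only [ricciForm, LinearMap.mk₂_apply]
  rw [← LinearMap.trace_conj' _ e]
  congr 1
  ext v
  obtain ⟨v, rfl⟩ := e.surjective v
  rw [LinearEquiv.conj_apply_apply, e.symm_apply_apply]
  exact hp.curvatureForm_eq h h' hu v w z

theorem toMatrix_bilin_comp (b : Module.Basis ι ℝ E) (T : E →ₗ[ℝ] E →ₗ[ℝ] ℝ) (J : E →ₗ[ℝ] E) :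
    (Matrix.of fun i j => T (J (b i)) (J (b j))) =
      (LinearMap.toMatrix b b J).transpose * (Matrix.of fun i j => T (b i) (b j))
        * LinearMap.toMatrix b b J := by
  ext i j
  conv_lhs => rw [Matrix.of_apply, ← b.sum_repr (J (b i)), ← b.sum_repr (J (b j))]
  simp only [map_sum, map_smul, LinearMap.sum_apply, LinearMap.smul_apply, smul_eq_mul,
    Matrix.mul_apply, Matrix.transpose_apply, LinearMap.toMatrix_apply, Matrix.of_apply,
    Finset.mul_sum, Finset.sum_mul]
  exact Finset.sum_congr rfl fun k _ => Finset.sum_congr rfl fun l _ => by ring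

theorem IsPullback.formMatrix_eq (hp : IsPullback B B' φ U V) (b : Module.Basis ι ℝ E)
    {u : E} (hu : u ∈ V) :
    formMatrix b B' u = (LinearMap.toMatrix b b (fderiv ℝ φ u)).transpose *
      formMatrix b B (φ u) * LinearMap.toMatrix b b (fderiv ℝ φ u) := by
  have := toMatrix_bilin_comp b ((ContinuousLinearMap.coeLM ℝ).comp (B (φ u) : E →ₗ[ℝ] E →L[ℝ] ℝ))
    (fderiv ℝ φ u)
  exact Eq.trans (Matrix.ext fun i j => hp.eq u hu _ _) this

theorem IsPullback.det_formMatrix (hp : IsPullback B B' φ U V) (b : Module.Basis ι ℝ E)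
    {u : E} (hu : u ∈ V) :
    (formMatrix b B' u).det = (fderiv ℝ φ u).det ^ 2 * (formMatrix b B (φ u)).det := by
  rw [hp.formMatrix_eq b hu, Matrix.det_mul, Matrix.det_mul, Matrix.det_transpose,
    LinearMap.det_toMatrix]
  change LinearMap.det _ * _ * LinearMap.det _ = (LinearMap.det _) ^ 2 * _
  ring

theorem coordScalarCurvature_eq_trace (b : Module.Basis ι ℝ E) (G : E → Matrix ι ι ℝ) (u : E) :
    coordScalarCurvature b G u =
      ((G u)⁻¹ * (Matrix.of fun i j => coordRicci b G j i u)).trace := by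
  simp [coordScalarCurvature, Matrix.trace, Matrix.mul_apply]

/-- The scalar curvature is invariant under changes of coordinates. -/
theorem IsPullback.coordScalarCurvature_eq (hp : IsPullback B B' φ U V) (h : IsMetricOn b B U)
    (h' : IsMetricOn b B' V) {u : E} (hu : u ∈ V) :
    coordScalarCurvature b (formMatrix b B') u
      = coordScalarCurvature b (formMatrix b B) (φ u) := by
  have h0 : IsUnit (formMatrix b B (φ u)).det := (h.det_ne_zero _ (hp.mapsTo hu)).isUnit
  have h0' := h'.det_ne_zero u hu
  have hG := hp.formMatrix_eq b hu
  have hR := toMatrix_bilin_comp b (ricciForm (connectionForm b (formMatrix b B)) (φ u))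
    (fderiv ℝ φ u)
  simp only [coordScalarCurvature_eq_trace, h.coordRicci_eq_ricciForm (hp.mapsTo hu),
    h'.coordRicci_eq_ricciForm hu, hp.ricciForm_eq h h' hu]
  rw [hG] at h0' ⊢
  erw [hR]
  generalize LinearMap.toMatrix b b (fderiv ℝ φ u : E →ₗ[ℝ] E) = P at *
  have hP : IsUnit P.det := by
    rw [Matrix.det_mul] at h0'
    exact (right_ne_zero_of_mul h0').isUnit
  have hPt : IsUnit P.transpose.det := by rwa [Matrix.det_transpose]
  rw [Matrix.mul_inv_rev, Matrix.mul_inv_rev]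
  have e1 : ∀ R : Matrix ι ι ℝ, P⁻¹ * ((formMatrix b B (φ u))⁻¹ * (P.transpose)⁻¹) *
      (P.transpose * R * P) = P⁻¹ * ((formMatrix b B (φ u))⁻¹ * R) * P := by
    intro R
    simp only [Matrix.mul_assoc]
    rw [Matrix.nonsing_inv_mul_cancel_left _ _ hPt]
  erw [e1]
  rw [ Matrix.trace_mul_comm, ← Matrix.mul_assoc, Matrix.mul_nonsing_inv _ hP, Matrix.one_mul]

theorem pderiv_congr {f g : E → ℝ} {u : E} (h : f =ᶠ[𝓝 u] g) (b : Module.Basis ι ℝ E) (i : ι) :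
    pderiv b i f =ᶠ[𝓝 u] pderiv b i g := by
  filter_upwards [h.fderiv (𝕜 := ℝ)] with y hy
  rw [pderiv, pderiv, hy]

theorem christoffel_congr {G G' : E → Matrix ι ι ℝ} {u : E} (h : G =ᶠ[𝓝 u] G')
    (b : Module.Basis ι ℝ E) (k i j : ι) :
    christoffel b G k i j =ᶠ[𝓝 u] christoffel b G' k i j := by
  have hp : ∀ l i j, pderiv b l (fun v => G v i j) =ᶠ[𝓝 u] pderiv b l (fun v => G' v i j) :=
    fun l i j => pderiv_congr (h.mono fun y hy => by simp only [hy]) b l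
  have h1 : ∀ᶠ y in 𝓝 u, ∀ l i j,
      pderiv b l (fun v => G v i j) y = pderiv b l (fun v => G' v i j) y :=
    eventually_all.2 fun l => eventually_all.2 fun i => eventually_all.2 fun j => hp l i j
  filter_upwards [h1, h] with y hy hy'
  simp only [christoffel, hy, hy']

theorem coordScalarCurvature_congr {G G' : E → Matrix ι ι ℝ} {u : E} (h : G =ᶠ[𝓝 u] G')
    (b : Module.Basis ι ℝ E) : coordScalarCurvature b G u = coordScalarCurvature b G' u := by
  have h1 := christoffel_congr h b
  simp only [coordScalarCurvature, coordRicci, h.eq_of_nhds, fun k i j => (h1 k i j).eq_of_nhds,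
    fun l k i j => (pderiv_congr (h1 k i j) b l).eq_of_nhds]

end ScalarInvariance
end

noncomputable section
set_option linter.unusedSectionVars false

section Block

variable {E : Type*} [NormedAddCommGroup E] [NormedSpace ℝ E]
  {κ : Type*} [Fintype κ] [DecidableEq κ]

theorem pderiv_mul {ι : Type*} {b : Module.Basis ι ℝ E} {f g : E → ℝ} {u : E}
    (hf : DifferentiableAt ℝ f u) (hg : DifferentiableAt ℝ g u) (i : ι) :
    pderiv b i (fun y => f y * g y) u = pderiv b i f u * g u + f u * pderiv b i g u := by
  simp [pderiv, fderiv_fun_mul hf hg]; ring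

theorem pderiv_sum {ι α : Type*} {b : Module.Basis ι ℝ E} {f : α → E → ℝ} {u : E} {s : Finset α}
    (hf : ∀ a ∈ s, DifferentiableAt ℝ (f a) u) (i : ι) :
    pderiv b i (fun y => ∑ a ∈ s, f a y) u = ∑ a ∈ s, pderiv b i (f a) u := by
  simp [pderiv, fderiv_fun_sum hf, _root_.sum_apply]

theorem pderiv_const {ι : Type*} (b : Module.Basis ι ℝ E) (c : ℝ) (u : E) (i : ι) :
    pderiv b i (fun _ => c) u = 0 := by
  simp [pderiv]

theorem pderiv_const_mul {ι : Type*} {b : Module.Basis ι ℝ E} {f : E → ℝ} {u : E}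
    (hf : DifferentiableAt ℝ f u) (c : ℝ) (i : ι) :
    pderiv b i (fun y => c * f y) u = c * pderiv b i f u := by
  rw [pderiv_mul (differentiableAt_const c) hf, pderiv_const, zero_mul, zero_add]

theorem pderiv_inv {ι : Type*} {b : Module.Basis ι ℝ E} {f : E → ℝ} {u : E}
    (hf : DifferentiableAt ℝ f u) (h0 : f u ≠ 0) (i : ι) :
    pderiv b i (fun y => (f y)⁻¹) u = - pderiv b i f u / f u ^ 2 := by
  have := ((hasDerivAt_inv h0).comp_hasFDerivAt u hf.hasFDerivAt).fderiv
  rw [Function.comp_def] at this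
  rw [pderiv, this, pderiv]
  simp [div_eq_mul_inv, mul_comm]

/-- The block diagonal metric with blocks `c F` and `γ`. -/
def blockMetric (F : E → ℝ) (γ : E → Matrix κ κ ℝ) (c : ℝ) (y : E) :
    Matrix (Fin 1 ⊕ κ) (Fin 1 ⊕ κ) ℝ :=
  Matrix.fromBlocks (Matrix.of fun _ _ => c * F y) 0 0 (γ y)

theorem blockMetric_det (F : E → ℝ) (γ : E → Matrix κ κ ℝ) (c : ℝ) (y : E) :
    (blockMetric F γ c y).det = c * F y * (γ y).det := by
  simp [blockMetric, Matrix.det_fromBlocks_zero₂₁]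

theorem blockMetric_inv {F : E → ℝ} {γ : E → Matrix κ κ ℝ} {c : ℝ} {y : E} (hc : c ≠ 0)
    (hF : F y ≠ 0) (hγ : (γ y).det ≠ 0) :
    (blockMetric F γ c y)⁻¹ =
      Matrix.fromBlocks (Matrix.of fun _ _ => c⁻¹ * (F y)⁻¹) 0 0 (γ y)⁻¹ := by
  refine Matrix.inv_eq_right_inv ?_
  rw [blockMetric, Matrix.fromBlocks_multiply, ← Matrix.fromBlocks_one]
  congr 1
  · ext i j
    fin_cases i; fin_cases j
    simp [Matrix.mul_apply]
    field_simp
  · simp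
  · simp
  · simp [Matrix.mul_nonsing_inv _ hγ.isUnit]

variable {b : Module.Basis (Fin 1 ⊕ κ) ℝ E} {F : E → ℝ} {γ : E → Matrix κ κ ℝ} {W : Set E}

/-- A block diagonal metric, smooth on the open set `W`, whose first block depends on the first
coordinate only. -/
structure IsBlockOn (b : Module.Basis (Fin 1 ⊕ κ) ℝ E) (F : E → ℝ) (γ : E → Matrix κ κ ℝ)
    (W : Set E) : Prop where
  isOpen : IsOpen W
  contDiffOn_fst : ContDiffOn ℝ ∞ F W
  contDiffOn_snd : ∀ i j, ContDiffOn ℝ ∞ (fun y => γ y i j) W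
  fst_ne_zero : ∀ y ∈ W, F y ≠ 0
  det_ne_zero : ∀ y ∈ W, (γ y).det ≠ 0
  symm : ∀ y ∈ W, ∀ i j, γ y i j = γ y j i
  pderiv_fst : ∀ y ∈ W, ∀ k, pderiv b (Sum.inr k) F y = 0

/-- Derivative of a matrix in the first coordinate. -/
def timeDeriv (b : Module.Basis (Fin 1 ⊕ κ) ℝ E) (γ : E → Matrix κ κ ℝ) (y : E) : Matrix κ κ ℝ :=
  Matrix.of fun i j => pderiv b (Sum.inl 0) (fun v => γ v i j) y

/-- The endomorphism `γ⁻¹ ∂ₜ γ`. -/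
def shapeMatrix (b : Module.Basis (Fin 1 ⊕ κ) ℝ E) (γ : E → Matrix κ κ ℝ) (y : E) : Matrix κ κ ℝ :=
  (γ y)⁻¹ * timeDeriv b γ y

/-- Christoffel symbols of the second block. -/
def spaceChristoffel (b : Module.Basis (Fin 1 ⊕ κ) ℝ E) (γ : E → Matrix κ κ ℝ) (k i j : κ)
    (y : E) : ℝ :=
  (1 / 2) * ∑ l, (γ y)⁻¹ k l *
    (pderiv b (Sum.inr i) (fun v => γ v j l) y + pderiv b (Sum.inr j) (fun v => γ v i l) y
      - pderiv b (Sum.inr l) (fun v => γ v i j) y)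

namespace IsBlockOn

variable (h : IsBlockOn b F γ W) {y : E} (hy : y ∈ W) {c : ℝ} (hc : c ≠ 0)
include h hy

theorem differentiableAt_fst : DifferentiableAt ℝ F y :=
  (h.contDiffOn_fst.contDiffAt (h.isOpen.mem_nhds hy)).differentiableAt (by simp)

theorem differentiableAt_snd (i j : κ) : DifferentiableAt ℝ (fun v => γ v i j) y :=
  ((h.contDiffOn_snd i j).contDiffAt (h.isOpen.mem_nhds hy)).differentiableAt (by simp)

theorem timeDeriv_symm (i j : κ) : timeDeriv b γ y i j = timeDeriv b γ y j i := by
  refine (pderiv_congr ?_ b _).eq_of_nhds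
  filter_upwards [h.isOpen.mem_nhds hy] with v hv using h.symm v hv i j

theorem pderiv_blockMetric_inl (c : ℝ) (a : Fin 1 ⊕ κ) :
    pderiv b a (fun v => blockMetric F γ c v (Sum.inl 0) (Sum.inl 0)) y = c * pderiv b a F y := by
  simp [blockMetric, pderiv_const_mul (h.differentiableAt_fst hy)]

omit h hy in
theorem pderiv_blockMetric_inl_inr (c : ℝ) (a : Fin 1 ⊕ κ) (j : κ) :
    pderiv b a (fun v => blockMetric F γ c v (Sum.inl 0) (Sum.inr j)) y = 0 := by
  simp [blockMetric, pderiv_const]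

omit h hy in
theorem pderiv_blockMetric_inr_inl (c : ℝ) (a : Fin 1 ⊕ κ) (j : κ) :
    pderiv b a (fun v => blockMetric F γ c v (Sum.inr j) (Sum.inl 0)) y = 0 := by
  simp [blockMetric, pderiv_const]

omit h hy in
theorem pderiv_blockMetric_inr_inr (c : ℝ) (a : Fin 1 ⊕ κ) (i j : κ) :
    pderiv b a (fun v => blockMetric F γ c v (Sum.inr i) (Sum.inr j)) y
      = pderiv b a (fun v => γ v i j) y := rfl

include hc

theorem christoffel_inl_inl_inl :
    christoffel b (blockMetric F γ c) (Sum.inl 0) (Sum.inl 0) (Sum.inl 0) y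
      = pderiv b (Sum.inl 0) F y / (2 * F y) := by
  have := h.fst_ne_zero y hy
  simp only [christoffel, Fintype.sum_sum_type, Finset.univ_unique, Finset.sum_singleton,
    blockMetric_inv hc this (h.det_ne_zero y hy), Fin.default_eq_zero,
    h.pderiv_blockMetric_inl hy, Matrix.fromBlocks_apply₁₁, Matrix.fromBlocks_apply₁₂,
    Matrix.of_apply, Matrix.zero_apply, zero_mul, Finset.sum_const_zero]
  field_simp
  ring

theorem christoffel_inl_inl_inr (j : κ) :
    christoffel b (blockMetric F γ c) (Sum.inl 0) (Sum.inl 0) (Sum.inr j) y = 0 := by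
  have := h.fst_ne_zero y hy
  simp only [christoffel, Fintype.sum_sum_type, Finset.univ_unique, Finset.sum_singleton,
    blockMetric_inv hc this (h.det_ne_zero y hy), Fin.default_eq_zero,
    h.pderiv_blockMetric_inl hy, pderiv_blockMetric_inl_inr, pderiv_blockMetric_inr_inl,
    Matrix.fromBlocks_apply₁₁, Matrix.fromBlocks_apply₁₂, h.pderiv_fst y hy,
    Matrix.of_apply, Matrix.zero_apply, zero_mul, Finset.sum_const_zero]
  ring

theorem christoffel_inl_inr_inl (j : κ) :
    christoffel b (blockMetric F γ c) (Sum.inl 0) (Sum.inr j) (Sum.inl 0) y = 0 := by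
  have := h.fst_ne_zero y hy
  simp only [christoffel, Fintype.sum_sum_type, Finset.univ_unique, Finset.sum_singleton,
    blockMetric_inv hc this (h.det_ne_zero y hy), Fin.default_eq_zero,
    h.pderiv_blockMetric_inl hy, pderiv_blockMetric_inl_inr, pderiv_blockMetric_inr_inl,
    Matrix.fromBlocks_apply₁₁, Matrix.fromBlocks_apply₁₂, h.pderiv_fst y hy,
    Matrix.of_apply, Matrix.zero_apply, zero_mul, Finset.sum_const_zero]
  ring

theorem christoffel_inl_inr_inr (i j : κ) :
    christoffel b (blockMetric F γ c) (Sum.inl 0) (Sum.inr i) (Sum.inr j) y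
      = c⁻¹ * (-1 / 2 * (F y)⁻¹ * timeDeriv b γ y i j) := by
  have := h.fst_ne_zero y hy
  simp only [christoffel, Fintype.sum_sum_type, Finset.univ_unique, Finset.sum_singleton,
    blockMetric_inv hc this (h.det_ne_zero y hy), Fin.default_eq_zero,
    pderiv_blockMetric_inr_inr, pderiv_blockMetric_inr_inl,
    Matrix.fromBlocks_apply₁₁, Matrix.fromBlocks_apply₁₂,
    Matrix.of_apply, Matrix.zero_apply, zero_mul, Finset.sum_const_zero, timeDeriv]
  ring

theorem christoffel_inr_inl_inl (k : κ) :
    christoffel b (blockMetric F γ c) (Sum.inr k) (Sum.inl 0) (Sum.inl 0) y = 0 := by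
  have := h.fst_ne_zero y hy
  simp [christoffel, Fintype.sum_sum_type,
    blockMetric_inv hc this (h.det_ne_zero y hy),
    h.pderiv_blockMetric_inl hy, pderiv_blockMetric_inl_inr, h.pderiv_fst y hy]

theorem christoffel_inr_inl_inr (k j : κ) :
    christoffel b (blockMetric F γ c) (Sum.inr k) (Sum.inl 0) (Sum.inr j) y
      = 1 / 2 * shapeMatrix b γ y k j := by
  have := h.fst_ne_zero y hy
  simp only [christoffel, Fintype.sum_sum_type, Finset.univ_unique, Finset.sum_singleton,
    blockMetric_inv hc this (h.det_ne_zero y hy), Fin.default_eq_zero,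
    pderiv_blockMetric_inr_inr, pderiv_blockMetric_inl_inr,
    Matrix.fromBlocks_apply₂₂, Matrix.fromBlocks_apply₂₁,
    Matrix.zero_apply, zero_mul, zero_add, add_zero, sub_zero, shapeMatrix, Matrix.mul_apply]
  congr 1
  exact Finset.sum_congr rfl fun l _ => by rw [h.timeDeriv_symm hy l j]; rfl

theorem christoffel_inr_inr_inl (k j : κ) :
    christoffel b (blockMetric F γ c) (Sum.inr k) (Sum.inr j) (Sum.inl 0) y
      = 1 / 2 * shapeMatrix b γ y k j := by
  have := h.fst_ne_zero y hy
  simp only [christoffel, Fintype.sum_sum_type, Finset.univ_unique, Finset.sum_singleton,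
    blockMetric_inv hc this (h.det_ne_zero y hy), Fin.default_eq_zero,
    pderiv_blockMetric_inr_inr, pderiv_blockMetric_inl_inr, pderiv_blockMetric_inr_inl,
    Matrix.fromBlocks_apply₂₂, Matrix.fromBlocks_apply₂₁,
    Matrix.zero_apply, zero_mul, zero_add, sub_zero, shapeMatrix, Matrix.mul_apply]
  congr 1
  exact Finset.sum_congr rfl fun l _ => by rw [h.timeDeriv_symm hy l j]; rfl

theorem christoffel_inr_inr_inr (k i j : κ) :
    christoffel b (blockMetric F γ c) (Sum.inr k) (Sum.inr i) (Sum.inr j) y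
      = spaceChristoffel b γ k i j y := by
  have := h.fst_ne_zero y hy
  simp only [christoffel, Fintype.sum_sum_type, Finset.univ_unique, Finset.sum_singleton,
    blockMetric_inv hc this (h.det_ne_zero y hy), Fin.default_eq_zero,
    pderiv_blockMetric_inr_inr, 
    Matrix.fromBlocks_apply₂₂, Matrix.fromBlocks_apply₂₁,
    Matrix.zero_apply, zero_mul, zero_add, spaceChristoffel]

omit hy hc in
theorem contDiffOn_timeDeriv (i j : κ) : ContDiffOn ℝ ∞ (fun v => timeDeriv b γ v i j) W :=
  contDiffOn_pderiv h.isOpen (h.contDiffOn_snd i j) b _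

omit hy hc in
theorem contDiffOn_shapeMatrix (i j : κ) : ContDiffOn ℝ ∞ (fun v => shapeMatrix b γ v i j) W := by
  simp only [shapeMatrix, Matrix.mul_apply]
  exact ContDiffOn.sum fun k _ =>
    (contDiffOn_inv_entry h.contDiffOn_snd h.det_ne_zero i k).mul (h.contDiffOn_timeDeriv k j)

omit hc in
theorem differentiableAt_timeDeriv (i j : κ) :
    DifferentiableAt ℝ (fun v => timeDeriv b γ v i j) y :=
  ((h.contDiffOn_timeDeriv i j).contDiffAt (h.isOpen.mem_nhds hy)).differentiableAt (by simp)

omit hc in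
theorem differentiableAt_shapeMatrix (i j : κ) :
    DifferentiableAt ℝ (fun v => shapeMatrix b γ v i j) y :=
  ((h.contDiffOn_shapeMatrix i j).contDiffAt (h.isOpen.mem_nhds hy)).differentiableAt (by simp)

theorem coordRicci_inl :
    coordRicci b (blockMetric F γ c) (Sum.inl 0) (Sum.inl 0) y
      = - (1 / 2) * pderiv b (Sum.inl 0) (fun v => (shapeMatrix b γ v).trace) y
        + (1 / 4) * (shapeMatrix b γ y).trace * (pderiv b (Sum.inl 0) F y / F y)
        - (1 / 4) * (shapeMatrix b γ y * shapeMatrix b γ y).trace := by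
  have e1 : ∀ k, pderiv b (Sum.inr k)
      (christoffel b (blockMetric F γ c) (Sum.inr k) (Sum.inl 0) (Sum.inl 0)) y = 0 := by
    intro k
    rw [← pderiv_const b 0 y (Sum.inr k)]
    refine (pderiv_congr ?_ b _).eq_of_nhds
    filter_upwards [h.isOpen.mem_nhds hy] with v hv using h.christoffel_inr_inl_inl hv hc k
  have e2 : ∀ k, pderiv b (Sum.inl 0)
      (christoffel b (blockMetric F γ c) (Sum.inr k) (Sum.inl 0) (Sum.inr k)) y
      = 1 / 2 * pderiv b (Sum.inl 0) (fun v => shapeMatrix b γ v k k) y := by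
    intro k
    rw [← pderiv_const_mul (h.differentiableAt_shapeMatrix hy k k)]
    refine (pderiv_congr ?_ b _).eq_of_nhds
    filter_upwards [h.isOpen.mem_nhds hy] with v hv using h.christoffel_inr_inl_inr hv hc k k
  have e3 : pderiv b (Sum.inl 0) (fun v => (shapeMatrix b γ v).trace) y
      = ∑ k, pderiv b (Sum.inl 0) (fun v => shapeMatrix b γ v k k) y :=
    pderiv_sum (fun k _ => h.differentiableAt_shapeMatrix hy k k) _
  have h0 := h.fst_ne_zero y hy
  rw [e3]
  simp only [coordRicci, Fintype.sum_sum_type, Finset.univ_unique, Finset.sum_singleton,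
    Fin.default_eq_zero, e1, e2, h.christoffel_inl_inl_inl hy hc,
    h.christoffel_inl_inl_inr hy hc,
    h.christoffel_inr_inl_inl hy hc, h.christoffel_inr_inl_inr hy hc,
    h.christoffel_inr_inr_inl hy hc, sub_self, zero_add, zero_sub, mul_zero, sub_zero,
    Finset.sum_const_zero, Matrix.trace, Matrix.diag_apply, Matrix.mul_apply,
    Finset.sum_add_distrib, Finset.sum_neg_distrib]
  have f1 : ∑ k, 1 / 2 * pderiv b (Sum.inl 0) (fun v => shapeMatrix b γ v k k) y
      = 1 / 2 * ∑ k, pderiv b (Sum.inl 0) (fun v => shapeMatrix b γ v k k) y := by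
    rw [Finset.mul_sum]
  have f2 : ∑ k, 1 / 2 * shapeMatrix b γ y k k * (pderiv b (Sum.inl 0) F y / (2 * F y))
      = 1 / 4 * (∑ k, shapeMatrix b γ y k k) * (pderiv b (Sum.inl 0) F y / F y) := by
    rw [Finset.mul_sum, Finset.sum_mul]
    exact Finset.sum_congr rfl fun k _ => by field_simp; ring
  have f3 : ∑ k, ∑ l, 1 / 2 * shapeMatrix b γ y k l * (1 / 2 * shapeMatrix b γ y l k)
      = 1 / 4 * ∑ k, ∑ l, shapeMatrix b γ y k l * shapeMatrix b γ y l k := by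
    simp only [Finset.mul_sum]
    exact Finset.sum_congr rfl fun k _ => Finset.sum_congr rfl fun l _ => by ring
  rw [f1, f2, f3]
  ring

omit h hy hc in
/-- Ricci tensor of the second block. -/
def _root_.spaceRicci (b : Module.Basis (Fin 1 ⊕ κ) ℝ E) (γ : E → Matrix κ κ ℝ) (i j : κ) (y : E) :
    ℝ :=
  (∑ k, (pderiv b (Sum.inr k) (spaceChristoffel b γ k i j) y
      - pderiv b (Sum.inr j) (spaceChristoffel b γ k i k) y))
    + ∑ k, ∑ l, (spaceChristoffel b γ k k l y * spaceChristoffel b γ l i j y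
        - spaceChristoffel b γ k j l y * spaceChristoffel b γ l i k y)

theorem coordRicci_inr (i j : κ) :
    coordRicci b (blockMetric F γ c) (Sum.inr i) (Sum.inr j) y
      = spaceRicci b γ i j y + c⁻¹ * (
        pderiv b (Sum.inl 0) (fun v => -1 / 2 * (F v)⁻¹ * timeDeriv b γ v i j) y
        + (pderiv b (Sum.inl 0) F y / (2 * F y) + 1 / 2 * (shapeMatrix b γ y).trace)
          * (-1 / 2 * (F y)⁻¹ * timeDeriv b γ y i j)
        + 1 / 4 * (F y)⁻¹ * (∑ l, timeDeriv b γ y j l * shapeMatrix b γ y l i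
          + ∑ k, shapeMatrix b γ y k j * timeDeriv b γ y i k)) := by
  have h0 := h.fst_ne_zero y hy
  have e1 : pderiv b (Sum.inl 0)
      (christoffel b (blockMetric F γ c) (Sum.inl 0) (Sum.inr i) (Sum.inr j)) y
      = c⁻¹ * pderiv b (Sum.inl 0) (fun v => -1 / 2 * (F v)⁻¹ * timeDeriv b γ v i j) y := by
    rw [← pderiv_const_mul]
    · refine (pderiv_congr ?_ b _).eq_of_nhds
      filter_upwards [h.isOpen.mem_nhds hy] with v hv using h.christoffel_inl_inr_inr hv hc i j
    · exact (((h.differentiableAt_fst hy).inv h0).const_mul _).mul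
        (h.differentiableAt_timeDeriv hy i j)
  have e2 : pderiv b (Sum.inr j)
      (christoffel b (blockMetric F γ c) (Sum.inl 0) (Sum.inr i) (Sum.inl 0)) y = 0 := by
    rw [← pderiv_const b 0 y (Sum.inr j)]
    refine (pderiv_congr ?_ b _).eq_of_nhds
    filter_upwards [h.isOpen.mem_nhds hy] with v hv using h.christoffel_inl_inr_inl hv hc i
  have e3 : ∀ a k i j, pderiv b a
      (christoffel b (blockMetric F γ c) (Sum.inr k) (Sum.inr i) (Sum.inr j)) y =
      pderiv b a (spaceChristoffel b γ k i j) y := by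
    intro a k i j
    refine (pderiv_congr ?_ b _).eq_of_nhds
    filter_upwards [h.isOpen.mem_nhds hy] with v hv using h.christoffel_inr_inr_inr hv hc k i j
  simp only [coordRicci, Fintype.sum_sum_type, Finset.univ_unique, Finset.sum_singleton,
    Fin.default_eq_zero, e1, e2, e3, h.christoffel_inl_inl_inl hy hc,
    h.christoffel_inl_inl_inr hy hc, h.christoffel_inl_inr_inl hy hc,
    h.christoffel_inl_inr_inr hy hc, h.christoffel_inr_inr_inr hy hc,
    h.christoffel_inr_inr_inl hy hc, spaceRicci, zero_mul, mul_zero,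
    Finset.sum_add_distrib, Finset.sum_sub_distrib, Matrix.trace, Matrix.diag_apply]
  have f1 : ∑ l, c⁻¹ * (-1 / 2 * (F y)⁻¹ * timeDeriv b γ y j l) * (1 / 2 * shapeMatrix b γ y l i)
      = - (c⁻¹ * (1 / 4 * (F y)⁻¹ * ∑ l, timeDeriv b γ y j l * shapeMatrix b γ y l i)) := by
    rw [Finset.mul_sum, Finset.mul_sum, ← Finset.sum_neg_distrib]
    exact Finset.sum_congr rfl fun l _ => by ring
  have f2 : ∑ k, 1 / 2 * shapeMatrix b γ y k j * (c⁻¹ * (-1 / 2 * (F y)⁻¹ * timeDeriv b γ y i k))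
      = - (c⁻¹ * (1 / 4 * (F y)⁻¹ * ∑ k, shapeMatrix b γ y k j * timeDeriv b γ y i k)) := by
    rw [Finset.mul_sum, Finset.mul_sum, ← Finset.sum_neg_distrib]
    exact Finset.sum_congr rfl fun l _ => by ring
  have f3 : ∑ k, 1 / 2 * shapeMatrix b γ y k k * (c⁻¹ * (-1 / 2 * (F y)⁻¹ * timeDeriv b γ y i j))
      = 1 / 2 * (∑ k, shapeMatrix b γ y k k) * (c⁻¹ * (-1 / 2 * (F y)⁻¹ * timeDeriv b γ y i j)) := by
    rw [Finset.mul_sum, Finset.sum_mul]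
  simp only [f1, f2, f3, Finset.sum_const_zero]
  ring

omit hc in
theorem pderiv_inv_entry (i j : κ) :
    pderiv b (Sum.inl 0) (fun v => (γ v)⁻¹ i j) y
      = - ((γ y)⁻¹ * timeDeriv b γ y * (γ y)⁻¹) i j := by
  have hu : IsUnit (γ y).det := (h.det_ne_zero y hy).isUnit
  have hd : ∀ i j, DifferentiableAt ℝ (fun v => (γ v)⁻¹ i j) y := fun i j =>
    ((contDiffOn_inv_entry h.contDiffOn_snd h.det_ne_zero i j).contDiffAt
      (h.isOpen.mem_nhds hy)).differentiableAt (by simp)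
  have h1 : timeDeriv b (fun v => (γ v)⁻¹) y * γ y + (γ y)⁻¹ * timeDeriv b γ y = 0 := by
    ext i j
    have e1 : pderiv b (Sum.inl 0) (fun v => ∑ k, (γ v)⁻¹ i k * γ v k j) y = 0 := by
      rw [← pderiv_const b ((1 : Matrix κ κ ℝ) i j) y (Sum.inl 0)]
      refine (pderiv_congr ?_ b _).eq_of_nhds
      filter_upwards [h.isOpen.mem_nhds hy] with v hv
      rw [← Matrix.mul_apply, Matrix.nonsing_inv_mul _ (h.det_ne_zero v hv).isUnit]
    rw [pderiv_sum (fun k _ => (hd i k).fun_mul (h.differentiableAt_snd hy k j))] at e1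
    simp only [pderiv_mul (hd _ _) (h.differentiableAt_snd hy _ _), Finset.sum_add_distrib] at e1
    simpa [Matrix.mul_apply, timeDeriv] using e1
  have h2 : timeDeriv b (fun v => (γ v)⁻¹) y = - ((γ y)⁻¹ * timeDeriv b γ y * (γ y)⁻¹) := by
    have h3 := congrArg (· * (γ y)⁻¹) (eq_neg_of_add_eq_zero_left h1)
    simpa [Matrix.mul_nonsing_inv_cancel_right _ _ hu] using h3
  exact congrFun (congrFun h2 i) j

omit hc in
/-- `tr (γ⁻¹ ∂ₜ² γ) = ∂ₜ tr A + tr A²` for `A = γ⁻¹ ∂ₜ γ`. -/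
theorem sum_inv_mul_pderiv_timeDeriv :
    ∑ i, ∑ j, (γ y)⁻¹ i j * pderiv b (Sum.inl 0) (fun v => timeDeriv b γ v i j) y
      = pderiv b (Sum.inl 0) (fun v => (shapeMatrix b γ v).trace) y
        + (shapeMatrix b γ y * shapeMatrix b γ y).trace := by
  have hd : ∀ i j, DifferentiableAt ℝ (fun v => (γ v)⁻¹ i j) y := fun i j =>
    ((contDiffOn_inv_entry h.contDiffOn_snd h.det_ne_zero i j).contDiffAt
      (h.isOpen.mem_nhds hy)).differentiableAt (by simp)
  have hT := fun i j => h.differentiableAt_timeDeriv hy i j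
  have e1 : pderiv b (Sum.inl 0) (fun v => (shapeMatrix b γ v).trace) y
      = ∑ i, ∑ j, ((γ y)⁻¹ i j * pderiv b (Sum.inl 0) (fun v => timeDeriv b γ v j i) y
        - ((γ y)⁻¹ * timeDeriv b γ y * (γ y)⁻¹) i j * timeDeriv b γ y j i) := by
    simp only [Matrix.trace, Matrix.diag_apply, shapeMatrix, Matrix.mul_apply (M := (γ _)⁻¹)]
    rw [pderiv_sum fun i _ => DifferentiableAt.fun_sum fun j _ => (hd i j).fun_mul (hT j i)]
    refine Finset.sum_congr rfl fun i _ => ?_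
    rw [pderiv_sum fun j _ => (hd i j).fun_mul (hT j i)]
    refine Finset.sum_congr rfl fun j _ => ?_
    rw [pderiv_mul (hd i j) (hT j i), h.pderiv_inv_entry hy]
    ring
  have e2 : (shapeMatrix b γ y * shapeMatrix b γ y).trace
      = ∑ i, ∑ j, ((γ y)⁻¹ * timeDeriv b γ y * (γ y)⁻¹) i j * timeDeriv b γ y j i := by
    rw [shapeMatrix, ← Matrix.mul_assoc]
    simp [Matrix.trace, Matrix.mul_apply (N := timeDeriv b γ y)
      (M := (γ y)⁻¹ * timeDeriv b γ y * (γ y)⁻¹)]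
  have e3 : ∀ i j, pderiv b (Sum.inl 0) (fun v => timeDeriv b γ v j i) y
      = pderiv b (Sum.inl 0) (fun v => timeDeriv b γ v i j) y := by
    intro i j
    refine (pderiv_congr ?_ b _).eq_of_nhds
    filter_upwards [h.isOpen.mem_nhds hy] with v hv using h.timeDeriv_symm hv j i
  rw [e1, e2]
  simp only [Finset.sum_sub_distrib, sub_add_cancel, e3]

/-- Scalar curvature of a block diagonal metric: its dependence on the factor `c`. -/
theorem coordScalarCurvature_eq :
    coordScalarCurvature b (blockMetric F γ c) y
      = ∑ i, ∑ j, (γ y)⁻¹ i j * spaceRicci b γ i j y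
        + c⁻¹ * ((F y)⁻¹ * (
          - pderiv b (Sum.inl 0) (fun v => (shapeMatrix b γ v).trace) y
          + (1 / 2) * (shapeMatrix b γ y).trace * (pderiv b (Sum.inl 0) F y / F y)
          - (1 / 4) * (shapeMatrix b γ y * shapeMatrix b γ y).trace
          - (1 / 4) * (shapeMatrix b γ y).trace ^ 2)) := by
  have h0 := h.fst_ne_zero y hy
  have hT := fun i j => h.differentiableAt_timeDeriv hy i j
  have g1 : ∀ i j, pderiv b (Sum.inl 0) (fun v => -1 / 2 * (F v)⁻¹ * timeDeriv b γ v i j) y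
      = 1 / 2 * (F y)⁻¹ * (pderiv b (Sum.inl 0) F y / F y) * timeDeriv b γ y i j
        - 1 / 2 * (F y)⁻¹ * pderiv b (Sum.inl 0) (fun v => timeDeriv b γ v i j) y := by
    intro i j
    have hi := (h.differentiableAt_fst hy).fun_inv h0
    rw [pderiv_mul (hi.const_mul _) (hT i j), pderiv_const_mul hi,
      pderiv_inv (h.differentiableAt_fst hy) h0]
    field_simp
    ring
  have g2 : ∑ i, ∑ j, (γ y)⁻¹ i j * timeDeriv b γ y i j = (shapeMatrix b γ y).trace := by
    simp only [shapeMatrix, Matrix.trace, Matrix.diag_apply, Matrix.mul_apply]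
    exact Finset.sum_congr rfl fun i _ => Finset.sum_congr rfl fun j _ => by
      rw [h.timeDeriv_symm hy i j]
  have hγs : ∀ i j, (γ y)⁻¹ i j = (γ y)⁻¹ j i := by
    have : (γ y).transpose = γ y := by ext i j; exact h.symm y hy j i
    intro i j
    conv_lhs => rw [← this, ← Matrix.transpose_nonsing_inv]
    rfl
  have g3 : ∑ i, ∑ j, (γ y)⁻¹ i j * ∑ l, timeDeriv b γ y j l * shapeMatrix b γ y l i
      = (shapeMatrix b γ y * shapeMatrix b γ y).trace := by
    conv_rhs => rw [shapeMatrix, Matrix.mul_assoc]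
    simp only [Matrix.trace, Matrix.diag_apply, Matrix.mul_apply]
    rfl
  have g4 : ∑ i, ∑ j, (γ y)⁻¹ i j * ∑ k, shapeMatrix b γ y k j * timeDeriv b γ y i k
      = (shapeMatrix b γ y * shapeMatrix b γ y).trace := by
    rw [← g3, Finset.sum_comm]
    refine Finset.sum_congr rfl fun i _ => Finset.sum_congr rfl fun j _ => ?_
    rw [hγs j i]
    congr 1
    exact Finset.sum_congr rfl fun k _ => mul_comm _ _
  have g5 := h.sum_inv_mul_pderiv_timeDeriv hy
  have key : ∑ i, ∑ j, (γ y)⁻¹ i j * (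
        pderiv b (Sum.inl 0) (fun v => -1 / 2 * (F v)⁻¹ * timeDeriv b γ v i j) y
        + (pderiv b (Sum.inl 0) F y / (2 * F y) + 1 / 2 * (shapeMatrix b γ y).trace)
          * (-1 / 2 * (F y)⁻¹ * timeDeriv b γ y i j)
        + 1 / 4 * (F y)⁻¹ * (∑ l, timeDeriv b γ y j l * shapeMatrix b γ y l i
          + ∑ k, shapeMatrix b γ y k j * timeDeriv b γ y i k))
      = (F y)⁻¹ * (1 / 4 * (pderiv b (Sum.inl 0) F y / F y) * (shapeMatrix b γ y).trace
        - 1 / 4 * (shapeMatrix b γ y).trace ^ 2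
        - 1 / 2 * pderiv b (Sum.inl 0) (fun v => (shapeMatrix b γ v).trace) y) := by
    have : ∀ i j, (γ y)⁻¹ i j * (
        pderiv b (Sum.inl 0) (fun v => -1 / 2 * (F v)⁻¹ * timeDeriv b γ v i j) y
        + (pderiv b (Sum.inl 0) F y / (2 * F y) + 1 / 2 * (shapeMatrix b γ y).trace)
          * (-1 / 2 * (F y)⁻¹ * timeDeriv b γ y i j)
        + 1 / 4 * (F y)⁻¹ * (∑ l, timeDeriv b γ y j l * shapeMatrix b γ y l i
          + ∑ k, shapeMatrix b γ y k j * timeDeriv b γ y i k))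
        = (F y)⁻¹ * (1 / 4 * (pderiv b (Sum.inl 0) F y / F y) - 1 / 4 * (shapeMatrix b γ y).trace)
            * ((γ y)⁻¹ i j * timeDeriv b γ y i j)
          - 1 / 2 * (F y)⁻¹
            * ((γ y)⁻¹ i j * pderiv b (Sum.inl 0) (fun v => timeDeriv b γ v i j) y)
          + 1 / 4 * (F y)⁻¹
            * ((γ y)⁻¹ i j * ∑ l, timeDeriv b γ y j l * shapeMatrix b γ y l i)
          + 1 / 4 * (F y)⁻¹
            * ((γ y)⁻¹ i j * ∑ k, shapeMatrix b γ y k j * timeDeriv b γ y i k) := by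
      intro i j
      rw [g1]
      field_simp
      ring
    simp only [this, Finset.sum_add_distrib, Finset.sum_sub_distrib, ← Finset.mul_sum]
    rw [g2, g3, g4, g5]
    ring
  obtain ⟨X, hX, key⟩ : ∃ X : κ → κ → ℝ,
      (∀ i j, coordRicci b (blockMetric F γ c) (Sum.inr i) (Sum.inr j) y
        = spaceRicci b γ i j y + c⁻¹ * X i j) ∧ ∑ i, ∑ j, (γ y)⁻¹ i j * X i j = _ :=
    ⟨_, fun i j => h.coordRicci_inr hy hc i j, key⟩
  simp only [coordScalarCurvature, Fintype.sum_sum_type, Finset.univ_unique, Finset.sum_singleton,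
    blockMetric_inv hc h0 (h.det_ne_zero y hy), Fin.default_eq_zero,
    Matrix.fromBlocks_apply₁₁, Matrix.fromBlocks_apply₁₂, Matrix.fromBlocks_apply₂₂,
    Matrix.fromBlocks_apply₂₁, Matrix.of_apply, Matrix.zero_apply, zero_mul, zero_add, add_zero,
    Finset.sum_const_zero, h.coordRicci_inl hy hc, hX, mul_add _ _ (c⁻¹ * _),
    Finset.sum_add_distrib, mul_left_comm _ c⁻¹ (X _ _), ← Finset.mul_sum]
  rw [key]
  ring

end IsBlockOn

end Block
end

noncomputable section
set_option synthInstance.maxHeartbeats 200000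
set_option linter.unusedSectionVars false

section ChartForm

variable {E : Type*} [NormedAddCommGroup E] [NormedSpace ℝ E]
  {H : Type*} [TopologicalSpace H] {I : ModelWithCorners ℝ E H}
  {M : Type*} [TopologicalSpace M] [ChartedSpace H M]

/-- A bilinear form on a tangent space, as a form on the model space. -/
def modelForm (g : BilinField I M) (x : M) : E →L[ℝ] E →L[ℝ] ℝ := g x

/-- The derivative of the inverse of a chart. -/
def chartFrame (I : ModelWithCorners ℝ E H) (e : OpenPartialHomeomorph M H) (u : E) : E →L[ℝ] E :=
  mfderiv 𝓘(ℝ, E) I (e.extend I).symm u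

/-- The pullback of `g` by the inverse of the chart `e`. -/
def chartForm (g : BilinField I M) (e : OpenPartialHomeomorph M H) (u : E) : E →L[ℝ] E →L[ℝ] ℝ :=
  (modelForm g ((e.extend I).symm u)).bilinearComp (chartFrame I e u) (chartFrame I e u)

theorem chartForm_apply (g : BilinField I M) (e : OpenPartialHomeomorph M H) (u v w : E) :
    chartForm g e u v w
      = modelForm g ((e.extend I).symm u) (chartFrame I e u v) (chartFrame I e u w) := rfl

theorem chartComponents_eq {ι : Type*} [Fintype ι] [DecidableEq ι] (b : Module.Basis ι ℝ E)
    (g : BilinField I M) (e : OpenPartialHomeomorph M H) :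
    chartComponents b g e = formMatrix b (chartForm g e) := rfl

/-- The change of coordinates from `e` to `e'`. -/
def chartTransition (I : ModelWithCorners ℝ E H) (e e' : OpenPartialHomeomorph M H) : E → E :=
  e'.extend I ∘ (e.extend I).symm

/-- The domain of `chartTransition`. -/
def transitionDomain (I : ModelWithCorners ℝ E H) (e e' : OpenPartialHomeomorph M H) : Set E :=
  (e.extend I).target ∩ (e.extend I).symm ⁻¹' e'.source

variable [I.Boundaryless] {e e' : OpenPartialHomeomorph M H}

theorem isOpen_transitionDomain : IsOpen (transitionDomain I e e') :=
  (e.continuousOn_extend_symm (I := I)).isOpen_inter_preimage e.isOpen_extend_target e'.open_source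

theorem chartTransition_mapsTo :
    MapsTo (chartTransition I e e') (transitionDomain I e e') (e'.extend I).target := fun u hu =>
  (e'.extend I).map_source (by rw [e'.extend_source]; exact hu.2)

theorem extend_symm_chartTransition {u : E} (hu : u ∈ transitionDomain I e e') :
    (e'.extend I).symm (chartTransition I e e' u) = (e.extend I).symm u :=
  (e'.extend I).left_inv (by rw [e'.extend_source]; exact hu.2)

variable [IsManifold I ∞ M]

theorem contMDiffAt_extend_symm (he : e ∈ IsManifold.maximalAtlas I ∞ M) {u : E}
    (hu : u ∈ (e.extend I).target) : ContMDiffAt 𝓘(ℝ, E) I ∞ (e.extend I).symm u := by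
  have h := contMDiffOn_extend_symm he
  have h2 : (e.extend I).target = I '' e.target := by
    rw [e.extend_target', ]
  rw [← h2] at h
  exact h.contMDiffAt (e.isOpen_extend_target.mem_nhds hu)

theorem contDiffOn_chartTransition (he : e ∈ IsManifold.maximalAtlas I ∞ M)
    (he' : e' ∈ IsManifold.maximalAtlas I ∞ M) :
    ContDiffOn ℝ ∞ (chartTransition I e e') (transitionDomain I e e') := by
  intro u hu
  refine (ContMDiffAt.contDiffAt ?_).contDiffWithinAt
  exact ContMDiffAt.comp u (e'.contMDiffAt_extend he' hu.2) (contMDiffAt_extend_symm he hu.1)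

theorem chartFrame_eq (he : e ∈ IsManifold.maximalAtlas I ∞ M)
    (he' : e' ∈ IsManifold.maximalAtlas I ∞ M) {u : E} (hu : u ∈ transitionDomain I e e') (v : E) :
    chartFrame I e u v
      = chartFrame I e' (chartTransition I e e' u) (fderiv ℝ (chartTransition I e e') u v) := by
  have h1 : (e.extend I).symm =ᶠ[𝓝 u] (e'.extend I).symm ∘ chartTransition I e e' := by
    filter_upwards [isOpen_transitionDomain.mem_nhds hu] with y hy
    exact (extend_symm_chartTransition hy).symm
  have h2 : MDifferentiableAt 𝓘(ℝ, E) I (e'.extend I).symm (chartTransition I e e' u) :=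
    (contMDiffAt_extend_symm he' (chartTransition_mapsTo hu)).mdifferentiableAt (by simp)
  have h3 : MDifferentiableAt 𝓘(ℝ, E) 𝓘(ℝ, E) (chartTransition I e e') u :=
    (((contDiffOn_chartTransition he he').contDiffAt
      (isOpen_transitionDomain.mem_nhds hu)).differentiableAt (by simp)).mdifferentiableAt
  have h4 := h1.mfderiv_eq (I := 𝓘(ℝ, E)) (I' := I)
  rw [mfderiv_comp u h2 h3, mfderiv_eq_fderiv] at h4
  exact congrArg (fun T : E →L[ℝ] E => T v) h4

theorem isPullback_chartForm (g : BilinField I M) (he : e ∈ IsManifold.maximalAtlas I ∞ M)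
    (he' : e' ∈ IsManifold.maximalAtlas I ∞ M) :
    IsPullback (chartForm g e') (chartForm g e) (chartTransition I e e') (e'.extend I).target
      (transitionDomain I e e') where
  contDiffOn := contDiffOn_chartTransition he he'
  mapsTo := chartTransition_mapsTo
  eq u hu v w := by
    rw [chartForm_apply, chartForm_apply, extend_symm_chartTransition hu,
      chartFrame_eq he he' hu, chartFrame_eq he he' hu]

theorem contDiffAt_form_of_apply [FiniteDimensional ℝ E] {D : Type*} [NormedAddCommGroup D]
    [NormedSpace ℝ D] {B : D → E →L[ℝ] E →L[ℝ] ℝ} {u : D}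
    (h : ∀ v w, ContDiffAt ℝ ∞ (fun y => B y v w) u) : ContDiffAt ℝ ∞ B u := by
  let b := Module.finBasis ℝ E
  have h1 : B = fun y => ∑ i, ∑ j, B y (b i) (b j) • (coordL b i).smulRight (coordL b j) := by
    ext y v w
    conv_lhs => rw [← b.sum_repr v, ← b.sum_repr w]
    simp only [map_sum, map_smul, _root_.sum_apply, _root_.smul_apply, smul_eq_mul,
      ContinuousLinearMap.smulRight_apply, coordL_apply]
    rw [Finset.sum_comm]
    refine Finset.sum_congr rfl fun i _ => ?_
    rw [Finset.mul_sum]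
    exact Finset.sum_congr rfl fun j _ => by ring
  have h2 : ∀ {F : Type _} [NormedAddCommGroup F] [NormedSpace ℝ F] {f : D → ℝ}
      (_ : ContDiffAt ℝ ∞ f u) (c : F), ContDiffAt ℝ ∞ (fun u => f u • c) u :=
    fun hf c => hf.smul contDiffAt_const
  rw [h1]
  exact ContDiffAt.sum fun i _ => ContDiffAt.sum fun j _ => h2 (h _ _) _

theorem IsPullback.contDiffAt {B B' : E → E →L[ℝ] E →L[ℝ] ℝ} {φ : E → E} {U V : Set E}
    [FiniteDimensional ℝ E]
    (hp : IsPullback B B' φ U V) (hV : IsOpen V) {u : E} (hu : u ∈ V)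
    (hB : ContDiffAt ℝ ∞ B (φ u)) : ContDiffAt ℝ ∞ B' u := by
  have hn := hV.mem_nhds hu
  have h1 : ContDiffAt ℝ ∞ φ u := hp.contDiffOn.contDiffAt hn
  have h2 : ContDiffAt ℝ ∞ (fderiv ℝ φ) u :=
    (hp.contDiffOn.fderiv_of_isOpen hV (by simp : (∞ : WithTop ℕ∞) + 1 ≤ ∞)).contDiffAt hn
  have h4 : ContDiffAt ℝ ∞ (fun y => B (φ y)) u := ContDiffAt.comp (g := B) u hB h1
  refine contDiffAt_form_of_apply fun v w => ?_
  have h3 : (fun y => B' y v w) =ᶠ[𝓝 u] fun y => B (φ y) (fderiv ℝ φ y v) (fderiv ℝ φ y w) := by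
    filter_upwards [hn] with y hy using hp.eq y hy v w
  exact ((h4.clm_apply (h2.clm_apply contDiffAt_const)).clm_apply
    (h2.clm_apply contDiffAt_const)).congr_of_eventuallyEq h3

theorem contMDiffAt_comp_extChartAt_iff {F : Type*} [NormedAddCommGroup F] [NormedSpace ℝ F]
    {f : E → F} (x : M) : ContMDiffAt I 𝓘(ℝ, F) ∞ (fun y => f (extChartAt I x y)) x ↔
      ContDiffAt ℝ ∞ f (extChartAt I x x) := by
  constructor
  · intro h
    have hu := mem_extChartAt_target (I := I) x
    have h1 := contMDiffAt_extend_symm (IsManifold.chart_mem_maximalAtlas (I := I) (n := ∞) x) hu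
    have h2 : ContMDiffAt I 𝓘(ℝ, F) ∞ (fun y => f (extChartAt I x y))
        ((extChartAt I x).symm (extChartAt I x x)) := by
      rwa [extChartAt_to_inv]
    refine (ContMDiffAt.contDiffAt (h2.comp _ h1)).congr_of_eventuallyEq ?_
    filter_upwards [(isOpen_extChartAt_target (I := I) x).mem_nhds hu] with y hy
    exact congrArg f ((extChartAt I x).right_inv hy).symm
  · intro h
    exact h.contMDiffAt.comp x contMDiffAt_extChartAt

theorem contMDiffAt_bilinField_iff_chartAt (g : BilinField I M) (x : M) :
    ContMDiffAt I (I.prod 𝓘(ℝ, E →L[ℝ] E →L[ℝ] ℝ)) ∞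
      (fun x => Bundle.TotalSpace.mk' (E →L[ℝ] E →L[ℝ] ℝ)
        (E := fun x : M => TangentSpace I x →L[ℝ] TangentSpace I x →L[ℝ] ℝ) x (g x)) x ↔
      ContDiffAt ℝ ∞ (chartForm g (chartAt H x)) (extChartAt I x x) := by
  rw [← contMDiffAt_comp_extChartAt_iff, contMDiffAt_hom_bundle]
  have : IsManifold I 1 M := IsManifold.of_le (n := ∞) (by simp)
  have key : (fun y => ContinuousLinearMap.inCoordinates E (TangentSpace I) (E →L[ℝ] ℝ)
      (fun x : M => TangentSpace I x →L[ℝ] ℝ) x y x y (g y)) =ᶠ[𝓝 x]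
      fun y => chartForm g (chartAt H x) (extChartAt I x y) := by
    filter_upwards [(chartAt H x).open_source.mem_nhds (mem_chart_source H x)] with y hy
    ext v w
    have hb : y ∈ (trivializationAt E (TangentSpace I) x).baseSet := by simpa using hy
    have hs := TangentBundle.symmL_trivializationAt (I := I) hy
    rw [I.range_eq_univ, mfderivWithin_univ] at hs
    rw [inCoordinates_apply_eq₂ hb hb (Set.mem_univ _), chartForm_apply]
    have hy' : ((chartAt H x).extend I).symm (extChartAt I x y) = y :=
      (extChartAt I x).left_inv (by rwa [extChartAt_source])
    have e1 : ∀ v : E, chartFrame I (chartAt H x) (extChartAt I x y) v =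
        (trivializationAt E (TangentSpace I) x).symm y v := by
      intro v
      rw [← (trivializationAt E (TangentSpace I) x).symmL_apply (R := ℝ) hb, hs]
      rfl
    rw [e1, e1, hy']
    refine Eq.trans (b := g y ((trivializationAt E (TangentSpace I) x).symm y v)
      ((trivializationAt E (TangentSpace I) x).symm y w)) (by simp) rfl
  constructor
  · intro h
    exact h.2.congr_of_eventuallyEq key.symm
  · intro h
    exact ⟨contMDiffAt_id, h.congr_of_eventuallyEq key⟩

variable [FiniteDimensional ℝ E]

theorem contMDiffAt_bilinField_iff (g : BilinField I M) (he : e ∈ IsManifold.maximalAtlas I ∞ M)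
    {x : M} (hx : x ∈ e.source) :
    ContMDiffAt I (I.prod 𝓘(ℝ, E →L[ℝ] E →L[ℝ] ℝ)) ∞
      (fun x => Bundle.TotalSpace.mk' (E →L[ℝ] E →L[ℝ] ℝ)
        (E := fun x : M => TangentSpace I x →L[ℝ] TangentSpace I x →L[ℝ] ℝ) x (g x)) x ↔
      ContDiffAt ℝ ∞ (chartForm g e) (e.extend I x) := by
  rw [contMDiffAt_bilinField_iff_chartAt]
  have h0 := IsManifold.chart_mem_maximalAtlas (I := I) (n := ∞) x
  have hx0 := mem_chart_source H x
  have key : ∀ {e e' : OpenPartialHomeomorph M H}, e ∈ IsManifold.maximalAtlas I ∞ M →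
      e' ∈ IsManifold.maximalAtlas I ∞ M → x ∈ e.source → x ∈ e'.source →
      ContDiffAt ℝ ∞ (chartForm g e) (e.extend I x) →
      ContDiffAt ℝ ∞ (chartForm g e') (e'.extend I x) := by
    intro e e' he he' hx hx' h
    have hinv : (e'.extend I).symm (e'.extend I x) = x :=
      (e'.extend I).left_inv (by rwa [e'.extend_source])
    have hu : e'.extend I x ∈ transitionDomain I e' e :=
      ⟨(e'.extend I).map_source (by rwa [e'.extend_source]), by rw [Set.mem_preimage, hinv]; exact hx⟩
    refine (isPullback_chartForm g he' he).contDiffAt isOpen_transitionDomain hu ?_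
    rwa [chartTransition, Function.comp_apply, hinv]
  exact ⟨key h0 he hx0 hx, key he h0 hx hx0⟩

theorem contDiffOn_chartForm {g : BilinField I M} (he : e ∈ IsManifold.maximalAtlas I ∞ M)
    (hg : ContMDiff I (I.prod 𝓘(ℝ, E →L[ℝ] E →L[ℝ] ℝ)) ∞
      (fun x => Bundle.TotalSpace.mk' (E →L[ℝ] E →L[ℝ] ℝ)
        (E := fun x : M => TangentSpace I x →L[ℝ] TangentSpace I x →L[ℝ] ℝ) x (g x))) :
    ContDiffOn ℝ ∞ (chartForm g e) (e.extend I).target := by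
  intro u hu
  have hx : (e.extend I).symm u ∈ e.source := by
    rw [← e.extend_source (I := I)]; exact (e.extend I).map_target hu
  have := (contMDiffAt_bilinField_iff g he hx).1 (hg _)
  rw [(e.extend I).right_inv hu] at this
  exact this.contDiffWithinAt

theorem HasSignature.symm {V : Type*} [AddCommGroup V] [Module ℝ V] [TopologicalSpace V]
    {B : V →L[ℝ] V →L[ℝ] ℝ} {r s : ℕ} (h : HasSignature B r s) (v w : V) : B v w = B w v := by
  obtain ⟨c, hc⟩ := h
  have h1 : ((ContinuousLinearMap.coeLM ℝ).comp (B : V →ₗ[ℝ] V →L[ℝ] ℝ))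
      = ((ContinuousLinearMap.coeLM ℝ).comp (B : V →ₗ[ℝ] V →L[ℝ] ℝ)).flip := by
    refine c.ext fun i => c.ext fun j => ?_
    change B (c i) (c j) = B (c j) (c i)
    rw [hc, hc]
    by_cases hij : i = j
    · rw [hij]
    · rw [if_neg hij, if_neg (Ne.symm hij)]
  exact congrArg (fun T : V →ₗ[ℝ] V →ₗ[ℝ] ℝ => T v w) h1

theorem HasSignature.eq_zero {V : Type*} [AddCommGroup V] [Module ℝ V] [TopologicalSpace V]
    {B : V →L[ℝ] V →L[ℝ] ℝ} {r s : ℕ} (h : HasSignature B r s) {v : V} (hv : ∀ w, B v w = 0) :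
    v = 0 := by
  obtain ⟨c, hc⟩ := h
  have h1 : c.repr v = 0 := by
    ext i
    have := hv (c i)
    rw [← c.sum_repr v] at this
    simp only [map_sum, map_smul, _root_.sum_apply, _root_.smul_apply, hc, smul_eq_mul, mul_ite,
      mul_zero, Finset.sum_ite_eq', Finset.mem_univ, if_true] at this
    rcases i with i | i <;> simpa using this
  simpa using h1

theorem chartFrame_injective (he : e ∈ IsManifold.maximalAtlas I ∞ M) {u : E}
    (hu : u ∈ (e.extend I).target) : Function.Injective (chartFrame I e u) := by
  refine (injective_iff_map_eq_zero _).2 fun v hv => ?_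
  have h1 : MDifferentiableAt 𝓘(ℝ, E) I (e.extend I).symm u :=
    (contMDiffAt_extend_symm he hu).mdifferentiableAt (by simp)
  have hx : (e.extend I).symm u ∈ e.source := by
    rw [← e.extend_source (I := I)]; exact (e.extend I).map_target hu
  have h2 : MDifferentiableAt I 𝓘(ℝ, E) (e.extend I) ((e.extend I).symm u) :=
    (e.contMDiffAt_extend he hx).mdifferentiableAt (by simp)
  have h3 : (e.extend I) ∘ (e.extend I).symm =ᶠ[𝓝 u] id := by
    filter_upwards [e.isOpen_extend_target.mem_nhds hu] with y hy using (e.extend I).right_inv hy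
  have h4 := h3.mfderiv_eq (I := 𝓘(ℝ, E)) (I' := 𝓘(ℝ, E))
  rw [mfderiv_comp u h2 h1, mfderiv_id] at h4
  have h5 := congrArg (fun T : E →L[ℝ] E => T v) h4
  have h6 : (mfderiv I 𝓘(ℝ, E) (e.extend I) ((e.extend I).symm u) : E →L[ℝ] E)
      (chartFrame I e u v) = v := h5
  rw [← h6, hv]
  exact map_zero _

variable {ι : Type*} [Fintype ι] [DecidableEq ι]

theorem IsSmoothMetric.isMetricOn (b : Module.Basis ι ℝ E) {g : BilinField I M} {r s : ℕ}
    (hg : IsSmoothMetric g r s) (he : e ∈ IsManifold.maximalAtlas I ∞ M) :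
    IsMetricOn b (chartForm g e) (e.extend I).target where
  isOpen := e.isOpen_extend_target
  contDiffOn := contDiffOn_chartForm he hg.contMDiff
  symm u _ v w := (hg.hasSignature ((e.extend I).symm u)).symm _ _
  det_ne_zero u hu h0 := by
    obtain ⟨v, hv0, hv⟩ := Matrix.exists_vecMul_eq_zero_iff.2 h0
    have hinj := chartFrame_injective he hu
    have hsurj : Function.Surjective (chartFrame I e u) :=
      (LinearMap.injective_iff_surjective (f := (chartFrame I e u : E →ₗ[ℝ] E))).1 hinj
    let x : E := ∑ i, v i • b i
    have hx : ∀ j, chartForm g e u x (b j) = 0 := by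
      intro j
      have := congrFun hv j
      simpa [x, Matrix.vecMul, dotProduct, formMatrix] using this
    have hx' : ∀ w, chartForm g e u x w = 0 := by
      intro w
      rw [← b.sum_repr w, map_sum]
      exact Finset.sum_eq_zero fun j _ => by rw [map_smul, hx, smul_zero]
    have h1 : chartFrame I e u x = 0 := by
      refine (hg.hasSignature ((e.extend I).symm u)).eq_zero fun w => ?_
      obtain ⟨w', hw'⟩ := hsurj w
      rw [← hw']
      exact hx' w'
    have h2 : x = 0 := hinj (by rw [h1, map_zero])
    refine hv0 (funext fun i => ?_)
    have := congrArg (fun y => b.repr y i) h2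
    simpa [x, Finsupp.single_apply] using this

/-- The scalar curvature can be computed in any chart. -/
theorem IsSmoothMetric.scalarCurvature_eq (b : Module.Basis ι ℝ E) {g : BilinField I M} {r s : ℕ}
    (hg : IsSmoothMetric g r s) (he : e ∈ IsManifold.maximalAtlas I ∞ M) {x : M}
    (hx : x ∈ e.source) :
    scalarCurvature b g x = coordScalarCurvature b (chartComponents b g e) (e.extend I x) := by
  have h0 := IsManifold.chart_mem_maximalAtlas (I := I) (n := ∞) x
  have hinv : (extChartAt I x).symm (extChartAt I x x) = x := extChartAt_to_inv x
  have hu : extChartAt I x x ∈ transitionDomain I (chartAt H x) e :=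
    ⟨mem_extChartAt_target x, by
      rw [Set.mem_preimage]
      exact hinv.symm ▸ hx⟩
  have h := isPullback_chartForm g h0 he
  have h1 := hg.isMetricOn b he
  have h2 := hg.isMetricOn b h0
  have h3 : IsMetricOn b (chartForm g (chartAt H x)) (transitionDomain I (chartAt H x) e) :=
    ⟨isOpen_transitionDomain, h2.contDiffOn.mono Set.inter_subset_left,
      fun u hu => h2.symm u hu.1, fun u hu => h2.det_ne_zero u hu.1⟩
  have h4 := h.coordScalarCurvature_eq h1 h3 hu
  rw [scalarCurvature, chartComponents_eq, chartComponents_eq, h4]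
  congr 1
  exact congrArg (e.extend I) hinv

theorem IsSmoothMetric.continuous_scalarCurvature (b : Module.Basis ι ℝ E) {g : BilinField I M}
    {r s : ℕ} (hg : IsSmoothMetric g r s) : Continuous (scalarCurvature b g) := by
  refine continuous_iff_continuousAt.2 fun x => ?_
  have h0 := IsManifold.chart_mem_maximalAtlas (I := I) (n := ∞) x
  have h1 := hg.isMetricOn b h0
  have h2 := contDiffOn_coordScalarCurvature (b := b) h1.isOpen h1.contDiffOn_entry h1.det_ne_zero
  have h3 : ContinuousAt (fun y => coordScalarCurvature b (chartComponents b g (chartAt H x))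
      (extChartAt I x y)) x :=
    (h2.continuousOn.continuousAt (h1.isOpen.mem_nhds (mem_extChartAt_target x))).comp
      (continuousAt_extChartAt x)
  refine h3.congr ?_
  filter_upwards [(chartAt H x).open_source.mem_nhds (mem_chart_source H x)] with y hy
  exact (hg.scalarCurvature_eq b h0 hy).symm

end ChartForm
end

noncomputable section
set_option linter.unusedSectionVars false

section Volume

variable {E : Type*} [NormedAddCommGroup E] [NormedSpace ℝ E] [FiniteDimensional ℝ E]
  {H : Type*} [TopologicalSpace H] {I : ModelWithCorners ℝ E H} [I.Boundaryless]
  {M : Type*} [TopologicalSpace M] [ChartedSpace H M] [IsManifold I ∞ M]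
  [MeasurableSpace E] [BorelSpace E] [MeasurableSpace M] [BorelSpace M]
  {ι : Type*} [Fintype ι] [DecidableEq ι] {b : Module.Basis ι ℝ E}
  {g g' : BilinField I M} {e e' : OpenPartialHomeomorph M H}

/-- The density `|det gᵢⱼ|^{1/2}` in the chart `e`. -/
def volumeDensity (b : Module.Basis ι ℝ E) (g : BilinField I M) (e : OpenPartialHomeomorph M H)
    (u : E) : ℝ :=
  Real.sqrt |(chartComponents b g e u).det|

theorem aemeasurable_extend_symm (f : E → ENNReal) :
    AEMeasurable (e.extend I).symm ((b.addHaar.restrict (e.extend I).target).withDensity f) :=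
  (e.continuousOn_extend_symm.aemeasurable e.isOpen_extend_target.measurableSet).mono_ac
    (withDensity_absolutelyContinuous _ _)

theorem chartVolume_apply {A : Set M} (hA : MeasurableSet A) :
    chartVolume b g e A = ∫⁻ u in (e.extend I).target ∩ (e.extend I).symm ⁻¹' A,
      ENNReal.ofReal (volumeDensity b g e u) ∂b.addHaar := by
  rw [chartVolume, Measure.map_apply_of_aemeasurable (aemeasurable_extend_symm _) hA,
    withDensity_apply', Measure.restrict_restrict' e.isOpen_extend_target.measurableSet,
    Set.inter_comm]
  rfl

theorem measurableSet_extend_preimage {A : Set M} (hA : MeasurableSet A) :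
    MeasurableSet ((e.extend I).target ∩ (e.extend I).symm ⁻¹' A) := by
  have h := e.continuousOn_extend_symm (I := I)
  rw [continuousOn_iff_continuous_domRestrict] at h
  have h2 := MeasurableSet.subtype_image (e.isOpen_extend_target (I := I)).measurableSet
    (h.measurable hA)
  convert h2 using 1
  ext u
  simp [Set.mem_image]
  exact and_comm

theorem chartVolume_overlap (he : e ∈ IsManifold.maximalAtlas I ∞ M)
    (he' : e' ∈ IsManifold.maximalAtlas I ∞ M) {A : Set M} (hA : MeasurableSet A) :
    chartVolume b g e' (A ∩ e.source) = chartVolume b g e (A ∩ e'.source) := by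
  have hp := isPullback_chartForm g he he'
  rw [chartVolume_apply (hA.inter e.open_source.measurableSet),
    chartVolume_apply (hA.inter e'.open_source.measurableSet)]
  set S := (e.extend I).target ∩ (e.extend I).symm ⁻¹' (A ∩ e'.source) with hS
  have hSm : MeasurableSet S :=
    measurableSet_extend_preimage (hA.inter e'.open_source.measurableSet)
  have hsub : S ⊆ transitionDomain I e e' := fun u hu => ⟨hu.1, hu.2.2⟩
  have himg : (e'.extend I).target ∩ (e'.extend I).symm ⁻¹' (A ∩ e.source)
      = chartTransition I e e' '' S := by
    ext u
    constructor
    · rintro ⟨hu, huA, hue⟩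
      have h1 : e.extend I ((e'.extend I).symm u) ∈ (e.extend I).target :=
        (e.extend I).map_source (by rwa [e.extend_source])
      have h2 : (e.extend I).symm (e.extend I ((e'.extend I).symm u)) = (e'.extend I).symm u :=
        (e.extend I).left_inv (by rwa [e.extend_source])
      refine ⟨e.extend I ((e'.extend I).symm u), ⟨h1, ?_⟩, ?_⟩
      · rw [Set.mem_preimage, h2]
        refine ⟨huA, ?_⟩
        rw [← e'.extend_source (I := I)]; exact (e'.extend I).map_target hu
      · rw [chartTransition, Function.comp_apply, h2, (e'.extend I).right_inv hu]
    · rintro ⟨v, hv, rfl⟩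
      refine ⟨chartTransition_mapsTo (hsub hv), ?_⟩
      rw [Set.mem_preimage, extend_symm_chartTransition (hsub hv)]
      refine ⟨hv.2.1, ?_⟩
      rw [← e.extend_source (I := I)]; exact (e.extend I).map_target hv.1
  have hinj : InjOn (chartTransition I e e') S := by
    intro u hu v hv huv
    have h1 := extend_symm_chartTransition (hsub hu)
    rw [huv, extend_symm_chartTransition (hsub hv)] at h1
    rw [← (e.extend I).right_inv hu.1, ← h1, (e.extend I).right_inv hv.1]
  have hder : ∀ u ∈ S, HasFDerivWithinAt (chartTransition I e e')
      (fderiv ℝ (chartTransition I e e') u) S u := fun u hu =>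
    ((((contDiffOn_chartTransition he he').contDiffAt (isOpen_transitionDomain.mem_nhds
      (hsub hu))).differentiableAt (by simp)).hasFDerivAt).hasFDerivWithinAt
  rw [himg, lintegral_image_eq_lintegral_abs_det_fderiv_mul _ hSm hder hinj]
  refine setLIntegral_congr_fun hSm fun u hu => ?_
  rw [← ENNReal.ofReal_mul (abs_nonneg _)]
  congr 1
  simp only [volumeDensity]
  rw [chartComponents_eq, chartComponents_eq, hp.det_formMatrix b (hsub hu), abs_mul,
    Real.sqrt_mul (abs_nonneg _), abs_pow, Real.sqrt_sq (abs_nonneg _)]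

theorem chartVolume_compl_source : chartVolume b g e e.sourceᶜ = 0 := by
  rw [chartVolume_apply e.open_source.measurableSet.compl]
  have : (e.extend I).target ∩ (e.extend I).symm ⁻¹' e.sourceᶜ = ∅ := by
    ext u
    simp only [mem_inter_iff, mem_preimage, mem_compl_iff, mem_empty_iff_false, iff_false, not_and,
      not_not]
    intro hu
    rw [← e.extend_source (I := I)]; exact (e.extend I).map_target hu
  rw [this]
  simp

/-- On the domain of a chart of the atlas the volume measure is `|det gᵢⱼ|^{1/2} dx`. -/
theorem volumeMeasure_restrict_source (b : Module.Basis ι ℝ E) (g : BilinField I M)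
    (he : e ∈ atlas H M) : (volumeMeasure b g).restrict e.source = chartVolume b g e := by
  have hmax : ∀ {e : OpenPartialHomeomorph M H}, e ∈ atlas H M →
      e ∈ IsManifold.maximalAtlas I ∞ M := fun h => IsManifold.subset_maximalAtlas h
  have hs := e.open_source.measurableSet
  have hle : ∀ e' ∈ atlas H M, chartVolume b g e' ≤ volumeMeasure b g :=
    fun e' he' => le_iSup₂ (f := fun e' (_ : e' ∈ atlas H M) => chartVolume b g e') e' he'
  have hsupp : (chartVolume b g e).restrict e.source = chartVolume b g e := by
    rw [Measure.restrict_eq_self_of_ae_mem]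
    exact mem_ae_iff.2 chartVolume_compl_source
  apply le_antisymm
  · have h1 : volumeMeasure b g ≤
        chartVolume b g e + (volumeMeasure b g).restrict e.sourceᶜ := by
      refine iSup₂_le fun e' he' => Measure.le_iff.2 fun A hA => ?_
      rw [← measure_inter_add_sdiff A hs, Measure.add_apply, Measure.restrict_apply hA,
        chartVolume_overlap (hmax he) (hmax he') hA]
      exact add_le_add (measure_mono Set.inter_subset_left) (hle e' he' _)
    calc (volumeMeasure b g).restrict e.source
        ≤ (chartVolume b g e + (volumeMeasure b g).restrict e.sourceᶜ).restrict e.source :=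
          Measure.restrict_mono le_rfl h1
      _ = chartVolume b g e := by
          rw [Measure.restrict_add, hsupp, Measure.restrict_restrict hs, Set.inter_compl_self,
            Measure.restrict_empty, add_zero]
  · calc chartVolume b g e = (chartVolume b g e).restrict e.source := hsupp.symm
      _ ≤ _ := Measure.restrict_mono le_rfl (hle e he)

theorem IsSmoothMetric.continuousOn_volumeDensity (b : Module.Basis ι ℝ E) {r s : ℕ}
    (hg : IsSmoothMetric g r s) (he : e ∈ IsManifold.maximalAtlas I ∞ M) :
    ContinuousOn (volumeDensity b g e) (e.extend I).target :=
  ((contDiffOn_det (hg.isMetricOn b he).contDiffOn_entry).continuousOn.abs).sqrt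

theorem IsSmoothMetric.isLocallyFiniteMeasure (b : Module.Basis ι ℝ E) {r s : ℕ}
    (hg : IsSmoothMetric g r s) : IsLocallyFiniteMeasure (volumeMeasure b g) := by
  refine ⟨fun x => ?_⟩
  set e := chartAt H x
  have he : e ∈ IsManifold.maximalAtlas I ∞ M := IsManifold.chart_mem_maximalAtlas x
  have hx : x ∈ e.source := mem_chart_source H x
  have hu : e.extend I x ∈ (e.extend I).target := mem_extChartAt_target x
  have hcont := hg.continuousOn_volumeDensity b he
  obtain ⟨K, hK, hxK, hKt⟩ := exists_compact_subset (e.isOpen_extend_target (I := I)) hu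
  have hxc : (e.extend I).symm (e.extend I x) = x :=
    (e.extend I).left_inv (by rwa [e.extend_source])
  let A : Set M := e.source ∩ e.extend I ⁻¹' interior K
  have hAo : IsOpen A := by
    have := (e.continuousOn_extend (I := I)).isOpen_inter_preimage
      (by rw [e.extend_source]; exact e.open_source) (isOpen_interior (s := K))
    rwa [e.extend_source] at this
  refine ⟨A, hAo.mem_nhds ⟨hx, hxK⟩, ?_⟩
  have h1 : volumeMeasure b g A = chartVolume b g e A := by
    rw [← volumeMeasure_restrict_source b g (chart_mem_atlas H x),
      Measure.restrict_apply hAo.measurableSet, Set.inter_eq_left.2 Set.inter_subset_left]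
  rw [h1, chartVolume_apply hAo.measurableSet]
  have hsub : (e.extend I).target ∩ (e.extend I).symm ⁻¹' A ⊆ K := by
    rintro u ⟨hu, _, hu2⟩
    rw [Set.mem_preimage, (e.extend I).right_inv hu] at hu2
    exact interior_subset hu2
  obtain ⟨C, hC⟩ := hK.exists_bound_of_continuousOn (hcont.mono hKt)
  calc ∫⁻ u in (e.extend I).target ∩ (e.extend I).symm ⁻¹' A,
        ENNReal.ofReal (volumeDensity b g e u) ∂b.addHaar
      ≤ ∫⁻ u in K, ENNReal.ofReal (volumeDensity b g e u) ∂b.addHaar :=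
        lintegral_mono_set hsub
    _ ≤ ∫⁻ _ in K, ENNReal.ofReal C ∂b.addHaar := by
        refine setLIntegral_mono' hK.measurableSet fun u hu => ENNReal.ofReal_le_ofReal ?_
        exact (le_abs_self _).trans (hC u hu)
    _ < ⊤ := by
        rw [setLIntegral_const]
        exact ENNReal.mul_lt_top ENNReal.ofReal_lt_top hK.measure_lt_top

theorem setIntegral_volumeMeasure_source (b : Module.Basis ι ℝ E) {r s : ℕ}
    (hg : IsSmoothMetric g r s) (he : e ∈ atlas H M) {f : M → ℝ} (hf : Continuous f) :
    ∫ x in e.source, f x ∂(volumeMeasure b g)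
      = ∫ u in (e.extend I).target, volumeDensity b g e u * f ((e.extend I).symm u)
        ∂b.addHaar := by
  have hcont := hg.continuousOn_volumeDensity b (IsManifold.subset_maximalAtlas he)
  have ht := (e.isOpen_extend_target (I := I)).measurableSet
  rw [volumeMeasure_restrict_source b g he, chartVolume,
    integral_map (aemeasurable_extend_symm _) hf.measurable.aestronglyMeasurable,
    integral_withDensity_eq_integral_toReal_smul₀]
  · refine integral_congr_ae (Eventually.of_forall fun u => ?_)
    simp only [smul_eq_mul]
    rw [ENNReal.toReal_ofReal (Real.sqrt_nonneg _)]
    rfl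
  · exact (hcont.aemeasurable ht).ennreal_ofReal
  · exact Eventually.of_forall fun u => ENNReal.ofReal_lt_top

theorem volumeMeasure_le_smul {c : ENNReal}
    (h : ∀ e ∈ atlas H M, chartVolume b g' e ≤ c • chartVolume b g e) :
    volumeMeasure b g' ≤ c • volumeMeasure b g := by
  refine iSup₂_le fun e he => (h e he).trans (Measure.le_iff.2 fun A _ => ?_)
  rw [Measure.smul_apply, Measure.smul_apply]
  exact mul_le_mul_right (le_iSup₂ (f := fun e' (_ : e' ∈ atlas H M) => chartVolume b g e') e he A) _

theorem chartVolume_eq_smul {ε : ℝ} (hε : 0 < ε)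
    (h : ∀ u ∈ (e.extend I).target, |(chartComponents b g' e u).det|
      = ε ^ 2 * |(chartComponents b g e u).det|) :
    chartVolume b g' e = ENNReal.ofReal ε • chartVolume b g e := by
  refine Measure.ext fun A hA => ?_
  rw [Measure.smul_apply, chartVolume_apply hA, chartVolume_apply hA, smul_eq_mul,
    ← lintegral_const_mul' _ _ ENNReal.ofReal_ne_top]
  refine setLIntegral_congr_fun (measurableSet_extend_preimage hA) fun u hu => ?_
  simp only [volumeDensity]
  rw [← ENNReal.ofReal_mul hε.le, h u hu.1, Real.sqrt_mul (sq_nonneg _), Real.sqrt_sq hε.le]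

theorem volumeMeasure_eq_smul {ε : ℝ} (hε : 0 < ε)
    (h : ∀ e ∈ atlas H M, ∀ u ∈ (e.extend I).target, |(chartComponents b g' e u).det|
      = ε ^ 2 * |(chartComponents b g e u).det|) :
    volumeMeasure b g' = ENNReal.ofReal ε • volumeMeasure b g := by
  refine le_antisymm (volumeMeasure_le_smul fun e he => (chartVolume_eq_smul hε (h e he)).le) ?_
  have h1 : volumeMeasure b g ≤ (ENNReal.ofReal ε)⁻¹ • volumeMeasure b g' := by
    refine volumeMeasure_le_smul fun e he => ?_
    rw [chartVolume_eq_smul hε (h e he), smul_smul, ENNReal.inv_mul_cancel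
      (by simpa using hε) ENNReal.ofReal_ne_top, one_smul]
  calc ENNReal.ofReal ε • volumeMeasure b g
      ≤ ENNReal.ofReal ε • ((ENNReal.ofReal ε)⁻¹ • volumeMeasure b g') :=
        Measure.le_iff.2 fun A _ => by
          rw [Measure.smul_apply, Measure.smul_apply]; exact mul_le_mul_right (h1 A) _
    _ = volumeMeasure b g' := by
        rw [smul_smul, ENNReal.mul_inv_cancel (by simpa using hε) ENNReal.ofReal_ne_top, one_smul]

end Volume
end

noncomputable section
set_option linter.unusedSectionVars false
set_option synthInstance.maxHeartbeats 200000

section CircleForm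

/-- The derivative of the inclusion of the circle in `ℂ` at `z`. -/
def circleInclDeriv (z : Circle) : EuclideanSpace ℝ (Fin 1) →L[ℝ] ℂ :=
  mfderiv (𝓡 1) 𝓘(ℝ, ℂ) (fun y : Circle => (y : ℂ)) z

theorem contMDiff_circle_coe : ContMDiff (𝓡 1) 𝓘(ℝ, ℂ) ∞ (fun y : Circle => (y : ℂ)) := by
  have := finrank_real_complex_fact'
  exact contMDiff_coe_sphere (E := ℂ) (n := 1) (m := ∞)

theorem circleInclDeriv_injective (z : Circle) : Function.Injective (circleInclDeriv z) := by
  have := finrank_real_complex_fact'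
  have h := injective_mvfderiv_subtypeVal_sphere (E := ℂ) (n := 1) z
  intro v w hvw
  exact h hvw

theorem re_conj_mul_circleInclDeriv (z : Circle) (v : EuclideanSpace ℝ (Fin 1)) :
    ((starRingEnd ℂ (z : ℂ)) * circleInclDeriv z v).re = 0 := by
  have := finrank_real_complex_fact'
  have h := range_mvfderiv_subtypeVal (E := ℂ) (n := 1) z
  have h2 : circleInclDeriv z v ∈ (Submodule.span ℝ {((z : Circle) : ℂ)})ᗮ := by
    rw [← h]
    exact ⟨v, rfl⟩
  have h3 := Submodule.mem_orthogonal_singleton_iff_inner_right.1 h2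
  rw [Complex.inner] at h3
  rw [mul_comm]
  exact h3

/-- `circleDt` as a form on the model space. -/
def angleForm (e : OpenPartialHomeomorph Circle (EuclideanSpace ℝ (Fin 1)))
    (u : EuclideanSpace ℝ (Fin 1)) : EuclideanSpace ℝ (Fin 1) →L[ℝ] ℝ :=
  circleDt ((e.extend (𝓡 1)).symm u) ∘L chartFrame (𝓡 1) e u

theorem circleDt_eq (z : Circle) (v : EuclideanSpace ℝ (Fin 1)) :
    circleDt z v = ((starRingEnd ℂ (z : ℂ)) * circleInclDeriv z v).im := rfl

theorem circleDt_injective (z : Circle) (v : EuclideanSpace ℝ (Fin 1)) (h : circleDt z v = 0) :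
    v = 0 := by
  rw [circleDt_eq] at h
  have h1 : (starRingEnd ℂ (z : ℂ)) * circleInclDeriv z v = 0 :=
    Complex.ext (re_conj_mul_circleInclDeriv z v) h
  have h2 : circleInclDeriv z v = 0 := by
    rcases mul_eq_zero.1 h1 with h | h
    · exact absurd ((map_eq_zero _).1 h) (Circle.coe_ne_zero z)
    · exact h
  exact circleInclDeriv_injective z (by rw [h2, map_zero])

variable {e : OpenPartialHomeomorph Circle (EuclideanSpace ℝ (Fin 1))}

theorem angleForm_apply (he : e ∈ IsManifold.maximalAtlas (𝓡 1) ∞ Circle)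
    {u : EuclideanSpace ℝ (Fin 1)} (hu : u ∈ (e.extend (𝓡 1)).target)
    (v : EuclideanSpace ℝ (Fin 1)) :
    angleForm e u v = ((starRingEnd ℂ ((e.extend (𝓡 1)).symm u : ℂ))
      * fderiv ℝ (fun y => ((e.extend (𝓡 1)).symm y : ℂ)) u v).im := by
  have h1 : MDifferentiableAt 𝓘(ℝ, EuclideanSpace ℝ (Fin 1)) (𝓡 1) (e.extend (𝓡 1)).symm u :=
    (contMDiffAt_extend_symm he hu).mdifferentiableAt (by simp)
  have h2 : MDifferentiableAt (𝓡 1) 𝓘(ℝ, ℂ) (fun y : Circle => (y : ℂ))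
      ((e.extend (𝓡 1)).symm u) := contMDiff_circle_coe.contMDiffAt.mdifferentiableAt (by simp)
  have h3 := mfderiv_comp u h2 h1
  rw [mfderiv_eq_fderiv] at h3
  have h4 := congrArg (fun T : EuclideanSpace ℝ (Fin 1) →L[ℝ] ℂ => T v) h3
  change fderiv ℝ (fun y => ((e.extend (𝓡 1)).symm y : ℂ)) u v = _ at h4
  rw [h4]
  rfl

theorem contDiffOn_angleForm_apply (he : e ∈ IsManifold.maximalAtlas (𝓡 1) ∞ Circle)
    (v : EuclideanSpace ℝ (Fin 1)) :
    ContDiffOn ℝ ∞ (fun u => angleForm e u v) (e.extend (𝓡 1)).target := by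
  have hz : ContDiffOn ℝ ∞ (fun y => ((e.extend (𝓡 1)).symm y : ℂ)) (e.extend (𝓡 1)).target := by
    intro u hu
    refine (ContMDiffAt.contDiffAt ?_).contDiffWithinAt
    exact ContMDiffAt.comp u contMDiff_circle_coe.contMDiffAt (contMDiffAt_extend_symm he hu)
  have hd := hz.fderiv_of_isOpen e.isOpen_extend_target (by simp : (∞ : WithTop ℕ∞) + 1 ≤ ∞)
  have h1 : ContDiffOn ℝ ∞ (fun u => ((starRingEnd ℂ ((e.extend (𝓡 1)).symm u : ℂ))
      * fderiv ℝ (fun y => ((e.extend (𝓡 1)).symm y : ℂ)) u v).im) (e.extend (𝓡 1)).target :=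
    Complex.imCLM.contDiff.comp_contDiffOn
      ((Complex.conjCLE.contDiff.comp_contDiffOn hz).mul (hd.clm_apply contDiffOn_const))
  exact h1.congr fun u hu => angleForm_apply he hu v

theorem angleForm_injective (he : e ∈ IsManifold.maximalAtlas (𝓡 1) ∞ Circle)
    {u : EuclideanSpace ℝ (Fin 1)} (hu : u ∈ (e.extend (𝓡 1)).target)
    {v : EuclideanSpace ℝ (Fin 1)} (h : angleForm e u v = 0) : v = 0 :=
  chartFrame_injective he hu ((circleDt_injective _ _ h).trans (map_zero _).symm)

end CircleForm

section ProductChart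

variable {n : ℕ} {N : Type*} [TopologicalSpace N] [ChartedSpace (EuclideanSpace ℝ (Fin n)) N]
  [IsManifold (𝓡 n) ∞ N]
  {e₁ : OpenPartialHomeomorph Circle (EuclideanSpace ℝ (Fin 1))}
  {e₂ : OpenPartialHomeomorph N (EuclideanSpace ℝ (Fin n))}
  {a : ℝ} {γ : Circle → BilinField (𝓡 n) N}

theorem extend_prod_target : ((e₁.prod e₂).extend ((𝓡 1).prod (𝓡 n))).target
    = (e₁.extend (𝓡 1)).target ×ˢ (e₂.extend (𝓡 n)).target := by
  rw [e₁.extend_prod e₂, PartialEquiv.prod_target]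

theorem prod_mem_maximalAtlas (he₁ : e₁ ∈ IsManifold.maximalAtlas (𝓡 1) ∞ Circle)
    (he₂ : e₂ ∈ IsManifold.maximalAtlas (𝓡 n) ∞ N) :
    e₁.prod e₂ ∈ IsManifold.maximalAtlas ((𝓡 1).prod (𝓡 n)) ∞ (Circle × N) :=
  IsManifold.mem_maximalAtlas_prod he₁ he₂

theorem chartForm_circleProductMetric (he₁ : e₁ ∈ IsManifold.maximalAtlas (𝓡 1) ∞ Circle)
    (he₂ : e₂ ∈ IsManifold.maximalAtlas (𝓡 n) ∞ N)
    {u : EuclideanSpace ℝ (Fin 1) × EuclideanSpace ℝ (Fin n)}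
    (hu : u ∈ (e₁.extend (𝓡 1)).target ×ˢ (e₂.extend (𝓡 n)).target)
    (v w : EuclideanSpace ℝ (Fin 1) × EuclideanSpace ℝ (Fin n)) :
    chartForm (circleProductMetric a γ) (e₁.prod e₂) u v w
      = a * (angleForm e₁ u.1 v.1 * angleForm e₁ u.1 w.1)
        + chartForm (γ ((e₁.extend (𝓡 1)).symm u.1)) e₂ u.2 v.2 w.2 := by
  have hu' : u ∈ ((e₁.prod e₂).extend ((𝓡 1).prod (𝓡 n))).target := by
    rwa [extend_prod_target]
  have hm := (contMDiffAt_extend_symm (prod_mem_maximalAtlas he₁ he₂) hu').mdifferentiableAt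
    (by simp)
  have h1 : MDifferentiableAt 𝓘(ℝ, EuclideanSpace ℝ (Fin 1)) (𝓡 1) (e₁.extend (𝓡 1)).symm u.1 :=
    (contMDiffAt_extend_symm he₁ hu.1).mdifferentiableAt (by simp)
  have h2 : MDifferentiableAt 𝓘(ℝ, EuclideanSpace ℝ (Fin n)) (𝓡 n) (e₂.extend (𝓡 n)).symm u.2 :=
    (contMDiffAt_extend_symm he₂ hu.2).mdifferentiableAt (by simp)
  have key1 : ∀ v : EuclideanSpace ℝ (Fin 1) × EuclideanSpace ℝ (Fin n),
      mfderiv ((𝓡 1).prod (𝓡 n)) (𝓡 1) Prod.fst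
        (((e₁.prod e₂).extend ((𝓡 1).prod (𝓡 n))).symm u)
        (chartFrame ((𝓡 1).prod (𝓡 n)) (e₁.prod e₂) u v) = chartFrame (𝓡 1) e₁ u.1 v.1 := by
    intro v
    have h3 := mfderiv_comp u (I'' := 𝓡 1) (g := (Prod.fst : Circle × N → Circle))
      mdifferentiableAt_fst hm
    have h4 := mfderiv_comp u (I := 𝓘(ℝ, EuclideanSpace ℝ (Fin 1) × EuclideanSpace ℝ (Fin n)))
      h1 (differentiableAt_fst (𝕜 := ℝ)).mdifferentiableAt
    have h5 := h3.symm.trans h4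
    rw [mfderiv_eq_fderiv, fderiv_fst] at h5
    exact congrArg (fun T : EuclideanSpace ℝ (Fin 1) × EuclideanSpace ℝ (Fin n) →L[ℝ]
      EuclideanSpace ℝ (Fin 1) => T v) h5
  have key2 : ∀ v : EuclideanSpace ℝ (Fin 1) × EuclideanSpace ℝ (Fin n),
      mfderiv ((𝓡 1).prod (𝓡 n)) (𝓡 n) Prod.snd
        (((e₁.prod e₂).extend ((𝓡 1).prod (𝓡 n))).symm u)
        (chartFrame ((𝓡 1).prod (𝓡 n)) (e₁.prod e₂) u v) = chartFrame (𝓡 n) e₂ u.2 v.2 := by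
    intro v
    have h3 := mfderiv_comp u (I'' := 𝓡 n) (g := (Prod.snd : Circle × N → N))
      mdifferentiableAt_snd hm
    have h4 := mfderiv_comp u (I := 𝓘(ℝ, EuclideanSpace ℝ (Fin 1) × EuclideanSpace ℝ (Fin n)))
      h2 (differentiableAt_snd (𝕜 := ℝ)).mdifferentiableAt
    have h5 := h3.symm.trans h4
    rw [mfderiv_eq_fderiv, fderiv_snd] at h5
    exact congrArg (fun T : EuclideanSpace ℝ (Fin 1) × EuclideanSpace ℝ (Fin n) →L[ℝ]
      EuclideanSpace ℝ (Fin n) => T v) h5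
  rw [chartForm_apply]
  refine (circleProductMetric_apply a γ _ _ _).trans ?_
  rw [key1, key1, key2, key2]
  rfl

end ProductChart
end

noncomputable section
set_option linter.unusedSectionVars false
set_option synthInstance.maxHeartbeats 200000

section Signature

variable {V : Type*} [AddCommGroup V] [Module ℝ V] [TopologicalSpace V]
  {W : Type*} [AddCommGroup W] [Module ℝ W] [TopologicalSpace W]

theorem HasSignature.of_basis {ι : Type*} [DecidableEq ι] {B : V →L[ℝ] V →L[ℝ] ℝ} {r s : ℕ}
    (v : Module.Basis ι ℝ V) (f : ι ≃ Fin r ⊕ Fin s)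
    (h : ∀ i j, B (v i) (v j)
      = if i = j then Sum.elim (fun _ => (-1 : ℝ)) (fun _ => (1 : ℝ)) (f i) else 0) :
    HasSignature B r s := by
  refine ⟨v.reindex f, fun i j => ?_⟩
  rw [v.reindex_apply, v.reindex_apply, h, Equiv.apply_symm_apply]
  simp only [EmbeddingLike.apply_eq_iff_eq]

theorem HasSignature.map {B : V →L[ℝ] V →L[ℝ] ℝ} {B' : W →L[ℝ] W →L[ℝ] ℝ} {r s : ℕ}
    (h : HasSignature B r s) (L : V ≃ₗ[ℝ] W) (hL : ∀ v w, B' (L v) (L w) = B v w) :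
    HasSignature B' r s := by
  obtain ⟨v, hv⟩ := h
  exact ⟨v.map L, fun i j => by rw [Module.Basis.map_apply, Module.Basis.map_apply, hL, hv]⟩

theorem HasSignature.neg {B B' : V →L[ℝ] V →L[ℝ] ℝ} {r s : ℕ} (h : HasSignature B r s)
    (hB : ∀ v w, B' v w = -B v w) : HasSignature B' s r := by
  obtain ⟨v, hv⟩ := h
  refine HasSignature.of_basis v (Equiv.sumComm _ _) fun i j => ?_
  rw [hB, hv]
  split_ifs
  · rcases i with i | i <;> simp
  · simp

theorem HasSignature.of_pos [FiniteDimensional ℝ V] {B : V →L[ℝ] V →L[ℝ] ℝ}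
    (hsymm : ∀ v w, B v w = B w v) (hpos : ∀ v, v ≠ 0 → 0 < B v v) :
    HasSignature B 0 (Module.finrank ℝ V) := by
  let B' : LinearMap.BilinForm ℝ V :=
    (ContinuousLinearMap.coeLM ℝ).comp (B : V →ₗ[ℝ] V →L[ℝ] ℝ)
  have hB' : ∀ v w, B' v w = B v w := fun _ _ => rfl
  have hs : LinearMap.IsSymm B' := ⟨fun v w => by simp [hB', hsymm v w]⟩
  obtain ⟨v, hv⟩ := LinearMap.BilinForm.exists_orthogonal_basis hs
  have hp : ∀ i, 0 < B (v i) (v i) := fun i => hpos _ (v.ne_zero i)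
  have hu : ∀ i, IsUnit (Real.sqrt (B (v i) (v i)))⁻¹ := fun i =>
    (inv_pos.2 (Real.sqrt_pos.2 (hp i))).ne'.isUnit
  refine HasSignature.of_basis (v.isUnitSMul hu) (Equiv.emptySum (Fin 0) _).symm fun i j => ?_
  rw [v.isUnitSMul_apply, v.isUnitSMul_apply]
  simp only [map_smul, _root_.smul_apply, smul_eq_mul]
  by_cases hij : i = j
  · subst hij
    have := Real.mul_self_sqrt (hp i).le
    have h0 := (Real.sqrt_pos.2 (hp i)).ne'
    rw [if_pos rfl]
    simp only [Equiv.emptySum_symm_apply, Sum.elim_inr]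
    field_simp
    nlinarith
  · rw [if_neg hij]
    have : B' (v i) (v j) = 0 := hv hij
    rw [hB'] at this
    simp [this]

end Signature

section DefiniteMetric

variable {n : ℕ} {N : Type*} [TopologicalSpace N] [T2Space N] [CompactSpace N]
  [ChartedSpace (EuclideanSpace ℝ (Fin n)) N] [IsManifold (𝓡 n) ∞ N]

section ChartDeriv

variable {E : Type*} [NormedAddCommGroup E] [NormedSpace ℝ E]
  {H : Type*} [TopologicalSpace H] {I : ModelWithCorners ℝ E H} [I.Boundaryless]
  {M : Type*} [TopologicalSpace M] [ChartedSpace H M] [IsManifold I ∞ M]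
  {e : OpenPartialHomeomorph M H}

/-- The derivative of a chart. -/
def chartDeriv (I : ModelWithCorners ℝ E H) (e : OpenPartialHomeomorph M H) (x : M) : E →L[ℝ] E :=
  mfderiv I 𝓘(ℝ, E) (e.extend I) x

theorem chartDeriv_chartFrame (he : e ∈ IsManifold.maximalAtlas I ∞ M) {u : E}
    (hu : u ∈ (e.extend I).target) (v : E) :
    chartDeriv I e ((e.extend I).symm u) (chartFrame I e u v) = v := by
  have h1 : MDifferentiableAt 𝓘(ℝ, E) I (e.extend I).symm u :=
    (contMDiffAt_extend_symm he hu).mdifferentiableAt (by simp)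
  have hx : (e.extend I).symm u ∈ e.source := by
    rw [← e.extend_source (I := I)]; exact (e.extend I).map_target hu
  have h2 : MDifferentiableAt I 𝓘(ℝ, E) (e.extend I) ((e.extend I).symm u) :=
    (e.contMDiffAt_extend he hx).mdifferentiableAt (by simp)
  have h3 : (e.extend I) ∘ (e.extend I).symm =ᶠ[𝓝 u] id := by
    filter_upwards [e.isOpen_extend_target.mem_nhds hu] with y hy using (e.extend I).right_inv hy
  have h4 := h3.mfderiv_eq (I := 𝓘(ℝ, E)) (I' := 𝓘(ℝ, E))
  rw [mfderiv_comp u h2 h1, mfderiv_id] at h4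
  exact congrArg (fun T : E →L[ℝ] E => T v) h4

theorem chartDeriv_injective [FiniteDimensional ℝ E] (he : e ∈ IsManifold.maximalAtlas I ∞ M)
    {x : M} (hx : x ∈ e.source) : Function.Injective (chartDeriv I e x) := by
  have hu : e.extend I x ∈ (e.extend I).target :=
    (e.extend I).map_source (by rwa [e.extend_source])
  have hinv : (e.extend I).symm (e.extend I x) = x :=
    (e.extend I).left_inv (by rwa [e.extend_source])
  have h := chartDeriv_chartFrame he hu
  rw [hinv] at h
  exact (LinearMap.injective_iff_surjective (f := (chartDeriv I e x : E →ₗ[ℝ] E))).2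
    fun v => ⟨_, h v⟩

end ChartDeriv

/-- The pullback of the Euclidean metric by a chart. -/
def flatForm (e : OpenPartialHomeomorph N (EuclideanSpace ℝ (Fin n))) : BilinField (𝓡 n) N :=
  fun x => ((innerSL ℝ : EuclideanSpace ℝ (Fin n) →L[ℝ] EuclideanSpace ℝ (Fin n) →L[ℝ]
    ℝ).bilinearComp (chartDeriv (𝓡 n) e x) (chartDeriv (𝓡 n) e x) :)

theorem flatForm_apply (e : OpenPartialHomeomorph N (EuclideanSpace ℝ (Fin n))) (x : N)
    (v w : EuclideanSpace ℝ (Fin n)) :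
    modelForm (flatForm e) x v w = inner ℝ (chartDeriv (𝓡 n) e x v) (chartDeriv (𝓡 n) e x w) := rfl

theorem contMDiffAt_flatForm {e : OpenPartialHomeomorph N (EuclideanSpace ℝ (Fin n))}
    (he : e ∈ IsManifold.maximalAtlas (𝓡 n) ∞ N) {x : N} (hx : x ∈ e.source) :
    ContMDiffAt (𝓡 n) ((𝓡 n).prod
      𝓘(ℝ, EuclideanSpace ℝ (Fin n) →L[ℝ] EuclideanSpace ℝ (Fin n) →L[ℝ] ℝ)) ∞
      (fun x => Bundle.TotalSpace.mk'
        (EuclideanSpace ℝ (Fin n) →L[ℝ] EuclideanSpace ℝ (Fin n) →L[ℝ] ℝ)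
        (E := fun x : N => TangentSpace (𝓡 n) x →L[ℝ] TangentSpace (𝓡 n) x →L[ℝ] ℝ) x
        (flatForm e x)) x := by
  refine (contMDiffAt_bilinField_iff (flatForm e) he hx).2 ?_
  refine contDiffAt_form_of_apply fun v w => ?_
  refine (contDiffAt_const (c := inner ℝ v w)).congr_of_eventuallyEq ?_
  filter_upwards [e.isOpen_extend_target.mem_nhds ((e.extend (𝓡 n)).map_source
    (by rwa [OpenPartialHomeomorph.extend_source]))] with u hu
  rw [chartForm_apply, flatForm_apply, chartDeriv_chartFrame he hu, chartDeriv_chartFrame he hu]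

/-- The positive definite symmetric forms on the tangent space at `x`. -/
def definiteForms (n : ℕ) {N : Type*} [TopologicalSpace N]
    [ChartedSpace (EuclideanSpace ℝ (Fin n)) N] (x : N) :
    Set (TangentSpace (𝓡 n) x →L[ℝ] TangentSpace (𝓡 n) x →L[ℝ] ℝ) :=
  {B | (∀ v w, B v w = B w v) ∧ ∀ v, v ≠ 0 → 0 < B v v}

theorem convex_definiteForms (x : N) : Convex ℝ (definiteForms n x) := by
  rintro B ⟨hB, hB'⟩ C ⟨hC, hC'⟩ a b ha hb hab
  refine ⟨fun v w => ?_, fun v hv => ?_⟩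
  · simp only [_root_.add_apply, _root_.smul_apply, hB v w, hC v w]
  · simp only [_root_.add_apply, _root_.smul_apply, smul_eq_mul]
    rcases ha.eq_or_lt with rfl | ha
    · rw [zero_add] at hab
      subst hab
      simpa using hC' v hv
    · have h1 := mul_pos ha (hB' v hv)
      have h2 := mul_nonneg hb (hC' v hv).le
      linarith

theorem flatForm_mem_definiteForms {e : OpenPartialHomeomorph N (EuclideanSpace ℝ (Fin n))}
    (he : e ∈ IsManifold.maximalAtlas (𝓡 n) ∞ N) {x : N} (hx : x ∈ e.source) :
    flatForm e x ∈ definiteForms n x :=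
  ⟨fun _ _ => real_inner_comm (F := EuclideanSpace ℝ (Fin n)) _ _, fun _ hv =>
    real_inner_self_pos.2 fun h0 =>
      hv (chartDeriv_injective he hx (h0.trans (map_zero _).symm))⟩

theorem definiteForms.hasSignature {x : N}
    {B : TangentSpace (𝓡 n) x →L[ℝ] TangentSpace (𝓡 n) x →L[ℝ] ℝ} (h : B ∈ definiteForms n x) :
    HasSignature B 0 n := by
  have h0 : FiniteDimensional ℝ (TangentSpace (𝓡 n) x) :=
    inferInstanceAs (FiniteDimensional ℝ (EuclideanSpace ℝ (Fin n)))
  have h1 : Module.finrank ℝ (TangentSpace (𝓡 n) x) = n :=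
    (finrank_euclideanSpace_fin : Module.finrank ℝ (EuclideanSpace ℝ (Fin n)) = n)
  have h2 := HasSignature.of_pos h.1 h.2
  rwa [h1] at h2

set_option maxHeartbeats 2000000 in
/-- A compact manifold carries a Riemannian metric. -/
theorem exists_isSmoothMetric_definite (n : ℕ) (N : Type*) [TopologicalSpace N] [T2Space N]
    [CompactSpace N] [ChartedSpace (EuclideanSpace ℝ (Fin n)) N] [IsManifold (𝓡 n) ∞ N] :
    ∃ g : BilinField (𝓡 n) N, IsSmoothMetric g 0 n := by
  have hloc : ∀ x₀ : N, ∃ U ∈ 𝓝 x₀, ∃ f : BilinField (𝓡 n) N,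
      ContMDiffOn (𝓡 n) ((𝓡 n).prod
        𝓘(ℝ, EuclideanSpace ℝ (Fin n) →L[ℝ] EuclideanSpace ℝ (Fin n) →L[ℝ] ℝ)) ∞
      (fun x => Bundle.TotalSpace.mk'
        (EuclideanSpace ℝ (Fin n) →L[ℝ] EuclideanSpace ℝ (Fin n) →L[ℝ] ℝ)
        (E := fun x : N => TangentSpace (𝓡 n) x →L[ℝ] TangentSpace (𝓡 n) x →L[ℝ] ℝ) x
        (f x)) U ∧ ∀ x ∈ U, f x ∈ definiteForms n x := fun x₀ => by
    have he := IsManifold.chart_mem_maximalAtlas (I := 𝓡 n) (n := ∞) x₀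
    exact ⟨(chartAt _ x₀).source, (chartAt _ x₀).open_source.mem_nhds (mem_chart_source _ x₀),
      flatForm (chartAt _ x₀), fun x hx => (contMDiffAt_flatForm he hx).contMDiffWithinAt,
      fun x hx => flatForm_mem_definiteForms he hx⟩
  obtain ⟨g, hg⟩ := exists_contMDiffSection_forall_mem_convex_of_local (𝓡 n) (n := ⊤)
    (F_fiber := EuclideanSpace ℝ (Fin n) →L[ℝ] EuclideanSpace ℝ (Fin n) →L[ℝ] ℝ)
    (fun x : N => TangentSpace (𝓡 n) x →L[ℝ] TangentSpace (𝓡 n) x →L[ℝ] ℝ) (definiteForms n)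
    convex_definiteForms hloc
  exact ⟨fun x => g x, g.contMDiff, fun x => definiteForms.hasSignature (hg x)⟩

theorem IsSmoothMetric.neg {g : BilinField (𝓡 n) N} {r s : ℕ} (hg : IsSmoothMetric g r s) :
    IsSmoothMetric (fun x => -g x) s r where
  contMDiff := fun x => by
    have he := IsManifold.chart_mem_maximalAtlas (I := 𝓡 n) (n := ∞) x
    have h1 := (contMDiffAt_bilinField_iff g he (mem_chart_source _ x)).1 (hg.contMDiff x)
    refine (contMDiffAt_bilinField_iff (fun x => -g x) he (mem_chart_source _ x)).2 ?_
    exact h1.neg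
  hasSignature x := (hg.hasSignature x).neg fun v w => rfl

theorem exists_isSmoothMetric {p q : ℕ} (hpq : p + q = n)
    (hN : p = 0 ∨ q = 0 ∨ ∃ γ₀ : BilinField (𝓡 n) N, IsSmoothMetric γ₀ p q) :
    ∃ γ₀ : BilinField (𝓡 n) N, IsSmoothMetric γ₀ p q := by
  obtain ⟨g, hg⟩ := exists_isSmoothMetric_definite n N
  rcases hN with rfl | rfl | h
  · have : q = n := by omega
    exact ⟨g, by rwa [this]⟩
  · have : p = n := by omega
    exact ⟨_, by rw [this]; exact hg.neg⟩
  · exact h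

end DefiniteMetric
end

noncomputable section
set_option linter.unusedSectionVars false
set_option synthInstance.maxHeartbeats 200000

section ProductFamily

variable {n : ℕ} {N : Type*} [TopologicalSpace N] [ChartedSpace (EuclideanSpace ℝ (Fin n)) N]
  [IsManifold (𝓡 n) ∞ N]

/-- A family of tensor fields on `N` which depends smoothly on the parameter in the circle. -/
def IsSmoothFamily (γ : Circle → BilinField (𝓡 n) N) : Prop :=
  ∀ e₁ ∈ IsManifold.maximalAtlas (𝓡 1) ∞ Circle, ∀ e₂ ∈ IsManifold.maximalAtlas (𝓡 n) ∞ N,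
    ContDiffOn ℝ ∞ (fun u : EuclideanSpace ℝ (Fin 1) × EuclideanSpace ℝ (Fin n) =>
      chartForm (γ ((e₁.extend (𝓡 1)).symm u.1)) e₂ u.2)
      ((e₁.extend (𝓡 1)).target ×ˢ (e₂.extend (𝓡 n)).target)

variable {e₁ : OpenPartialHomeomorph Circle (EuclideanSpace ℝ (Fin 1))}
  {e₂ : OpenPartialHomeomorph N (EuclideanSpace ℝ (Fin n))}
  {a : ℝ} {γ : Circle → BilinField (𝓡 n) N}

theorem isSmoothFamily_zero : IsSmoothFamily (fun _ : Circle => (0 : BilinField (𝓡 n) N)) := by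
  intro e₁ _ e₂ _
  have : (fun u : EuclideanSpace ℝ (Fin 1) × EuclideanSpace ℝ (Fin n) =>
      chartForm (0 : BilinField (𝓡 n) N) e₂ u.2) = fun _ => 0 := by
    ext u v w
    rfl
  rw [this]
  exact contDiffOn_const

theorem isOpen_prod_target :
    IsOpen ((e₁.extend (𝓡 1)).target ×ˢ (e₂.extend (𝓡 n)).target) :=
  e₁.isOpen_extend_target.prod e₂.isOpen_extend_target

theorem IsSmoothFamily.contMDiff (h : IsSmoothFamily γ) (a : ℝ) :
    ContMDiff ((𝓡 1).prod (𝓡 n)) (((𝓡 1).prod (𝓡 n)).prod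
      𝓘(ℝ, EuclideanSpace ℝ (Fin 1) × EuclideanSpace ℝ (Fin n) →L[ℝ]
        EuclideanSpace ℝ (Fin 1) × EuclideanSpace ℝ (Fin n) →L[ℝ] ℝ)) ∞
      (fun x => Bundle.TotalSpace.mk' (EuclideanSpace ℝ (Fin 1) × EuclideanSpace ℝ (Fin n) →L[ℝ]
        EuclideanSpace ℝ (Fin 1) × EuclideanSpace ℝ (Fin n) →L[ℝ] ℝ)
        (E := fun x : Circle × N => TangentSpace ((𝓡 1).prod (𝓡 n)) x →L[ℝ]
          TangentSpace ((𝓡 1).prod (𝓡 n)) x →L[ℝ] ℝ) x (circleProductMetric a γ x)) := by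
  intro x
  have he₁ := IsManifold.chart_mem_maximalAtlas (I := 𝓡 1) (n := ∞) x.1
  have he₂ := IsManifold.chart_mem_maximalAtlas (I := 𝓡 n) (n := ∞) x.2
  have he := prod_mem_maximalAtlas he₁ he₂
  have hx : x ∈ ((chartAt (EuclideanSpace ℝ (Fin 1)) x.1).prod
      (chartAt (EuclideanSpace ℝ (Fin n)) x.2)).source :=
    ⟨mem_chart_source _ x.1, mem_chart_source _ x.2⟩
  refine (contMDiffAt_bilinField_iff (circleProductMetric a γ) he hx).2 ?_
  refine contDiffAt_form_of_apply fun v w => ?_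
  have hu : (((chartAt (EuclideanSpace ℝ (Fin 1)) x.1).prod
      (chartAt (EuclideanSpace ℝ (Fin n)) x.2)).extend ((𝓡 1).prod (𝓡 n))) x
      ∈ (((chartAt (EuclideanSpace ℝ (Fin 1)) x.1).extend (𝓡 1)).target ×ˢ
        ((chartAt (EuclideanSpace ℝ (Fin n)) x.2).extend (𝓡 n)).target) :=
    ⟨mem_extChartAt_target x.1, mem_extChartAt_target x.2⟩
  have hθ : ∀ v, ContDiffOn ℝ ∞
      (fun u : EuclideanSpace ℝ (Fin 1) × EuclideanSpace ℝ (Fin n) =>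
        angleForm (chartAt (EuclideanSpace ℝ (Fin 1)) x.1) u.1 v)
      (((chartAt (EuclideanSpace ℝ (Fin 1)) x.1).extend (𝓡 1)).target ×ˢ
        ((chartAt (EuclideanSpace ℝ (Fin n)) x.2).extend (𝓡 n)).target) := fun v =>
    (contDiffOn_angleForm_apply he₁ v).comp contDiff_fst.contDiffOn fun u hu => hu.1
  have h1 : ContDiffOn ℝ ∞ (fun u => chartForm (circleProductMetric a γ)
      ((chartAt (EuclideanSpace ℝ (Fin 1)) x.1).prod (chartAt (EuclideanSpace ℝ (Fin n)) x.2))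
      u v w) _ :=
    (((contDiffOn_const (c := a)).mul ((hθ v.1).mul (hθ w.1))).add
      (((h _ he₁ _ he₂).clm_apply (contDiffOn_const (c := v.2))).clm_apply
        (contDiffOn_const (c := w.2)))).congr
      fun u hu => chartForm_circleProductMetric he₁ he₂ hu v w
  exact h1.contDiffAt (isOpen_prod_target.mem_nhds hu)

theorem IsSmoothFamily.uniformlyBoundedSmooth (h : IsSmoothFamily γ) (σ : ℝ) :
    UniformlyBoundedSmooth (productBasis n) (Ioc (0 : ℝ) 1)
        (fun ε => circleProductMetric (σ * ε ^ 2) γ) := by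
  intro e he K hK hKt k i j
  let f : EuclideanSpace ℝ (Fin 1) × EuclideanSpace ℝ (Fin n) → ℝ := fun v =>
    chartComponents (productBasis n)
      (circleProductMetric 1 (fun _ : Circle => (0 : BilinField (𝓡 n) N))) e v i j
  let g : EuclideanSpace ℝ (Fin 1) × EuclideanSpace ℝ (Fin n) → ℝ := fun v =>
    chartComponents (productBasis n) (circleProductMetric 0 γ) e v i j
  have ho := e.isOpen_extend_target (I := (𝓡 1).prod (𝓡 n))
  have hf : ContDiffOn ℝ ∞ f (e.extend ((𝓡 1).prod (𝓡 n))).target :=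
    ((contDiffOn_chartForm he (isSmoothFamily_zero.contMDiff 1)).clm_apply
      contDiffOn_const).clm_apply contDiffOn_const
  have hg : ContDiffOn ℝ ∞ g (e.extend ((𝓡 1).prod (𝓡 n))).target :=
    ((contDiffOn_chartForm he (h.contMDiff 0)).clm_apply
      contDiffOn_const).clm_apply contDiffOn_const
  have heq : ∀ ε : ℝ, (fun v => chartComponents (productBasis n)
      (circleProductMetric (σ * ε ^ 2) γ) e v i j) = (σ * ε ^ 2) • f + g := by
    intro ε
    ext v
    simp only [f, g, chartComponents, Matrix.of_apply, Pi.add_apply, Pi.smul_apply, smul_eq_mul,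
      circleProductMetric_apply, one_mul, zero_mul, zero_add]
    simp only [Pi.zero_apply, _root_.zero_apply, add_zero]
  have hcont : ∀ {f : EuclideanSpace ℝ (Fin 1) × EuclideanSpace ℝ (Fin n) → ℝ},
      ContDiffOn ℝ ∞ f (e.extend ((𝓡 1).prod (𝓡 n))).target →
      ∃ C, ∀ u ∈ K, ‖iteratedFDeriv ℝ k f u‖ ≤ C := by
    intro f hf
    have h1 : ContinuousOn (iteratedFDeriv ℝ k f) (e.extend ((𝓡 1).prod (𝓡 n))).target :=
      (hf.continuousOn_iteratedFDerivWithin (m := k) (by exact_mod_cast le_top)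
        ho.uniqueDiffOn).congr fun u hu => (iteratedFDerivWithin_of_isOpen k ho hu).symm
    exact hK.exists_bound_of_continuousOn (h1.mono hKt)
  obtain ⟨C, hC⟩ := hcont hf
  obtain ⟨D, hD⟩ := hcont hg
  refine ⟨|σ| * C + D, fun ε hε u hu => ?_⟩
  have hfu : ContDiffAt ℝ k f u := (hf.contDiffAt (ho.mem_nhds (hKt hu))).of_le
    (by exact_mod_cast le_top)
  have hgu : ContDiffAt ℝ k g u := (hg.contDiffAt (ho.mem_nhds (hKt hu))).of_le
    (by exact_mod_cast le_top)
  have hsu : ContDiffAt ℝ k ((σ * ε ^ 2) • f) u :=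
    ContDiffAt.const_smul (σ * ε ^ 2) hfu
  rw [heq ε, iteratedFDeriv_add_apply hsu hgu, iteratedFDeriv_const_smul_apply hfu]
  refine (norm_add_le _ _).trans (add_le_add ?_ (hD u hu))
  rw [norm_smul, Real.norm_eq_abs, abs_mul, abs_of_nonneg (sq_nonneg ε)]
  have h1 : ε ^ 2 ≤ 1 := pow_le_one₀ hε.1.le hε.2
  have h2 := mul_le_mul_of_nonneg_left h1 (abs_nonneg σ)
  rw [mul_one] at h2
  exact mul_le_mul h2 (hC u hu) (norm_nonneg _) (abs_nonneg _)

theorem circleProductMetric_apply_prod (y : Circle × N)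
    (v w : EuclideanSpace ℝ (Fin 1) × EuclideanSpace ℝ (Fin n)) :
    modelForm (circleProductMetric a γ) y v w =
      a * (circleDt y.1 v.1 * circleDt y.1 w.1) + modelForm (γ y.1) y.2 v.2 w.2 := by
  refine (circleProductMetric_apply a γ y v w).trans ?_
  rw [mfderiv_fst, mfderiv_snd]
  rfl

/-- A basis of the tangent space of the circle on which `dt` takes the value `a`. -/
theorem exists_basis_circleDt (z : Circle) {a : ℝ} (ha : a ≠ 0) :
    ∃ b : Module.Basis (Fin 1) ℝ (EuclideanSpace ℝ (Fin 1)), ∀ i, circleDt z (b i) = a := by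
  let b := (EuclideanSpace.basisFun (Fin 1) ℝ).toBasis
  have h0 : circleDt z (b 0) ≠ 0 := fun h => b.ne_zero 0 (circleDt_injective z _ h)
  have hu : ∀ i : Fin 1, IsUnit (a * (circleDt z (b 0))⁻¹) := fun _ =>
    (mul_ne_zero ha (inv_ne_zero h0)).isUnit
  refine ⟨b.isUnitSMul hu, fun i => ?_⟩
  have hi : i = 0 := Subsingleton.elim _ _
  rw [b.isUnitSMul_apply, hi]
  refine (map_smul (circleDt z) _ _).trans ?_
  rw [smul_eq_mul, inv_mul_cancel_right₀ h0]

theorem hasSignature_circleProductMetric {σ : ℝ} {p q r s : ℕ}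
    (hσ : (σ = 1 ∧ r = p ∧ s = q + 1) ∨ (σ = -1 ∧ r = p + 1 ∧ s = q)) {ε : ℝ} (hε : 0 < ε)
    {y : Circle × N} (h : HasSignature (γ y.1 y.2) p q) :
    HasSignature (circleProductMetric (σ * ε ^ 2) γ y) r s := by
  obtain ⟨v, hv⟩ := h
  obtain ⟨b, hb⟩ := exists_basis_circleDt y.1 (inv_ne_zero hε.ne')
  let v' : Module.Basis (Fin p ⊕ Fin q) ℝ (EuclideanSpace ℝ (Fin n)) := v
  have hv' : ∀ i j, modelForm (γ y.1) y.2 (v' i) (v' j)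
      = if i = j then Sum.elim (fun _ => (-1 : ℝ)) (fun _ => (1 : ℝ)) i else 0 := hv
  have hB : ∀ i j, modelForm (circleProductMetric (σ * ε ^ 2) γ) y (b.prod v' i) (b.prod v' j)
      = if i = j then Sum.elim (fun _ => σ)
        (Sum.elim (fun _ => (-1 : ℝ)) (fun _ => (1 : ℝ))) i else 0 := by
    intro i j
    rw [circleProductMetric_apply_prod]
    have h0 : circleDt y.1 (0 : EuclideanSpace ℝ (Fin 1)) = 0 := map_zero _
    rcases i with i | i <;> rcases j with j | j
    · have hij : i = j := Subsingleton.elim _ _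
      simp only [Module.Basis.prod_apply_inl_fst, Module.Basis.prod_apply_inl_snd, map_zero, hb,
        hij, if_true, Sum.elim_inl, add_zero]
      field_simp
    · simp [h0]
    · simp [h0]
    · simp [h0, hv']
  rcases hσ with ⟨rfl, rfl, rfl⟩ | ⟨rfl, rfl, rfl⟩
  · let f : Fin 1 ⊕ (Fin r ⊕ Fin q) ≃ Fin r ⊕ Fin (q + 1) :=
      (Equiv.sumComm _ _).trans ((Equiv.sumAssoc _ _ _).trans
        (Equiv.sumCongr (Equiv.refl _) finSumFinEquiv))
    refine HasSignature.of_basis (V := TangentSpace ((𝓡 1).prod (𝓡 n)) y)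
      (b.prod v' : Module.Basis _ ℝ (EuclideanSpace ℝ (Fin 1) × EuclideanSpace ℝ (Fin n)))
      f fun i j => (hB i j).trans ?_
    rcases i with i | i | i <;> rfl
  · let f : Fin 1 ⊕ (Fin p ⊕ Fin s) ≃ Fin (p + 1) ⊕ Fin s :=
      (Equiv.sumAssoc _ _ _).symm.trans
        (Equiv.sumCongr ((Equiv.sumComm _ _).trans finSumFinEquiv) (Equiv.refl _))
    refine HasSignature.of_basis (V := TangentSpace ((𝓡 1).prod (𝓡 n)) y)
      (b.prod v' : Module.Basis _ ℝ (EuclideanSpace ℝ (Fin 1) × EuclideanSpace ℝ (Fin n)))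
      f fun i j => (hB i j).trans ?_
    rcases i with i | i | i <;> rfl

theorem IsSmoothFamily.isSmoothMetric {σ : ℝ} {p q r s : ℕ} (h : IsSmoothFamily γ)
    (hγ : ∀ z x, HasSignature (γ z x) p q)
    (hσ : (σ = 1 ∧ r = p ∧ s = q + 1) ∨ (σ = -1 ∧ r = p + 1 ∧ s = q)) {ε : ℝ} (hε : 0 < ε) :
    IsSmoothMetric (circleProductMetric (σ * ε ^ 2) γ) r s where
  contMDiff := h.contMDiff _
  hasSignature _ := hasSignature_circleProductMetric hσ hε (hγ _ _)

theorem IsSmoothFamily.isSmoothMetric_apply {p q : ℕ} (h : IsSmoothFamily γ)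
    (hγ : ∀ z x, HasSignature (γ z x) p q) (z : Circle) : IsSmoothMetric (γ z) p q where
  contMDiff x := by
    have he₁ := IsManifold.chart_mem_maximalAtlas (I := 𝓡 1) (n := ∞) z
    have he₂ := IsManifold.chart_mem_maximalAtlas (I := 𝓡 n) (n := ∞) x
    refine (contMDiffAt_bilinField_iff (γ z) he₂ (mem_chart_source _ x)).2 ?_
    have h1 := (h _ he₁ _ he₂).contDiffAt (isOpen_prod_target.mem_nhds
      (⟨mem_extChartAt_target z, mem_extChartAt_target x⟩ :
        ((extChartAt (𝓡 1) z z, extChartAt (𝓡 n) x x) : _ × _) ∈ _ ×ˢ _))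
    have h2 : ContDiffAt ℝ ∞ (fun u : EuclideanSpace ℝ (Fin n) => (extChartAt (𝓡 1) z z, u))
      (extChartAt (𝓡 n) x x) := contDiffAt_const.prodMk contDiffAt_id
    have h3 := ContDiffAt.comp (extChartAt (𝓡 n) x x) h1 h2
    refine h3.congr_of_eventuallyEq (Eventually.of_forall fun u => ?_)
    have : ((chartAt (EuclideanSpace ℝ (Fin 1)) z).extend (𝓡 1)).symm (extChartAt (𝓡 1) z z) = z :=
      extChartAt_to_inv z
    simp only [Function.comp_apply, this]
  hasSignature := hγ z

end ProductFamily
end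

noncomputable section
set_option linter.unusedSectionVars false
set_option synthInstance.maxHeartbeats 200000

section TimeCurvature

variable {κ : Type*} [Fintype κ] [DecidableEq κ] {E : Type*} [NormedAddCommGroup E]
  [NormedSpace ℝ E]

/-- The part of the scalar curvature of `blockMetric F γ c` which scales as `c⁻¹`. -/
def timeCurvature (b : Module.Basis (Fin 1 ⊕ κ) ℝ E) (F : E → ℝ) (γ : E → Matrix κ κ ℝ)
    (y : E) : ℝ :=
  (F y)⁻¹ * (-pderiv b (Sum.inl 0) (fun v => (shapeMatrix b γ v).trace) y
    + 1 / 2 * (shapeMatrix b γ y).trace * (pderiv b (Sum.inl 0) F y / F y)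
    - 1 / 4 * (shapeMatrix b γ y * shapeMatrix b γ y).trace
    - 1 / 4 * (shapeMatrix b γ y).trace ^ 2)

theorem timeCurvature_eq_zero {b : Module.Basis (Fin 1 ⊕ κ) ℝ E} {F : E → ℝ}
    {γ : E → Matrix κ κ ℝ} {y : E} (h : timeDeriv b γ =ᶠ[𝓝 y] 0) : timeCurvature b F γ y = 0 := by
  have h1 : shapeMatrix b γ y = 0 := by
    rw [shapeMatrix, h.eq_of_nhds, Pi.zero_apply, mul_zero]
  have h2 : (fun v => (shapeMatrix b γ v).trace) =ᶠ[𝓝 y] fun _ => 0 := by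
    filter_upwards [h] with v hv
    rw [shapeMatrix, hv, Pi.zero_apply, mul_zero, Matrix.trace_zero]
  have h3 : pderiv b (Sum.inl 0) (fun v => (shapeMatrix b γ v).trace) y = 0 := by
    rw [pderiv, h2.fderiv_eq (𝕜 := ℝ)]
    simp
  simp [timeCurvature, h1, h3]

end TimeCurvature

section Action

variable {n : ℕ} {N : Type*} [TopologicalSpace N] [ChartedSpace (EuclideanSpace ℝ (Fin n)) N]
  [IsManifold (𝓡 n) ∞ N]
  {e₁ : OpenPartialHomeomorph Circle (EuclideanSpace ℝ (Fin 1))}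
  {e₂ : OpenPartialHomeomorph N (EuclideanSpace ℝ (Fin n))}
  {a : ℝ} {γ : Circle → BilinField (𝓡 n) N}

/-- The component of `dt` in the chart `e₁`. -/
def angleDensity (e₁ : OpenPartialHomeomorph Circle (EuclideanSpace ℝ (Fin 1)))
    (u : EuclideanSpace ℝ (Fin 1)) : ℝ :=
  angleForm e₁ u ((EuclideanSpace.basisFun (Fin 1) ℝ).toBasis 0)

/-- The components of the family `γ` in the charts `e₁` and `e₂`. -/
def familyComponents (γ : Circle → BilinField (𝓡 n) N)
    (e₁ : OpenPartialHomeomorph Circle (EuclideanSpace ℝ (Fin 1)))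
    (e₂ : OpenPartialHomeomorph N (EuclideanSpace ℝ (Fin n)))
    (u : EuclideanSpace ℝ (Fin 1) × EuclideanSpace ℝ (Fin n)) : Matrix (Fin n) (Fin n) ℝ :=
  chartComponents (EuclideanSpace.basisFun (Fin n) ℝ).toBasis
    (γ ((e₁.extend (𝓡 1)).symm u.1)) e₂ u.2

theorem productBasis_inl (i : Fin 1) :
    productBasis n (Sum.inl i) = ((EuclideanSpace.basisFun (Fin 1) ℝ).toBasis i, 0) :=
  Prod.ext (Module.Basis.prod_apply_inl_fst ..) (Module.Basis.prod_apply_inl_snd ..)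

theorem productBasis_inr (i : Fin n) :
    productBasis n (Sum.inr i) = (0, (EuclideanSpace.basisFun (Fin n) ℝ).toBasis i) :=
  Prod.ext (Module.Basis.prod_apply_inr_fst ..) (Module.Basis.prod_apply_inr_snd ..)

theorem chartComponents_circleProductMetric
    (he₁ : e₁ ∈ IsManifold.maximalAtlas (𝓡 1) ∞ Circle)
    (he₂ : e₂ ∈ IsManifold.maximalAtlas (𝓡 n) ∞ N)
    {u : EuclideanSpace ℝ (Fin 1) × EuclideanSpace ℝ (Fin n)}
    (hu : u ∈ (e₁.extend (𝓡 1)).target ×ˢ (e₂.extend (𝓡 n)).target) :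
    chartComponents (productBasis n) (circleProductMetric a γ) (e₁.prod e₂) u
      = blockMetric (fun y => angleDensity e₁ y.1 ^ 2) (familyComponents γ e₁ e₂) a u := by
  rw [chartComponents_eq]
  ext i j
  rw [formMatrix, Matrix.of_apply, chartForm_circleProductMetric he₁ he₂ hu]
  rcases i with i | i <;> rcases j with j | j <;>
    simp only [productBasis_inl, productBasis_inr, blockMetric, Matrix.fromBlocks_apply₁₁,
      Matrix.fromBlocks_apply₁₂, Matrix.fromBlocks_apply₂₁, Matrix.fromBlocks_apply₂₂,
      Matrix.of_apply, Matrix.zero_apply, map_zero, _root_.zero_apply, mul_zero, zero_mul, add_zero,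
      zero_add]
  · rw [Subsingleton.elim i 0, Subsingleton.elim j 0, sq]
    rfl
  · rfl

theorem angleDensity_ne_zero (he₁ : e₁ ∈ IsManifold.maximalAtlas (𝓡 1) ∞ Circle)
    {u : EuclideanSpace ℝ (Fin 1)} (hu : u ∈ (e₁.extend (𝓡 1)).target) : angleDensity e₁ u ≠ 0 :=
  fun h => Module.Basis.ne_zero _ 0 (angleForm_injective he₁ hu h)

theorem contDiffOn_angleDensity (he₁ : e₁ ∈ IsManifold.maximalAtlas (𝓡 1) ∞ Circle) :
    ContDiffOn ℝ ∞ (angleDensity e₁) (e₁.extend (𝓡 1)).target :=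
  contDiffOn_angleForm_apply he₁ _

theorem pderiv_comp_fst (f : EuclideanSpace ℝ (Fin 1) → ℝ)
    {u : EuclideanSpace ℝ (Fin 1) × EuclideanSpace ℝ (Fin n)} (hf : DifferentiableAt ℝ f u.1)
    (i : Fin 1 ⊕ Fin n) :
    pderiv (productBasis n) i (fun y => f y.1) u = fderiv ℝ f u.1 (productBasis n i).1 := by
  have h1 := hf.hasFDerivAt.comp u (hasFDerivAt_fst (𝕜 := ℝ) (p := u))
  have h2 : (f ∘ Prod.fst) = fun y : EuclideanSpace ℝ (Fin 1) × EuclideanSpace ℝ (Fin n) =>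
    f y.1 := rfl
  rw [pderiv, ← h2, h1.fderiv]
  rfl

variable {p q r s : ℕ} {σ : ℝ}

theorem IsSmoothFamily.isBlockOn (h : IsSmoothFamily γ) (hγ : ∀ z x, HasSignature (γ z x) p q)
    (he₁ : e₁ ∈ IsManifold.maximalAtlas (𝓡 1) ∞ Circle)
    (he₂ : e₂ ∈ IsManifold.maximalAtlas (𝓡 n) ∞ N) :
    IsBlockOn (productBasis n) (fun y => angleDensity e₁ y.1 ^ 2) (familyComponents γ e₁ e₂)
      ((e₁.extend (𝓡 1)).target ×ˢ (e₂.extend (𝓡 n)).target) where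
  isOpen := isOpen_prod_target
  contDiffOn_fst := ((contDiffOn_angleDensity he₁).comp contDiff_fst.contDiffOn
    fun _ hu => hu.1).pow 2
  contDiffOn_snd _ _ := ((h _ he₁ _ he₂).clm_apply contDiffOn_const).clm_apply contDiffOn_const
  fst_ne_zero y hy := pow_ne_zero 2 (angleDensity_ne_zero he₁ hy.1)
  det_ne_zero y hy :=
    ((h.isSmoothMetric_apply hγ ((e₁.extend (𝓡 1)).symm y.1)).isMetricOn _ he₂).det_ne_zero _ hy.2
  symm y _ _ _ := (hγ ((e₁.extend (𝓡 1)).symm y.1) ((e₂.extend (𝓡 n)).symm y.2)).symm _ _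
  pderiv_fst y hy k := by
    have h1 : DifferentiableAt ℝ (fun v => angleDensity e₁ v ^ 2) y.1 :=
      ((((contDiffOn_angleDensity he₁).contDiffAt
        (e₁.isOpen_extend_target.mem_nhds hy.1)).differentiableAt (by simp)).pow 2)
    rw [pderiv_comp_fst _ h1, productBasis_inr, map_zero]

/-- The part of the scalar curvature of `σ ε² dt² + γ` which scales as `ε⁻²`. -/
def singularCurvature (σ : ℝ) (γ : Circle → BilinField (𝓡 n) N) (x : Circle × N) : ℝ :=
  (scalarCurvature (productBasis n) (circleProductMetric (σ * (1 / 2) ^ 2) γ) x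
    - scalarCurvature (productBasis n) (circleProductMetric (σ * 1 ^ 2) γ) x) / 3

/-- The part of the scalar curvature of `σ ε² dt² + γ` which does not depend on `ε`. -/
def regularCurvature (σ : ℝ) (γ : Circle → BilinField (𝓡 n) N) (x : Circle × N) : ℝ :=
  scalarCurvature (productBasis n) (circleProductMetric (σ * 1 ^ 2) γ) x
    - singularCurvature σ γ x

variable (hs : IsSmoothFamily γ) (hγ : ∀ z x, HasSignature (γ z x) p q)
  (hσ : (σ = 1 ∧ r = p ∧ s = q + 1) ∨ (σ = -1 ∧ r = p + 1 ∧ s = q))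

include hs hγ hσ in
theorem IsSmoothFamily.exists_scalarCurvature_eq
    (he₁ : e₁ ∈ IsManifold.maximalAtlas (𝓡 1) ∞ Circle)
    (he₂ : e₂ ∈ IsManifold.maximalAtlas (𝓡 n) ∞ N)
    {u : EuclideanSpace ℝ (Fin 1) × EuclideanSpace ℝ (Fin n)}
    (hu : u ∈ (e₁.extend (𝓡 1)).target ×ˢ (e₂.extend (𝓡 n)).target) :
    ∃ A : ℝ, ∀ ε : ℝ, 0 < ε → scalarCurvature (productBasis n) (circleProductMetric (σ * ε ^ 2) γ)
      (((e₁.prod e₂).extend ((𝓡 1).prod (𝓡 n))).symm u) = A + (σ * ε ^ 2)⁻¹ *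
        timeCurvature (productBasis n) (fun y => angleDensity e₁ y.1 ^ 2)
          (familyComponents γ e₁ e₂) u := by
  have he := prod_mem_maximalAtlas he₁ he₂
  have hu' : u ∈ ((e₁.prod e₂).extend ((𝓡 1).prod (𝓡 n))).target := by
    rwa [extend_prod_target]
  have hx : ((e₁.prod e₂).extend ((𝓡 1).prod (𝓡 n))).symm u ∈ (e₁.prod e₂).source := by
    rw [← OpenPartialHomeomorph.extend_source (I := (𝓡 1).prod (𝓡 n))]
    exact ((e₁.prod e₂).extend ((𝓡 1).prod (𝓡 n))).map_target hu'
  have hσ0 : σ ≠ 0 := by rcases hσ with h | h <;> rw [h.1] <;> norm_num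
  refine ⟨∑ i, ∑ j, (familyComponents γ e₁ e₂ u)⁻¹ i j
    * spaceRicci (productBasis n) (familyComponents γ e₁ e₂) i j u, fun ε hε => ?_⟩
  rw [(hs.isSmoothMetric hγ hσ hε).scalarCurvature_eq (productBasis n) he hx,
    ((e₁.prod e₂).extend ((𝓡 1).prod (𝓡 n))).right_inv hu',
    coordScalarCurvature_congr (G' := blockMetric (fun y => angleDensity e₁ y.1 ^ 2)
      (familyComponents γ e₁ e₂) (σ * ε ^ 2)) ?_ (productBasis n)]
  · exact (hs.isBlockOn hγ he₁ he₂).coordScalarCurvature_eq hu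
      (mul_ne_zero hσ0 (pow_ne_zero 2 hε.ne'))
  · filter_upwards [isOpen_prod_target.mem_nhds hu] with y hy
    exact chartComponents_circleProductMetric he₁ he₂ hy

include hs hγ hσ in
theorem IsSmoothFamily.singularCurvature_eq
    (he₁ : e₁ ∈ IsManifold.maximalAtlas (𝓡 1) ∞ Circle)
    (he₂ : e₂ ∈ IsManifold.maximalAtlas (𝓡 n) ∞ N)
    {u : EuclideanSpace ℝ (Fin 1) × EuclideanSpace ℝ (Fin n)}
    (hu : u ∈ (e₁.extend (𝓡 1)).target ×ˢ (e₂.extend (𝓡 n)).target) :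
    singularCurvature σ γ (((e₁.prod e₂).extend ((𝓡 1).prod (𝓡 n))).symm u) = σ⁻¹ *
        timeCurvature (productBasis n) (fun y => angleDensity e₁ y.1 ^ 2)
          (familyComponents γ e₁ e₂) u := by
  obtain ⟨A, hA⟩ := hs.exists_scalarCurvature_eq hγ hσ he₁ he₂ hu
  rw [singularCurvature, hA _ (by norm_num), hA _ one_pos, mul_inv, mul_inv]
  ring

include hs hγ hσ in
theorem IsSmoothFamily.scalarCurvature_eq_add {ε : ℝ} (hε : 0 < ε) (x : Circle × N) :
    scalarCurvature (productBasis n) (circleProductMetric (σ * ε ^ 2) γ) x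
      = regularCurvature σ γ x + (ε ^ 2)⁻¹ * singularCurvature σ γ x := by
  have he₁ := IsManifold.chart_mem_maximalAtlas (I := 𝓡 1) (n := ∞) x.1
  have he₂ := IsManifold.chart_mem_maximalAtlas (I := 𝓡 n) (n := ∞) x.2
  have hu : (extChartAt (𝓡 1) x.1 x.1, extChartAt (𝓡 n) x.2 x.2)
      ∈ ((chartAt (EuclideanSpace ℝ (Fin 1)) x.1).extend (𝓡 1)).target
        ×ˢ ((chartAt (EuclideanSpace ℝ (Fin n)) x.2).extend (𝓡 n)).target :=
    ⟨mem_extChartAt_target x.1, mem_extChartAt_target x.2⟩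
  obtain ⟨A, hA⟩ := hs.exists_scalarCurvature_eq hγ hσ he₁ he₂ hu
  have hx : (((chartAt (EuclideanSpace ℝ (Fin 1)) x.1).prod
      (chartAt (EuclideanSpace ℝ (Fin n)) x.2)).extend ((𝓡 1).prod (𝓡 n))).symm
      (extChartAt (𝓡 1) x.1 x.1, extChartAt (𝓡 n) x.2 x.2) = x :=
    Prod.ext (extChartAt_to_inv (I := 𝓡 1) x.1) (extChartAt_to_inv (I := 𝓡 n) x.2)
  rw [hx] at hA
  rw [regularCurvature, singularCurvature, hA _ hε, hA _ one_pos, hA (1 / 2) (by norm_num),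
    mul_inv, mul_inv, mul_inv]
  ring

include hs hγ hσ in
theorem IsSmoothFamily.continuous_singularCurvature : Continuous (singularCurvature σ γ) :=
  (((hs.isSmoothMetric hγ hσ (by norm_num)).continuous_scalarCurvature _).sub
    ((hs.isSmoothMetric hγ hσ one_pos).continuous_scalarCurvature _)).div_const _

include hs hγ hσ in
theorem IsSmoothFamily.continuous_regularCurvature : Continuous (regularCurvature σ γ) :=
  ((hs.isSmoothMetric hγ hσ one_pos).continuous_scalarCurvature _).sub
    (hs.continuous_singularCurvature hγ hσ)

variable [MeasurableSpace N] [BorelSpace N] [T2Space N] [CompactSpace N]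

theorem borelSpace_circle_prod (n : ℕ) (N : Type*) [TopologicalSpace N]
    [ChartedSpace (EuclideanSpace ℝ (Fin n)) N] [CompactSpace N] [MeasurableSpace N]
    [BorelSpace N] : BorelSpace (Circle × N) := by
  have : SecondCountableTopology N :=
    ChartedSpace.secondCountable_of_sigmaCompact (EuclideanSpace ℝ (Fin n)) N
  infer_instance

theorem volumeMeasure_circleProductMetric (σ : ℝ) (γ : Circle → BilinField (𝓡 n) N) {ε : ℝ}
    (hε : 0 < ε) :
    volumeMeasure (productBasis n) (circleProductMetric (σ * ε ^ 2) γ)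
      = ENNReal.ofReal ε •
        volumeMeasure (productBasis n) (circleProductMetric (σ * 1 ^ 2) γ) := by
  have := borelSpace_circle_prod n N
  refine volumeMeasure_eq_smul hε ?_
  rintro _ ⟨e₁, he₁, e₂, he₂, rfl⟩ u hu
  rw [extend_prod_target] at hu
  have he₁ := IsManifold.subset_maximalAtlas (I := 𝓡 1) (n := ∞) he₁
  have he₂ := IsManifold.subset_maximalAtlas (I := 𝓡 n) (n := ∞) he₂
  rw [chartComponents_circleProductMetric he₁ he₂ hu,
    chartComponents_circleProductMetric he₁ he₂ hu, blockMetric_det, blockMetric_det]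
  simp only [abs_mul, abs_pow, abs_of_pos hε, abs_one]
  ring

include hs hγ hσ in
theorem IsSmoothFamily.integrable_of_continuous {f : Circle × N → ℝ} (hf : Continuous f) {ε : ℝ}
    (hε : 0 < ε) :
    Integrable f (volumeMeasure (productBasis n) (circleProductMetric (σ * ε ^ 2) γ)) := by
  have := borelSpace_circle_prod n N
  have := (hs.isSmoothMetric hγ hσ hε).isLocallyFiniteMeasure (productBasis n)
  exact hf.integrable_of_hasCompactSupport (HasCompactSupport.of_compactSpace f)

include hs hγ hσ in
theorem IsSmoothFamily.einsteinHilbert_eq {ε : ℝ} (hε : 0 < ε) :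
    einsteinHilbert (productBasis n) (circleProductMetric (σ * ε ^ 2) γ)
      = (∫ x, singularCurvature σ γ x
          ∂(volumeMeasure (productBasis n) (circleProductMetric (σ * 1 ^ 2) γ))) / ε
        + (∫ x, regularCurvature σ γ x
          ∂(volumeMeasure (productBasis n) (circleProductMetric (σ * 1 ^ 2) γ))) * ε := by
  have h1 := hs.integrable_of_continuous hγ hσ (hs.continuous_singularCurvature hγ hσ) one_pos
  have h2 := hs.integrable_of_continuous hγ hσ (hs.continuous_regularCurvature hγ hσ) one_pos
  rw [einsteinHilbert, volumeMeasure_circleProductMetric σ γ hε, integral_smul_measure,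
    integral_congr_ae (Eventually.of_forall (hs.scalarCurvature_eq_add hγ hσ hε)),
    integral_add h2 (h1.const_mul _), integral_const_mul, ENNReal.toReal_ofReal hε.le, smul_eq_mul]
  field_simp
  ring

end Action

section Asymptotics

variable {f : ℝ → ℝ} {a c : ℝ} (hf : ∀ ε ∈ Ioc (0 : ℝ) 1, f ε = a / ε + c * ε)

include hf in
theorem eventuallyEq_of_eq_div_add : f =ᶠ[𝓝[>] 0] fun ε => a * ε⁻¹ + c * ε := by
  filter_upwards [Ioc_mem_nhdsGT (zero_lt_one' ℝ)] with ε hε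
  rw [hf ε hε, div_eq_mul_inv]

include hf in
theorem tendsto_atBot_of_eq_div_add (ha : a < 0) : Tendsto f (𝓝[>] 0) atBot := by
  refine Tendsto.congr' (eventuallyEq_of_eq_div_add hf).symm ?_
  refine Filter.Tendsto.atBot_add (C := c * 0) ?_ ?_
  · exact (tendsto_inv_nhdsGT_zero).const_mul_atTop_of_neg ha
  · exact (tendsto_id.mono_left nhdsWithin_le_nhds).const_mul c

include hf in
theorem isBigO_of_eq_div_add : f =O[𝓝[>] 0] fun ε => ε⁻¹ := by
  refine (eventuallyEq_of_eq_div_add hf).trans_isBigO ?_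
  refine ((Asymptotics.isBigO_refl _ _).const_mul_left a).add ?_
  refine Asymptotics.IsBigO.const_mul_left ?_ c
  refine Asymptotics.IsBigO.of_bound 1 ?_
  filter_upwards [Ioc_mem_nhdsGT (zero_lt_one' ℝ)] with ε hε
  rw [one_mul, Real.norm_eq_abs, Real.norm_eq_abs, abs_of_pos hε.1, abs_of_pos (inv_pos.2 hε.1)]
  exact hε.2.trans ((one_le_inv₀ hε.1).2 hε.2)

end Asymptotics
end

noncomputable section
set_option linter.unusedSectionVars false
set_option synthInstance.maxHeartbeats 200000

section ExpMatrix

variable {κ : Type*} [Fintype κ] [DecidableEq κ] {V : Matrix κ κ ℝ} {d : κ → ℝ}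

/-- The matrix with eigenvalues `d`, the eigenvectors being the columns of `V`. -/
def genMatrix (V : Matrix κ κ ℝ) (d : κ → ℝ) : Matrix κ κ ℝ := V * Matrix.diagonal d * V⁻¹

/-- The exponential of `τ` times `genMatrix V d`. -/
def flowMatrix (V : Matrix κ κ ℝ) (d : κ → ℝ) (τ : ℝ) : Matrix κ κ ℝ :=
  V * Matrix.diagonal (fun i => Real.exp (τ * d i)) * V⁻¹

theorem flowMatrix_zero (hV : IsUnit V.det) : flowMatrix V d 0 = 1 := by
  simp [flowMatrix, Matrix.mul_nonsing_inv _ hV]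

theorem det_flowMatrix (hV : IsUnit V.det) (τ : ℝ) :
    (flowMatrix V d τ).det = Real.exp (τ * ∑ i, d i) := by
  rw [flowMatrix, Matrix.det_mul, Matrix.det_mul, mul_right_comm, ← Matrix.det_mul,
    Matrix.mul_nonsing_inv _ hV, Matrix.det_one, one_mul, Matrix.det_diagonal, Finset.mul_sum,
    Real.exp_sum]

theorem isUnit_det_flowMatrix (hV : IsUnit V.det) (τ : ℝ) : IsUnit (flowMatrix V d τ).det := by
  rw [det_flowMatrix hV]
  exact (Real.exp_pos _).ne'.isUnit

theorem flowMatrix_mul_genMatrix (hV : IsUnit V.det) (τ : ℝ) :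
    flowMatrix V d τ * genMatrix V d
      = V * Matrix.diagonal (fun i => Real.exp (τ * d i) * d i) * V⁻¹ := by
  rw [flowMatrix, genMatrix, Matrix.mul_assoc, Matrix.mul_assoc V (Matrix.diagonal d),
    Matrix.nonsing_inv_mul_cancel_left _ _ hV, ← Matrix.mul_assoc, Matrix.mul_assoc V,
    Matrix.diagonal_mul_diagonal]

theorem genMatrix_mul_flowMatrix (hV : IsUnit V.det) (τ : ℝ) :
    genMatrix V d * flowMatrix V d τ = flowMatrix V d τ * genMatrix V d := by
  rw [flowMatrix_mul_genMatrix hV, flowMatrix, genMatrix, Matrix.mul_assoc,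
    Matrix.mul_assoc V (Matrix.diagonal _) V⁻¹,
    Matrix.nonsing_inv_mul_cancel_left _ _ hV, ← Matrix.mul_assoc, Matrix.mul_assoc V,
    Matrix.diagonal_mul_diagonal]
  simp only [mul_comm]

theorem flowMatrix_apply (τ : ℝ) (i j : κ) :
    flowMatrix V d τ i j = ∑ k, V i k * Real.exp (τ * d k) * V⁻¹ k j := by
  rw [flowMatrix, Matrix.mul_apply]
  simp only [Matrix.mul_diagonal]

theorem hasDerivAt_flowMatrix (hV : IsUnit V.det) (i j : κ) (τ : ℝ) :
    HasDerivAt (fun t => flowMatrix V d t i j) ((flowMatrix V d τ * genMatrix V d) i j) τ := by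
  have h : ∀ k, HasDerivAt (fun t => V i k * Real.exp (t * d k) * V⁻¹ k j)
      (V i k * (Real.exp (τ * d k) * d k) * V⁻¹ k j) τ := fun k =>
    (((hasDerivAt_mul_const (d k)).exp).const_mul _).mul_const _
  have h2 := HasDerivAt.fun_sum (u := Finset.univ) fun k _ => h k
  rw [flowMatrix_mul_genMatrix hV]
  simp only [flowMatrix_apply]
  refine h2.congr_deriv ?_
  rw [Matrix.mul_apply]
  simp only [Matrix.mul_diagonal]

theorem contDiff_flowMatrix (i j : κ) : ContDiff ℝ ∞ (fun t => flowMatrix V d t i j) := by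
  simp only [flowMatrix_apply]
  exact ContDiff.sum fun k _ => ((contDiff_const.mul
    (contDiff_id.mul contDiff_const).exp).mul contDiff_const)

theorem trace_genMatrix (hV : IsUnit V.det) : (genMatrix V d).trace = ∑ i, d i := by
  rw [genMatrix, Matrix.trace_mul_comm, Matrix.nonsing_inv_mul_cancel_left _ _ hV,
    Matrix.trace_diagonal]

/-- The quadratic form whose sign decides the sign of the action. -/
def actionForm (V : Matrix κ κ ℝ) (d : κ → ℝ) (G : Matrix κ κ ℝ) : ℝ :=
  4 * (∑ i, d i) ^ 2 - 2 * (genMatrix V d * genMatrix V d).trace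
    - 2 * (genMatrix V d * (G⁻¹ * (genMatrix V d).transpose * G)).trace

theorem actionForm_eq (hV : IsUnit V.det) {G S : Matrix κ κ ℝ} (hS : IsUnit S.det)
    (hSd : ∃ s : κ → ℝ, S = Matrix.diagonal s) (hG : V.transpose * G * V = S) :
    actionForm V d G = 4 * (∑ i, d i) ^ 2 - 4 * ∑ i, d i ^ 2 := by
  obtain ⟨s, rfl⟩ := hSd
  have hVt : IsUnit V.transpose.det := by rwa [Matrix.det_transpose]
  have h1 : (genMatrix V d * genMatrix V d).trace = ∑ i, d i ^ 2 := by
    have : genMatrix V d * genMatrix V d = V * (Matrix.diagonal d * Matrix.diagonal d * V⁻¹) := by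
      simp only [genMatrix, Matrix.mul_assoc]
      rw [Matrix.nonsing_inv_mul_cancel_left _ _ hV]
    rw [this, Matrix.trace_mul_comm, Matrix.mul_assoc, Matrix.nonsing_inv_mul _ hV, Matrix.mul_one,
      Matrix.diagonal_mul_diagonal, Matrix.trace_diagonal]
    simp only [sq]
  have hGV : G * V = V.transpose⁻¹ * Matrix.diagonal s := by
    rw [← hG, Matrix.mul_assoc, Matrix.nonsing_inv_mul_cancel_left _ _ hVt]
  have hGdet : IsUnit G.det := by
    have := congrArg Matrix.det hG
    rw [Matrix.det_mul, Matrix.det_mul] at this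
    rw [← this] at hS
    exact isUnit_of_mul_isUnit_right (isUnit_of_mul_isUnit_left hS)
  have h2 : G⁻¹ * V.transpose⁻¹ = V * (Matrix.diagonal s)⁻¹ := by
    have : G⁻¹ * (G * V) * (Matrix.diagonal s)⁻¹ = G⁻¹ * V.transpose⁻¹ := by
      rw [hGV, Matrix.mul_assoc, Matrix.mul_assoc, Matrix.mul_nonsing_inv _ hS, Matrix.mul_one]
    rw [← this, Matrix.nonsing_inv_mul_cancel_left _ _ hGdet]
  have h3 : (genMatrix V d * (G⁻¹ * (genMatrix V d).transpose * G)).trace = ∑ i, d i ^ 2 := by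
    have e1 : (genMatrix V d).transpose
        = V.transpose⁻¹ * (Matrix.diagonal d * V.transpose) := by
      rw [genMatrix, Matrix.transpose_mul, Matrix.transpose_mul, Matrix.diagonal_transpose,
        Matrix.transpose_nonsing_inv]
    have e2 : genMatrix V d * (G⁻¹ * (genMatrix V d).transpose * G)
        = V * (Matrix.diagonal d * ((Matrix.diagonal s)⁻¹ * (Matrix.diagonal d
          * (V.transpose * G)))) := by
      rw [e1, ← Matrix.mul_assoc G⁻¹, h2]
      simp only [genMatrix, Matrix.mul_assoc]
      rw [Matrix.nonsing_inv_mul_cancel_left _ _ hV]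
    rw [e2, Matrix.trace_mul_comm]
    simp only [Matrix.mul_assoc]
    rw [← Matrix.mul_assoc V.transpose, hG]
    rw [Matrix.inv_diagonal]
    simp only [Matrix.diagonal_mul_diagonal, Matrix.trace_diagonal]
    refine Finset.sum_congr rfl fun i _ => ?_
    have hsi : IsUnit s := by
      rw [Matrix.det_diagonal] at hS
      rw [Pi.isUnit_iff]
      exact fun i => (Finset.prod_ne_zero_iff.1 hS.ne_zero i (Finset.mem_univ i)).isUnit
    have h5 : Ring.inverse s i * s i = 1 := congrFun (Ring.inverse_mul_cancel s hsi) i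
    linear_combination d i ^ 2 * h5
  rw [actionForm, h1, h3]
  ring

variable {E : Type*} [NormedAddCommGroup E] [NormedSpace ℝ E]
  {b : Module.Basis (Fin 1 ⊕ κ) ℝ E} {τ : E → ℝ} {G₀ : E → Matrix κ κ ℝ} {y : E}

/-- The metric `G₀` deformed by the flow at time `τ`. -/
def flowMetric (V : Matrix κ κ ℝ) (d : κ → ℝ) (τ : E → ℝ) (G₀ : E → Matrix κ κ ℝ) (y : E) :
    Matrix κ κ ℝ :=
  (flowMatrix V d (τ y)).transpose * G₀ y * flowMatrix V d (τ y)

theorem timeDeriv_flowMetric (hV : IsUnit V.det) (hτ : DifferentiableAt ℝ τ y)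
    (hG : ∀ i j, DifferentiableAt ℝ (fun v => G₀ v i j) y) (h0 : timeDeriv b G₀ y = 0) :
    timeDeriv b (flowMetric V d τ G₀) y = pderiv b (Sum.inl 0) τ y •
      ((genMatrix V d).transpose * flowMetric V d τ G₀ y
        + flowMetric V d τ G₀ y * genMatrix V d) := by
  set P := flowMatrix V d (τ y) with hP
  set K := genMatrix V d with hK
  have hP' : ∀ i j, HasFDerivAt (fun v => flowMatrix V d (τ v) i j)
      ((P * K) i j • fderiv ℝ τ y) y := fun i j =>
    (hasDerivAt_flowMatrix hV i j (τ y)).comp_hasFDerivAt y hτ.hasFDerivAt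
  have h1 : timeDeriv b (flowMetric V d τ G₀) y = pderiv b (Sum.inl 0) τ y •
      ((P * K).transpose * G₀ y * P + P.transpose * G₀ y * (P * K)) := by
    ext i j
    have h2 : HasFDerivAt (fun v => flowMetric V d τ G₀ v i j) (∑ l,
        ((∑ k, P k i * G₀ y k l) • ((P * K) l j • fderiv ℝ τ y)
          + P l j • ∑ k, (P k i • fderiv ℝ (fun v => G₀ v k l) y
            + G₀ y k l • ((P * K) k i • fderiv ℝ τ y)))) y := by
      simp only [flowMetric, Matrix.mul_apply, Matrix.transpose_apply]
      refine HasFDerivAt.fun_sum fun l _ => ?_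
      refine HasFDerivAt.fun_mul (HasFDerivAt.fun_sum fun k _ => ?_) (hP' l j)
      exact (hP' k i).fun_mul (hG k l).hasFDerivAt
    have h3 : ∀ k l, fderiv ℝ (fun v => G₀ v k l) y (b (Sum.inl 0)) = 0 := fun k l =>
      congrFun (congrFun h0 k) l
    rw [timeDeriv, Matrix.of_apply, pderiv, h2.fderiv]
    simp only [_root_.sum_apply, _root_.add_apply, _root_.smul_apply, smul_eq_mul, h3, mul_zero,
      zero_add, Matrix.smul_apply, Matrix.add_apply, pderiv]
    rw [Matrix.mul_apply, Matrix.mul_apply (M := P.transpose * G₀ y), ← Finset.sum_add_distrib,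
      Finset.mul_sum]
    refine Finset.sum_congr rfl fun l _ => ?_
    simp only [Matrix.mul_apply (M := (P * K).transpose), Matrix.mul_apply (M := P.transpose),
      Matrix.transpose_apply, Finset.mul_sum, Finset.sum_mul, mul_add]
    rw [add_comm]
    congr 1 <;> exact Finset.sum_congr rfl fun k _ => by ring
  rw [h1, ← genMatrix_mul_flowMatrix hV, ← hP, ← hK, Matrix.transpose_mul,
    flowMetric, ← hP]
  congr 1
  rw [← Matrix.transpose_mul, hK, hP, genMatrix_mul_flowMatrix hV, Matrix.transpose_mul]
  simp only [Matrix.mul_assoc]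

theorem det_flowMetric (hV : IsUnit V.det) : (flowMetric V d τ G₀ y).det
    = Real.exp (τ y * ∑ i, d i) ^ 2 * (G₀ y).det := by
  rw [flowMetric, Matrix.det_mul, Matrix.det_mul, Matrix.det_transpose, det_flowMatrix hV]
  ring

theorem shapeMatrix_flowMetric (hV : IsUnit V.det) (hτ : DifferentiableAt ℝ τ y)
    (hG : ∀ i j, DifferentiableAt ℝ (fun v => G₀ v i j) y) (h0 : timeDeriv b G₀ y = 0)
    (hdet : (G₀ y).det ≠ 0) :
    shapeMatrix b (flowMetric V d τ G₀) y = pderiv b (Sum.inl 0) τ y •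
      ((flowMetric V d τ G₀ y)⁻¹ * (genMatrix V d).transpose * flowMetric V d τ G₀ y
        + genMatrix V d) := by
  have hu : IsUnit (flowMetric V d τ G₀ y).det := by
    rw [det_flowMetric hV]
    exact (mul_ne_zero (pow_ne_zero _ (Real.exp_pos _).ne') hdet).isUnit
  rw [shapeMatrix, timeDeriv_flowMetric hV hτ hG h0, Matrix.mul_smul, Matrix.mul_add,
    Matrix.nonsing_inv_mul_cancel_left _ _ hu, Matrix.mul_assoc]

theorem trace_shapeMatrix_flowMetric (hV : IsUnit V.det) (hτ : DifferentiableAt ℝ τ y)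
    (hG : ∀ i j, DifferentiableAt ℝ (fun v => G₀ v i j) y) (h0 : timeDeriv b G₀ y = 0)
    (hdet : (G₀ y).det ≠ 0) :
    (shapeMatrix b (flowMetric V d τ G₀) y).trace
      = 2 * (∑ i, d i) * pderiv b (Sum.inl 0) τ y := by
  have hu : IsUnit (flowMetric V d τ G₀ y).det := by
    rw [det_flowMetric hV]
    exact (mul_ne_zero (pow_ne_zero _ (Real.exp_pos _).ne') hdet).isUnit
  rw [shapeMatrix_flowMetric hV hτ hG h0 hdet, Matrix.trace_smul, Matrix.trace_add,
    Matrix.trace_mul_comm, Matrix.mul_nonsing_inv_cancel_left _ _ hu, Matrix.trace_transpose,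
    trace_genMatrix hV, smul_eq_mul]
  ring

theorem sq_trace_sub_trace_sq_flowMetric (hV : IsUnit V.det) (hτ : DifferentiableAt ℝ τ y)
    (hG : ∀ i j, DifferentiableAt ℝ (fun v => G₀ v i j) y) (h0 : timeDeriv b G₀ y = 0)
    (hdet : (G₀ y).det ≠ 0) :
    (shapeMatrix b (flowMetric V d τ G₀) y).trace ^ 2
      - (shapeMatrix b (flowMetric V d τ G₀) y * shapeMatrix b (flowMetric V d τ G₀) y).trace
      = pderiv b (Sum.inl 0) τ y ^ 2 * actionForm V d (G₀ y) := by
  set G := flowMetric V d τ G₀ y with hGdef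
  set P := flowMatrix V d (τ y) with hP
  set K := genMatrix V d with hK
  have hu : IsUnit G.det := by
    rw [hGdef, det_flowMetric hV]
    exact (mul_ne_zero (pow_ne_zero _ (Real.exp_pos _).ne') hdet).isUnit
  have hPu : IsUnit P.det := isUnit_det_flowMatrix hV _
  have hPtu : IsUnit P.transpose.det := by rwa [Matrix.det_transpose]
  have hG0 : G = P.transpose * (G₀ y * P) := by rw [hGdef, flowMetric, Matrix.mul_assoc]
  have hcomm : K * P = P * K := genMatrix_mul_flowMatrix hV _
  have hcommt : K.transpose * P.transpose = P.transpose * K.transpose := by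
    rw [← Matrix.transpose_mul, ← Matrix.transpose_mul, hcomm]
  have h1 : G⁻¹ * K.transpose * G = P⁻¹ * ((G₀ y)⁻¹ * K.transpose * G₀ y) * P := by
    rw [hG0, Matrix.mul_inv_rev, Matrix.mul_inv_rev]
    simp only [Matrix.mul_assoc]
    rw [← Matrix.mul_assoc K.transpose, hcommt]
    simp only [Matrix.mul_assoc]
    rw [Matrix.nonsing_inv_mul_cancel_left _ _ hPtu]
  have h2 : (K * (G⁻¹ * K.transpose * G)).trace
      = (K * ((G₀ y)⁻¹ * K.transpose * G₀ y)).trace := by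
    rw [h1, ← Matrix.mul_assoc, Matrix.trace_mul_comm, ← Matrix.mul_assoc, ← Matrix.mul_assoc,
      ← hcomm, Matrix.mul_nonsing_inv_cancel_right _ _ hPu]
  have h3 : (G⁻¹ * K.transpose * G * (G⁻¹ * K.transpose * G)).trace = (K * K).trace := by
    have : G⁻¹ * K.transpose * G * (G⁻¹ * K.transpose * G)
        = G⁻¹ * (K.transpose * K.transpose * G) := by
      simp only [Matrix.mul_assoc]
      rw [Matrix.mul_nonsing_inv_cancel_left _ _ hu]
    rw [this, Matrix.trace_mul_comm, Matrix.mul_nonsing_inv_cancel_right _ _ hu,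
      ← Matrix.transpose_mul, Matrix.trace_transpose]
  rw [trace_shapeMatrix_flowMetric hV hτ hG h0 hdet, shapeMatrix_flowMetric hV hτ hG h0 hdet,
    ← hGdef, ← hK, Matrix.smul_mul, Matrix.mul_smul, Matrix.trace_smul, Matrix.trace_smul,
    Matrix.add_mul, Matrix.mul_add, Matrix.mul_add, Matrix.trace_add, Matrix.trace_add,
    Matrix.trace_add, h3, Matrix.trace_mul_comm (G⁻¹ * K.transpose * G) K, h2, actionForm, ← hK]
  simp only [smul_eq_mul]
  ring

end ExpMatrix
end

noncomputable section
set_option linter.unusedSectionVars false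
set_option synthInstance.maxHeartbeats 200000

section CompactSupport

variable {E : Type*} [NormedAddCommGroup E] [NormedSpace ℝ E]

theorem contDiff_of_eq_zero_off {f : E → ℝ} {W K : Set E} (hW : IsOpen W) (hK : IsClosed K)
    (hKW : K ⊆ W) (hf : ContDiffOn ℝ ∞ f W) (h0 : ∀ y ∉ K, f y = 0) : ContDiff ℝ ∞ f := by
  refine contDiff_iff_contDiffAt.2 fun y => ?_
  by_cases hy : y ∈ W
  · exact hf.contDiffAt (hW.mem_nhds hy)
  · refine (contDiffAt_const (c := (0 : ℝ))).congr_of_eventuallyEq ?_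
    filter_upwards [hK.isOpen_compl.mem_nhds fun h => hy (hKW h)] with v hv using h0 v hv

variable [FiniteDimensional ℝ E] [MeasurableSpace E] [BorelSpace E] {μ : Measure E}
  [μ.IsAddHaarMeasure]

theorem integral_fderiv_eq_zero {f : E → ℝ} (hf : ContDiff ℝ ∞ f) (hc : HasCompactSupport f)
    (v : E) : ∫ y, fderiv ℝ f y v ∂μ = 0 := by
  have h1 : Integrable (fun y => fderiv ℝ f y v) μ :=
    (((hf.continuous_fderiv (by simp)).clm_apply continuous_const)).integrable_of_hasCompactSupport
      (hc.fderiv_apply ℝ v)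
  have h2 : Integrable f μ := hf.continuous.integrable_of_hasCompactSupport hc
  have h := integral_mul_fderiv_eq_neg_fderiv_mul_of_integrable (μ := μ) (𝕜 := ℝ) (f := fun _ => 1)
    (g := f) (v := v) (by simp) (by simpa using h1) (by simpa using h2)
    (fun x _ => differentiableAt_const _) (fun x _ => hf.contDiffAt.differentiableAt (by simp))
  simpa using h

end CompactSupport

section ActionIntegral

variable {κ : Type*} [Fintype κ] [DecidableEq κ] {V : Matrix κ κ ℝ} {d : κ → ℝ}
  {E : Type*} [NormedAddCommGroup E] [NormedSpace ℝ E]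
  {b : Module.Basis (Fin 1 ⊕ κ) ℝ E} {W : Set E} {τ F D : E → ℝ} {G₀ : E → Matrix κ κ ℝ} {y : E}

theorem contDiffOn_actionForm (hG : ∀ i j, ContDiffOn ℝ ∞ (fun v => G₀ v i j) W)
    (hdet : ∀ y ∈ W, (G₀ y).det ≠ 0) : ContDiffOn ℝ ∞ (fun v => actionForm V d (G₀ v)) W := by
  have hinv := contDiffOn_inv_entry hG hdet
  unfold actionForm
  simp only [Matrix.trace, Matrix.diag_apply, Matrix.mul_apply]
  refine contDiffOn_const.sub (contDiffOn_const.mul (ContDiffOn.sum fun i _ =>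
    ContDiffOn.sum fun j _ => contDiffOn_const.mul (ContDiffOn.sum fun k _ => ?_)))
  exact (ContDiffOn.sum fun l _ => (hinv _ _).mul contDiffOn_const).mul (hG _ _)

theorem contDiff_pderiv {ι : Type*} {b : Module.Basis ι ℝ E} (hτ : ContDiff ℝ ∞ τ) (i : ι) :
    ContDiff ℝ ∞ (pderiv b i τ) :=
  (hτ.fderiv_right (by simp)).clm_apply contDiff_const

/-- The vector field whose divergence is the total derivative part of the action. -/
def actionFlux (b : Module.Basis (Fin 1 ⊕ κ) ℝ E) (d : κ → ℝ) (τ F D : E → ℝ) (y : E) : ℝ :=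
  Real.exp (τ y * ∑ i, d i) * D y * (2 * (∑ i, d i) * pderiv b (Sum.inl 0) τ y)
    * (Real.sqrt (F y))⁻¹

theorem density_mul_timeCurvature (hV : IsUnit V.det)
    (hB : IsBlockOn b F (flowMetric V d τ G₀) W) (hF : ∀ y ∈ W, 0 < F y) (hτ : ContDiff ℝ ∞ τ)
    (hG : ∀ i j, ContDiffOn ℝ ∞ (fun v => G₀ v i j) W) (h0 : ∀ y ∈ W, timeDeriv b G₀ y = 0)
    (hdet : ∀ y ∈ W, (G₀ y).det ≠ 0) (hD : DifferentiableAt ℝ D y)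
    (hD0 : pderiv b (Sum.inl 0) D y = 0) (hy : y ∈ W) :
    Real.sqrt (F y) * (Real.exp (τ y * ∑ i, d i) * D y)
        * timeCurvature b F (flowMetric V d τ G₀) y
      = -pderiv b (Sum.inl 0) (actionFlux b d τ F D) y
        + Real.exp (τ y * ∑ i, d i) * D y / (4 * Real.sqrt (F y))
          * (pderiv b (Sum.inl 0) τ y ^ 2 * actionForm V d (G₀ y)) := by
  have hn := hB.isOpen.mem_nhds hy
  have hτd : ∀ v, DifferentiableAt ℝ τ v := fun v => hτ.contDiffAt.differentiableAt (by simp)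
  have hGd : ∀ v ∈ W, ∀ i j, DifferentiableAt ℝ (fun v => G₀ v i j) v := fun v hv i j =>
    ((hG i j).contDiffAt (hB.isOpen.mem_nhds hv)).differentiableAt (by simp)
  have htr : ∀ v ∈ W, (shapeMatrix b (flowMetric V d τ G₀) v).trace
      = 2 * (∑ i, d i) * pderiv b (Sum.inl 0) τ v := fun v hv =>
    trace_shapeMatrix_flowMetric hV (hτd v) (hGd v hv) (h0 v hv) (hdet v hv)
  have hsq := sq_trace_sub_trace_sq_flowMetric (d := d) hV (hτd y) (hGd y hy) (h0 y hy) (hdet y hy)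
  have hτ'd : DifferentiableAt ℝ (pderiv b (Sum.inl 0) τ) y :=
    (contDiff_pderiv hτ _).contDiffAt.differentiableAt (by simp)
  have htr' : pderiv b (Sum.inl 0) (fun v => (shapeMatrix b (flowMetric V d τ G₀) v).trace) y
      = 2 * (∑ i, d i) * pderiv b (Sum.inl 0) (pderiv b (Sum.inl 0) τ) y := by
    rw [← pderiv_const_mul hτ'd]
    refine (pderiv_congr ?_ b _).eq_of_nhds
    filter_upwards [hn] with v hv using htr v hv
  have hFd : HasFDerivAt F (fderiv ℝ F y) y :=
    ((hB.contDiffOn_fst.contDiffAt hn).differentiableAt (by simp)).hasFDerivAt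
  have hm0 : Real.sqrt (F y) ≠ 0 := (Real.sqrt_pos.2 (hF y hy)).ne'
  have hmd := hFd.sqrt (hF y hy).ne'
  have hFm : F y = Real.sqrt (F y) ^ 2 := (Real.sq_sqrt (hF y hy).le).symm
  have hexp : HasFDerivAt (fun v => Real.exp (τ v * ∑ i, d i))
      (Real.exp (τ y * ∑ i, d i) • ((∑ i, d i) • fderiv ℝ τ y)) y :=
    ((hτd y).hasFDerivAt.mul_const (∑ i, d i)).exp
  have hminv := (hasDerivAt_inv hm0).comp_hasFDerivAt y hmd
  have hflux := ((hexp.fun_mul hD.hasFDerivAt).fun_mul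
    (hτ'd.hasFDerivAt.const_mul (2 * ∑ i, d i))).fun_mul hminv
  have hflux' : pderiv b (Sum.inl 0) (actionFlux b d τ F D) y = _ :=
    congrArg (fun T : E →L[ℝ] ℝ => T (b (Sum.inl 0))) hflux.fderiv
  have hD0' : fderiv ℝ D y (b (Sum.inl 0)) = 0 := hD0
  rw [htr y hy] at hsq
  have hA : (shapeMatrix b (flowMetric V d τ G₀) y * shapeMatrix b (flowMetric V d τ G₀) y).trace
      = (2 * (∑ i, d i) * pderiv b (Sum.inl 0) τ y) ^ 2
        - pderiv b (Sum.inl 0) τ y ^ 2 * actionForm V d (G₀ y) := by linarith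
  rw [hflux', timeCurvature, htr', htr y hy, hA]
  simp only [_root_.add_apply, _root_.smul_apply, smul_eq_mul, hD0', Function.comp_apply, mul_zero]
  change _ = -(_ * (-(Real.sqrt (F y) ^ 2)⁻¹ * (1 / (2 * Real.sqrt (F y))
    * pderiv b (Sum.inl 0) F y)) + (Real.sqrt (F y))⁻¹ * (_ * (_ *
      pderiv b (Sum.inl 0) (pderiv b (Sum.inl 0) τ) y) + _ * (0 + D y * (_ * (_ *
        pderiv b (Sum.inl 0) τ y))))) + _
  generalize pderiv b (Sum.inl 0) (pderiv b (Sum.inl 0) τ) y = τ₂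
  generalize pderiv b (Sum.inl 0) τ y = τ₁
  generalize pderiv b (Sum.inl 0) F y = F₁
  generalize actionForm V d (G₀ y) = q
  generalize Real.exp (τ y * ∑ i, d i) = x
  generalize ∑ i, d i = k
  generalize D y = D₀
  generalize hm : Real.sqrt (F y) = m at *
  rw [hFm]
  field_simp
  ring

variable [FiniteDimensional ℝ E] [MeasurableSpace E] [BorelSpace E]

theorem setIntegral_timeCurvature_neg {σ : ℝ} (hV : IsUnit V.det)
    (hB : IsBlockOn b F (flowMetric V d τ G₀) W) (hF : ∀ y ∈ W, 0 < F y) (hτ : ContDiff ℝ ∞ τ)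
    (hτc : HasCompactSupport τ) (hτW : tsupport τ ⊆ W)
    (hG : ∀ i j, ContDiffOn ℝ ∞ (fun v => G₀ v i j) W) (h0 : ∀ y ∈ W, timeDeriv b G₀ y = 0)
    (hdet : ∀ y ∈ W, (G₀ y).det ≠ 0) (hD : ContDiffOn ℝ ∞ D W)
    (hD0 : ∀ y ∈ W, pderiv b (Sum.inl 0) D y = 0) (hDpos : ∀ y ∈ W, 0 < D y)
    (hneg : ∀ y ∈ W, pderiv b (Sum.inl 0) τ y ≠ 0 → σ⁻¹ * actionForm V d (G₀ y) < 0)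
    (hne : ∃ y, pderiv b (Sum.inl 0) τ y ≠ 0) :
    ∫ y in W, Real.sqrt (F y) * (Real.exp (τ y * ∑ i, d i) * D y)
      * (σ⁻¹ * timeCurvature b F (flowMetric V d τ G₀) y) ∂b.addHaar < 0 := by
  have hWo := hB.isOpen
  have hK : IsClosed (tsupport τ) := isClosed_tsupport τ
  have hτ0 : ∀ y ∉ tsupport τ, pderiv b (Sum.inl 0) τ y = 0 := fun y hy => by
    rw [pderiv, fderiv_of_notMem_tsupport ℝ hy, _root_.zero_apply]
  have hτs := (contDiff_pderiv (b := b) hτ (Sum.inl 0)).contDiffOn (s := W)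
  have hmne : ∀ y ∈ W, Real.sqrt (F y) ≠ 0 := fun y hy => (Real.sqrt_pos.2 (hF y hy)).ne'
  have hms : ContDiffOn ℝ ∞ (fun y => Real.sqrt (F y)) W :=
    hB.contDiffOn_fst.sqrt fun y hy => (hF y hy).ne'
  have hes : ContDiffOn ℝ ∞ (fun y => Real.exp (τ y * ∑ i, d i)) W :=
    (hτ.mul contDiff_const).exp.contDiffOn
  let Q : E → ℝ := fun y => Real.exp (τ y * ∑ i, d i) * D y / (4 * Real.sqrt (F y))
          * (pderiv b (Sum.inl 0) τ y ^ 2 * (σ⁻¹ * actionForm V d (G₀ y)))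
  have hQ0 : ∀ y ∉ tsupport τ, Q y = 0 := fun y hy => by simp [Q, hτ0 y hy]
  have hQ : ContDiff ℝ ∞ Q := by
    refine contDiff_of_eq_zero_off hWo hK hτW ?_ hQ0
    exact ((hes.mul hD).div (contDiffOn_const.mul hms)
      fun y hy => mul_ne_zero (by norm_num) (hmne y hy)).mul
      ((hτs.pow 2).mul (contDiffOn_const.mul (contDiffOn_actionForm hG hdet)))
  have hQc : HasCompactSupport Q := HasCompactSupport.intro hτc hQ0
  have hH0 : ∀ y ∉ tsupport τ, actionFlux b d τ F D y = 0 := fun y hy => by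
    simp [actionFlux, hτ0 y hy]
  have hH : ContDiff ℝ ∞ (actionFlux b d τ F D) := by
    refine contDiff_of_eq_zero_off hWo hK hτW ?_ hH0
    exact ((hes.mul hD).mul (contDiffOn_const.mul hτs)).mul (hms.inv hmne)
  have hHc : HasCompactSupport (actionFlux b d τ F D) := HasCompactSupport.intro hτc hH0
  have hHK : tsupport (actionFlux b d τ F D) ⊆ W :=
    (closure_minimal (Function.support_subset_iff'.2 hH0) hK).trans hτW
  have hH' : ∀ y ∉ W, pderiv b (Sum.inl 0) (actionFlux b d τ F D) y = 0 := fun y hy => by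
    rw [pderiv, fderiv_of_notMem_tsupport ℝ fun h => hy (hHK h), _root_.zero_apply]
  have hH'i : Integrable (pderiv b (Sum.inl 0) (actionFlux b d τ F D)) b.addHaar :=
    (contDiff_pderiv hH _).continuous.integrable_of_hasCompactSupport (hHc.fderiv_apply ℝ _)
  have hQi : Integrable Q b.addHaar := hQ.continuous.integrable_of_hasCompactSupport hQc
  have hint : ∫ y in W, Real.sqrt (F y) * (Real.exp (τ y * ∑ i, d i) * D y)
      * (σ⁻¹ * timeCurvature b F (flowMetric V d τ G₀) y) ∂b.addHaar
      = ∫ y in W, (-σ⁻¹ * pderiv b (Sum.inl 0) (actionFlux b d τ F D) y + Q y) ∂b.addHaar := by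
    refine setIntegral_congr_fun hWo.measurableSet fun y hy => ?_
    have h1 := density_mul_timeCurvature hV hB hF hτ hG h0 hdet
      ((hD.contDiffAt (hWo.mem_nhds hy)).differentiableAt (by simp)) (hD0 y hy) hy
    simp only [Q]
    linear_combination σ⁻¹ * h1
  rw [hint, setIntegral_eq_integral_of_forall_compl_eq_zero fun y hy => by
      rw [hH' y hy, hQ0 y fun h => hy (hτW h), mul_zero, zero_add],
    integral_add (hH'i.const_mul _) hQi, integral_const_mul]
  have h1 : ∫ y, pderiv b (Sum.inl 0) (actionFlux b d τ F D) y ∂b.addHaar = 0 :=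
    integral_fderiv_eq_zero hH hHc _
  rw [h1, mul_zero, zero_add]
  have hfac : ∀ y ∈ W, 0 < Real.exp (τ y * ∑ i, d i) * D y / (4 * Real.sqrt (F y)) := fun y hy =>
    div_pos (mul_pos (Real.exp_pos _) (hDpos y hy))
      (mul_pos (by norm_num) (Real.sqrt_pos.2 (hF y hy)))
  have hQneg : ∀ y, pderiv b (Sum.inl 0) τ y ≠ 0 → Q y < 0 := fun y hy => by
    have hyW : y ∈ W := hτW (by_contra fun h => hy (hτ0 y h))
    exact mul_neg_of_pos_of_neg (hfac y hyW)
      (mul_neg_of_pos_of_neg (sq_pos_of_ne_zero hy) (hneg y hyW hy))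
  obtain ⟨y₀, hy₀⟩ := hne
  have h2 := Continuous.integral_pos_of_hasCompactSupport_nonneg_nonzero (μ := b.addHaar)
    (f := fun y => -Q y) (x := y₀) hQ.continuous.neg hQc.neg (fun y => by
      by_cases hy : pderiv b (Sum.inl 0) τ y = 0
      · simp [Q, hy]
      · exact (neg_pos.2 (hQneg y hy)).le) (neg_pos.2 (hQneg y₀ hy₀)).ne'
  rw [integral_neg] at h2
  linarith

end ActionIntegral
end

noncomputable section
set_option linter.unusedSectionVars false
set_option synthInstance.maxHeartbeats 200000

theorem toMatrix_clm_comp {E ι : Type*} [NormedAddCommGroup E] [NormedSpace ℝ E] [Fintype ι]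
    [DecidableEq ι] (b : Module.Basis ι ℝ E) (T : E →L[ℝ] E →L[ℝ] ℝ) (J : E →L[ℝ] E) :
    (Matrix.of fun i j => T (J (b i)) (J (b j))) =
      (LinearMap.toMatrix b b (J : E →ₗ[ℝ] E)).transpose * (Matrix.of fun i j => T (b i) (b j))
        * LinearMap.toMatrix b b (J : E →ₗ[ℝ] E) :=
  toMatrix_bilin_comp b ((ContinuousLinearMap.coeLM ℝ).comp (T : E →ₗ[ℝ] E →L[ℝ] ℝ)) J

section Deformation

variable {n : ℕ} {N : Type*} [TopologicalSpace N] [ChartedSpace (EuclideanSpace ℝ (Fin n)) N]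
  [IsManifold (𝓡 n) ∞ N]

/-- The linear map with a given matrix in the standard coordinates. -/
def matrixMap (P : Matrix (Fin n) (Fin n) ℝ) :
    EuclideanSpace ℝ (Fin n) →L[ℝ] EuclideanSpace ℝ (Fin n) :=
  LinearMap.toContinuousLinearMap (Matrix.toLin (EuclideanSpace.basisFun (Fin n) ℝ).toBasis
    (EuclideanSpace.basisFun (Fin n) ℝ).toBasis P)

theorem toMatrix_matrixMap (P : Matrix (Fin n) (Fin n) ℝ) :
    LinearMap.toMatrix (EuclideanSpace.basisFun (Fin n) ℝ).toBasis
      (EuclideanSpace.basisFun (Fin n) ℝ).toBasis (matrixMap P : _ →ₗ[ℝ] _) = P :=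
  LinearMap.toMatrix_toLin _ _ P

theorem matrixMap_one : matrixMap (1 : Matrix (Fin n) (Fin n) ℝ) = ContinuousLinearMap.id ℝ _ := by
  ext1 v
  simp [matrixMap]

theorem matrixMap_injective {P : Matrix (Fin n) (Fin n) ℝ} (hP : IsUnit P.det) :
    Function.Injective (matrixMap P) := by
  intro v w hvw
  have h : ∀ v, Matrix.toLin (EuclideanSpace.basisFun (Fin n) ℝ).toBasis
      (EuclideanSpace.basisFun (Fin n) ℝ).toBasis P⁻¹ (matrixMap P v) = v := fun v => by
    refine (Matrix.toLin_mul_apply _ _ _ P⁻¹ P v).symm.trans ?_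
    rw [Matrix.nonsing_inv_mul _ hP, Matrix.toLin_one]
    rfl
  rw [← h v, hvw, h w]

theorem contDiff_matrixMap {D : Type*} [NormedAddCommGroup D] [NormedSpace ℝ D]
    {P : D → Matrix (Fin n) (Fin n) ℝ} {u : D} (hP : ∀ i j, ContDiffAt ℝ ∞ (fun y => P y i j) u)
    (v : EuclideanSpace ℝ (Fin n)) : ContDiffAt ℝ ∞ (fun y => matrixMap (P y) v) u := by
  have h : ∀ y, matrixMap (P y) v = ∑ j, (∑ i, P y j i * v i) •
      (EuclideanSpace.basisFun (Fin n) ℝ).toBasis j := fun y => by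
    refine (Matrix.toLin_apply ..).trans ?_
    simp [Matrix.mulVec, dotProduct]
  simp only [h]
  exact ContDiffAt.sum fun j _ => ContDiffAt.smul
    (ContDiffAt.sum fun i _ => (hP j i).mul contDiffAt_const) contDiffAt_const

variable {e e' : OpenPartialHomeomorph N (EuclideanSpace ℝ (Fin n))}
  {P : Matrix (Fin n) (Fin n) ℝ} {x : N} {u : EuclideanSpace ℝ (Fin n)}

/-- The endomorphism of the tangent space at `x` with matrix `P` in the chart `e`. -/
def deformMap (e : OpenPartialHomeomorph N (EuclideanSpace ℝ (Fin n)))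
    (P : Matrix (Fin n) (Fin n) ℝ) (x : N) :
    EuclideanSpace ℝ (Fin n) →L[ℝ] EuclideanSpace ℝ (Fin n) :=
  ContinuousLinearMap.id ℝ _ + chartFrame (𝓡 n) e (e.extend (𝓡 n) x) ∘L
    ((matrixMap P - ContinuousLinearMap.id ℝ _) ∘L chartDeriv (𝓡 n) e x)

theorem deformMap_one : deformMap e 1 x = ContinuousLinearMap.id ℝ _ := by
  rw [deformMap, matrixMap_one, sub_self, ContinuousLinearMap.zero_comp,
    ContinuousLinearMap.comp_zero, add_zero]

theorem deformMap_chartFrame (he : e ∈ IsManifold.maximalAtlas (𝓡 n) ∞ N)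
    (hu : u ∈ (e.extend (𝓡 n)).target) (v : EuclideanSpace ℝ (Fin n)) :
    deformMap e P ((e.extend (𝓡 n)).symm u) (chartFrame (𝓡 n) e u v)
      = chartFrame (𝓡 n) e u (matrixMap P v) := by
  have h1 := chartDeriv_chartFrame he hu v
  have h2 : deformMap e P ((e.extend (𝓡 n)).symm u) (chartFrame (𝓡 n) e u v)
      = chartFrame (𝓡 n) e u v + chartFrame (𝓡 n) e (e.extend (𝓡 n) ((e.extend (𝓡 n)).symm u))
        (matrixMap P (chartDeriv (𝓡 n) e ((e.extend (𝓡 n)).symm u) (chartFrame (𝓡 n) e u v))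
          - chartDeriv (𝓡 n) e ((e.extend (𝓡 n)).symm u) (chartFrame (𝓡 n) e u v)) := rfl
  rw [h2, h1, (e.extend (𝓡 n)).right_inv hu, map_sub]
  abel

theorem deformMap_injective (he : e ∈ IsManifold.maximalAtlas (𝓡 n) ∞ N) (hx : x ∈ e.source)
    (hP : IsUnit P.det) : Function.Injective (deformMap e P x) := by
  have hu : e.extend (𝓡 n) x ∈ (e.extend (𝓡 n)).target :=
    (e.extend (𝓡 n)).map_source (by rwa [e.extend_source])
  have hinv : (e.extend (𝓡 n)).symm (e.extend (𝓡 n) x) = x :=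
    (e.extend (𝓡 n)).left_inv (by rwa [e.extend_source])
  have hinj := chartFrame_injective he hu
  have hsurj : Function.Surjective (chartFrame (𝓡 n) e (e.extend (𝓡 n) x)) :=
    (LinearMap.injective_iff_surjective (f := (chartFrame (𝓡 n) e (e.extend (𝓡 n) x) :
      EuclideanSpace ℝ (Fin n) →ₗ[ℝ] EuclideanSpace ℝ (Fin n)))).1 hinj
  intro v w hvw
  obtain ⟨v, rfl⟩ := hsurj v
  obtain ⟨w, rfl⟩ := hsurj w
  have h := deformMap_chartFrame (P := P) he hu
  rw [hinv] at h
  rw [h, h] at hvw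
  rw [matrixMap_injective hP (hinj hvw)]

/-- The tensor field `g`, deformed by the endomorphisms with matrices `P x` in the chart `e`. -/
def deformField (g : BilinField (𝓡 n) N) (e : OpenPartialHomeomorph N (EuclideanSpace ℝ (Fin n)))
    (P : N → Matrix (Fin n) (Fin n) ℝ) : BilinField (𝓡 n) N := fun x =>
  ((modelForm g x).bilinearComp (deformMap e (P x) x) (deformMap e (P x) x) :)

variable {g : BilinField (𝓡 n) N} {Q : N → Matrix (Fin n) (Fin n) ℝ}

theorem modelForm_deformField (v w : EuclideanSpace ℝ (Fin n)) : modelForm (deformField g e Q) x v w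
    = modelForm g x (deformMap e (Q x) x v) (deformMap e (Q x) x w) := rfl

theorem modelForm_deformField_of_eq_one (h : Q x = 1) :
    modelForm (deformField g e Q) x = modelForm g x := by
  ext v w
  rw [modelForm_deformField, h, deformMap_one]
  rfl

theorem chartForm_deformField (he : e ∈ IsManifold.maximalAtlas (𝓡 n) ∞ N)
    (hu : u ∈ (e.extend (𝓡 n)).target) (v w : EuclideanSpace ℝ (Fin n)) :
    chartForm (deformField g e Q) e u v w = chartForm g e u
      (matrixMap (Q ((e.extend (𝓡 n)).symm u)) v) (matrixMap (Q ((e.extend (𝓡 n)).symm u)) w) := by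
  rw [chartForm_apply, modelForm_deformField, deformMap_chartFrame he hu,
    deformMap_chartFrame he hu, chartForm_apply]

theorem chartComponents_deformField (he : e ∈ IsManifold.maximalAtlas (𝓡 n) ∞ N)
    (hu : u ∈ (e.extend (𝓡 n)).target) :
    chartComponents (EuclideanSpace.basisFun (Fin n) ℝ).toBasis (deformField g e Q) e u
      = (Q ((e.extend (𝓡 n)).symm u)).transpose
        * chartComponents (EuclideanSpace.basisFun (Fin n) ℝ).toBasis g e u
        * Q ((e.extend (𝓡 n)).symm u) := by
  have h := toMatrix_clm_comp (EuclideanSpace.basisFun (Fin n) ℝ).toBasis (chartForm g e u)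
    (matrixMap (Q ((e.extend (𝓡 n)).symm u)))
  rw [toMatrix_matrixMap] at h
  have h2 : formMatrix (EuclideanSpace.basisFun (Fin n) ℝ).toBasis
      (chartForm (deformField g e Q) e) u = Matrix.of fun i j => chartForm g e u
        (matrixMap (Q ((e.extend (𝓡 n)).symm u)) ((EuclideanSpace.basisFun (Fin n) ℝ).toBasis i))
        (matrixMap (Q ((e.extend (𝓡 n)).symm u))
          ((EuclideanSpace.basisFun (Fin n) ℝ).toBasis j)) := by
    ext i j
    rw [formMatrix, Matrix.of_apply, Matrix.of_apply, chartForm_deformField he hu]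
  rw [chartComponents_eq, chartComponents_eq, h2, h]
  simp only [formMatrix]

theorem hasSignature_deformField {p q : ℕ} (he : e ∈ IsManifold.maximalAtlas (𝓡 n) ∞ N)
    (hg : HasSignature (g x) p q) (hQ : IsUnit (Q x).det) (h1 : x ∉ e.source → Q x = 1) :
    HasSignature (deformField g e Q x) p q := by
  have hinj : Function.Injective (deformMap e (Q x) x) := by
    by_cases hx : x ∈ e.source
    · exact deformMap_injective he hx hQ
    · rw [h1 hx, deformMap_one]
      exact fun _ _ h => h
  let L : EuclideanSpace ℝ (Fin n) ≃ₗ[ℝ] EuclideanSpace ℝ (Fin n) :=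
    LinearEquiv.ofInjectiveEndo (deformMap e (Q x) x : _ →ₗ[ℝ] _) hinj
  have hg' : HasSignature (V := EuclideanSpace ℝ (Fin n)) (modelForm g x) p q := hg
  refine HasSignature.map hg' L.symm fun v w => ?_
  change modelForm (deformField g e Q) x (L.symm v) (L.symm w) = _
  rw [modelForm_deformField]
  change modelForm g x (L (L.symm v)) (L (L.symm w)) = _
  rw [L.apply_symm_apply, L.apply_symm_apply]

end Deformation

section FlowFamily

variable {n : ℕ} {N : Type*} [TopologicalSpace N] [ChartedSpace (EuclideanSpace ℝ (Fin n)) N]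
  [IsManifold (𝓡 n) ∞ N]
  {e : OpenPartialHomeomorph N (EuclideanSpace ℝ (Fin n))} {g : BilinField (𝓡 n) N}
  {V : Matrix (Fin n) (Fin n) ℝ} {d : Fin n → ℝ} {f : Circle → ℝ} {χ : N → ℝ}

/-- The metric `g`, deformed in the chart `e` by the flow of `genMatrix V d` at the times
`f z * χ x`. -/
def flowFamily (g : BilinField (𝓡 n) N) (e : OpenPartialHomeomorph N (EuclideanSpace ℝ (Fin n)))
    (V : Matrix (Fin n) (Fin n) ℝ) (d : Fin n → ℝ) (f : Circle → ℝ) (χ : N → ℝ) (z : Circle) :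
    BilinField (𝓡 n) N :=
  deformField g e fun x => flowMatrix V d (f z * χ x)

theorem isSmoothFamily_of_local {γ : Circle → BilinField (𝓡 n) N}
    (h : ∀ z x, ∃ e₁ ∈ IsManifold.maximalAtlas (𝓡 1) ∞ Circle,
      ∃ e₂ ∈ IsManifold.maximalAtlas (𝓡 n) ∞ N, z ∈ e₁.source ∧ x ∈ e₂.source ∧
      ∀ v w, ContDiffAt ℝ ∞ (fun u : EuclideanSpace ℝ (Fin 1) × EuclideanSpace ℝ (Fin n) =>
        chartForm (γ ((e₁.extend (𝓡 1)).symm u.1)) e₂ u.2 v w)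
        (e₁.extend (𝓡 1) z, e₂.extend (𝓡 n) x)) : IsSmoothFamily γ := by
  intro e₁ he₁ e₂ he₂ u hu
  refine ContDiffAt.contDiffWithinAt ?_
  have hz : (e₁.extend (𝓡 1)).symm u.1 ∈ e₁.source := by
    rw [← e₁.extend_source (I := 𝓡 1)]; exact (e₁.extend (𝓡 1)).map_target hu.1
  have hx : (e₂.extend (𝓡 n)).symm u.2 ∈ e₂.source := by
    rw [← e₂.extend_source (I := 𝓡 n)]; exact (e₂.extend (𝓡 n)).map_target hu.2
  obtain ⟨e₁', he₁', e₂', he₂', hz', hx', hγ⟩ :=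
    h ((e₁.extend (𝓡 1)).symm u.1) ((e₂.extend (𝓡 n)).symm u.2)
  have ht' : (e₁'.extend (𝓡 1) ((e₁.extend (𝓡 1)).symm u.1),
      e₂'.extend (𝓡 n) ((e₂.extend (𝓡 n)).symm u.2))
      ∈ (e₁'.extend (𝓡 1)).target ×ˢ (e₂'.extend (𝓡 n)).target :=
    ⟨(e₁'.extend (𝓡 1)).map_source (by rwa [e₁'.extend_source]),
      (e₂'.extend (𝓡 n)).map_source (by rwa [e₂'.extend_source])⟩
  have h1 : ContDiffAt ℝ ∞ (chartForm (circleProductMetric 0 γ) (e₁'.prod e₂'))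
      (e₁'.extend (𝓡 1) ((e₁.extend (𝓡 1)).symm u.1),
        e₂'.extend (𝓡 n) ((e₂.extend (𝓡 n)).symm u.2)) := by
    refine contDiffAt_form_of_apply fun v w => (hγ v.2 w.2).congr_of_eventuallyEq ?_
    filter_upwards [isOpen_prod_target.mem_nhds ht'] with y hy
    rw [chartForm_circleProductMetric he₁' he₂' hy, zero_mul, zero_add]
  have h2 := (contMDiffAt_bilinField_iff (circleProductMetric 0 γ)
    (prod_mem_maximalAtlas he₁' he₂')
    (x := ((e₁.extend (𝓡 1)).symm u.1, (e₂.extend (𝓡 n)).symm u.2)) ⟨hz', hx'⟩).2 h1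
  have h3 := (contMDiffAt_bilinField_iff (circleProductMetric 0 γ)
    (prod_mem_maximalAtlas he₁ he₂)
    (x := ((e₁.extend (𝓡 1)).symm u.1, (e₂.extend (𝓡 n)).symm u.2)) ⟨hz, hx⟩).1 h2
  have hu' : (e₁.prod e₂).extend ((𝓡 1).prod (𝓡 n))
      ((e₁.extend (𝓡 1)).symm u.1, (e₂.extend (𝓡 n)).symm u.2) = u :=
    Prod.ext ((e₁.extend (𝓡 1)).right_inv hu.1) ((e₂.extend (𝓡 n)).right_inv hu.2)
  rw [hu'] at h3
  refine contDiffAt_form_of_apply fun v w => ?_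
  refine ((h3.clm_apply (contDiffAt_const (c := (0, v)))).clm_apply
    (contDiffAt_const (c := (0, w)))).congr_of_eventuallyEq ?_
  filter_upwards [isOpen_prod_target.mem_nhds hu] with y hy
  rw [chartForm_circleProductMetric he₁ he₂ hy, zero_mul, zero_add]

theorem modelForm_flowFamily_of_eq_zero (hV : IsUnit V.det) {z : Circle} {x : N}
    (h : f z * χ x = 0) : modelForm (flowFamily g e V d f χ z) x = modelForm g x := by
  refine modelForm_deformField_of_eq_one ?_
  rw [h, flowMatrix_zero hV]

theorem chartForm_flowFamily_of_eq_zero (hV : IsUnit V.det) {z : Circle}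
    {e' : OpenPartialHomeomorph N (EuclideanSpace ℝ (Fin n))} {u : EuclideanSpace ℝ (Fin n)}
    (h : f z * χ ((e'.extend (𝓡 n)).symm u) = 0) :
    chartForm (flowFamily g e V d f χ z) e' u = chartForm g e' u := by
  rw [chartForm, chartForm, modelForm_flowFamily_of_eq_zero hV h]

theorem isSmoothFamily_flowFamily {p q : ℕ} (hg : IsSmoothMetric g p q) (hV : IsUnit V.det)
    (he : e ∈ IsManifold.maximalAtlas (𝓡 n) ∞ N) (hf : ContMDiff (𝓡 1) 𝓘(ℝ) ∞ f)
    (hχ : ContMDiff (𝓡 n) 𝓘(ℝ) ∞ χ) (hχe : tsupport χ ⊆ e.source) :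
    IsSmoothFamily (flowFamily g e V d f χ) := by
  refine isSmoothFamily_of_local fun z x => ?_
  have he₁ := IsManifold.chart_mem_maximalAtlas (I := 𝓡 1) (n := ∞) z
  by_cases hx : x ∈ e.source
  · refine ⟨_, he₁, e, he, mem_chart_source _ z, hx, fun v w => ?_⟩
    have hu : (extChartAt (𝓡 1) z z, e.extend (𝓡 n) x) ∈
        ((chartAt (EuclideanSpace ℝ (Fin 1)) z).extend (𝓡 1)).target ×ˢ (e.extend (𝓡 n)).target :=
      ⟨mem_extChartAt_target z, (e.extend (𝓡 n)).map_source (by rwa [e.extend_source])⟩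
    have hτ : ContDiffAt ℝ ∞ (fun u : EuclideanSpace ℝ (Fin 1) × EuclideanSpace ℝ (Fin n) =>
        f (((chartAt (EuclideanSpace ℝ (Fin 1)) z).extend (𝓡 1)).symm u.1)
          * χ ((e.extend (𝓡 n)).symm u.2)) (extChartAt (𝓡 1) z z, e.extend (𝓡 n) x) := by
      have h1 : ContDiffAt ℝ ∞ (fun u =>
          f (((chartAt (EuclideanSpace ℝ (Fin 1)) z).extend (𝓡 1)).symm u))
          (extChartAt (𝓡 1) z z) :=
        (hf.contMDiffAt.comp _ (contMDiffAt_extend_symm he₁ hu.1)).contDiffAt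
      have h2 : ContDiffAt ℝ ∞ (fun u => χ ((e.extend (𝓡 n)).symm u)) (e.extend (𝓡 n) x) :=
        (hχ.contMDiffAt.comp _ (contMDiffAt_extend_symm he hu.2)).contDiffAt
      exact (ContDiffAt.comp (extChartAt (𝓡 1) z z, e.extend (𝓡 n) x) h1 contDiffAt_fst).mul
        (ContDiffAt.comp (extChartAt (𝓡 1) z z, e.extend (𝓡 n) x) h2 contDiffAt_snd)
    have hM : ∀ v, ContDiffAt ℝ ∞
        (fun u : EuclideanSpace ℝ (Fin 1) × EuclideanSpace ℝ (Fin n) => matrixMap (flowMatrix V d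
        (f (((chartAt (EuclideanSpace ℝ (Fin 1)) z).extend (𝓡 1)).symm u.1)
          * χ ((e.extend (𝓡 n)).symm u.2))) v) (extChartAt (𝓡 1) z z, e.extend (𝓡 n) x) := fun v =>
      contDiff_matrixMap (fun i j => (contDiff_flowMatrix i j).contDiffAt.comp _ hτ) v
    have hG : ContDiffAt ℝ ∞ (fun u : EuclideanSpace ℝ (Fin 1) × EuclideanSpace ℝ (Fin n) =>
        chartForm g e u.2) (extChartAt (𝓡 1) z z, e.extend (𝓡 n) x) :=
      ContDiffAt.comp (g := chartForm g e) (extChartAt (𝓡 1) z z, e.extend (𝓡 n) x)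
        ((contDiffOn_chartForm he hg.contMDiff).contDiffAt
          (e.isOpen_extend_target.mem_nhds hu.2)) contDiffAt_snd
    refine ((hG.clm_apply (hM v)).clm_apply (hM w)).congr_of_eventuallyEq ?_
    filter_upwards [isOpen_prod_target.mem_nhds hu] with y hy
    exact chartForm_deformField he hy.2 v w
  · have he₂ := IsManifold.chart_mem_maximalAtlas (I := 𝓡 n) (n := ∞) x
    refine ⟨_, he₁, _, he₂, mem_chart_source _ z, mem_chart_source _ x, fun v w => ?_⟩
    have hG : ContDiffAt ℝ ∞ (fun u : EuclideanSpace ℝ (Fin 1) × EuclideanSpace ℝ (Fin n) =>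
        chartForm g (chartAt (EuclideanSpace ℝ (Fin n)) x) u.2)
        (extChartAt (𝓡 1) z z, extChartAt (𝓡 n) x x) :=
      ContDiffAt.comp (g := chartForm g (chartAt (EuclideanSpace ℝ (Fin n)) x))
        (extChartAt (𝓡 1) z z, extChartAt (𝓡 n) x x)
        ((contDiffOn_chartForm he₂ hg.contMDiff).contDiffAt
          ((chartAt (EuclideanSpace ℝ (Fin n)) x).isOpen_extend_target.mem_nhds
            (mem_extChartAt_target x))) contDiffAt_snd
    refine ((hG.clm_apply (contDiffAt_const (c := v))).clm_apply
      (contDiffAt_const (c := w))).congr_of_eventuallyEq ?_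
    have h1 : ∀ᶠ x' in 𝓝 x, χ x' = 0 :=
      notMem_tsupport_iff_eventuallyEq.1 fun h => hx (hχe h)
    have h2 : Tendsto (extChartAt (𝓡 n) x).symm (𝓝 (extChartAt (𝓡 n) x x)) (𝓝 x) := by
      have := continuousAt_extChartAt_symm (I := 𝓡 n) x
      rwa [ContinuousAt, extChartAt_to_inv] at this
    have h3 := (h2.comp (continuousAt_snd (p := (extChartAt (𝓡 1) z z, extChartAt (𝓡 n) x x)))
      ).eventually h1
    filter_upwards [h3] with y hy
    have hy' : χ (((chartAt (EuclideanSpace ℝ (Fin n)) x).extend (𝓡 n)).symm y.2) = 0 := hy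
    rw [chartForm_flowFamily_of_eq_zero hV (by rw [hy', mul_zero])]

theorem hasSignature_flowFamily {p q : ℕ} (hg : IsSmoothMetric g p q) (hV : IsUnit V.det)
    (he : e ∈ IsManifold.maximalAtlas (𝓡 n) ∞ N) (hχe : tsupport χ ⊆ e.source) (z : Circle)
    (x : N) : HasSignature (flowFamily g e V d f χ z x) p q :=
  hasSignature_deformField he (hg.hasSignature x) (isUnit_det_flowMatrix hV _) fun hx => by
    rw [image_eq_zero_of_notMem_tsupport fun h => hx (hχe h), mul_zero, flowMatrix_zero hV]

end FlowFamily
end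

noncomputable section
set_option linter.unusedSectionVars false
set_option synthInstance.maxHeartbeats 200000

section Diagonalize

theorem HasSignature.exists_diagonalize {n p q : ℕ} (hpq : p + q = n) {E : Type*}
    [NormedAddCommGroup E] [NormedSpace ℝ E] {T : E →L[ℝ] E →L[ℝ] ℝ} (hT : HasSignature T p q)
    (b : Module.Basis (Fin n) ℝ E) :
    ∃ (V : Matrix (Fin n) (Fin n) ℝ) (s : Fin n → ℝ), IsUnit V.det ∧ (∀ i, s i ≠ 0) ∧
      V.transpose * (Matrix.of fun i j => T (b i) (b j)) * V = Matrix.diagonal s := by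
  obtain ⟨v, hv⟩ := hT
  let f : Fin p ⊕ Fin q ≃ Fin n := finSumFinEquiv.trans (finCongr hpq)
  let w := v.reindex f
  let J : E →ₗ[ℝ] E := b.constr ℝ w
  have hJ : ∀ i, J (b i) = w i := fun i => b.constr_basis ℝ w i
  have h1 := toMatrix_bilin_comp b ((ContinuousLinearMap.coeLM ℝ).comp (T : E →ₗ[ℝ] E →L[ℝ] ℝ)) J
  have h2 : LinearMap.toMatrix b b J = b.toMatrix w := by
    ext i j
    rw [LinearMap.toMatrix_apply, hJ, Module.Basis.toMatrix_apply]
  refine ⟨b.toMatrix w, fun i => Sum.elim (fun _ => (-1 : ℝ)) (fun _ => (1 : ℝ)) (f.symm i), ?_,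
    fun i => ?_, ?_⟩
  · have := b.invertibleToMatrix w
    exact Matrix.isUnit_det_of_invertible _
  · rcases h : f.symm i with j | j <;> simp [h]
  · rw [← h2]
    refine h1.symm.trans ?_
    ext i j
    rw [Matrix.of_apply, hJ, hJ]
    change T (w i) (w j) = _
    rw [v.reindex_apply, v.reindex_apply, hv, Matrix.diagonal_apply]
    simp only [EmbeddingLike.apply_eq_iff_eq]

theorem exists_sum_eq {n : ℕ} (hn : 2 ≤ n) (a c : ℝ) :
    ∃ d : Fin n → ℝ, ∑ i, d i = a + c ∧ ∑ i, d i ^ 2 = a ^ 2 + c ^ 2 := by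
  obtain ⟨m, rfl⟩ := Nat.exists_eq_add_of_le' hn
  exact ⟨Fin.cons a (Fin.cons c fun _ => 0), by simp [Fin.sum_univ_succ],
    by simp [Fin.sum_univ_succ]⟩

end Diagonalize

section Congruence

variable {κ : Type*} [Fintype κ] [DecidableEq κ] {E : Type*} [NormedAddCommGroup E]
  [NormedSpace ℝ E] {b : Module.Basis (Fin 1 ⊕ κ) ℝ E} {F : E → ℝ} {G G' : E → Matrix κ κ ℝ}
  {W : Set E} {y : E}

theorem timeDeriv_congr (h : G =ᶠ[𝓝 y] G') : timeDeriv b G =ᶠ[𝓝 y] timeDeriv b G' := by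
  filter_upwards [h.eventuallyEq_nhds] with v hv
  ext i j
  rw [timeDeriv, timeDeriv, Matrix.of_apply, Matrix.of_apply]
  exact (pderiv_congr (hv.mono fun x hx => by rw [hx]) b _).eq_of_nhds

theorem timeCurvature_congr (h : G =ᶠ[𝓝 y] G') : timeCurvature b F G y = timeCurvature b F G' y := by
  have h1 : shapeMatrix b G =ᶠ[𝓝 y] shapeMatrix b G' := by
    filter_upwards [h, timeDeriv_congr (b := b) h] with v hv hv'
    rw [shapeMatrix, shapeMatrix, hv, hv']
  have h2 := (pderiv_congr (f := fun v => (shapeMatrix b G v).trace)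
    (g := fun v => (shapeMatrix b G' v).trace) (h1.mono fun x hx => by
      simp only [hx]) b (Sum.inl 0)).eq_of_nhds
  rw [timeCurvature, timeCurvature, h1.eq_of_nhds, h2]

theorem IsBlockOn.congr (h : IsBlockOn b F G W) (hG : ∀ y ∈ W, G' y = G y) :
    IsBlockOn b F G' W where
  isOpen := h.isOpen
  contDiffOn_fst := h.contDiffOn_fst
  contDiffOn_snd i j := (h.contDiffOn_snd i j).congr fun y hy => by rw [hG y hy]
  fst_ne_zero := h.fst_ne_zero
  det_ne_zero y hy := by rw [hG y hy]; exact h.det_ne_zero y hy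
  symm y hy := by rw [hG y hy]; exact h.symm y hy
  pderiv_fst := h.pderiv_fst

end Congruence

section Bump

variable {n : ℕ}

theorem pderiv_comp_snd (f : EuclideanSpace ℝ (Fin n) → ℝ)
    {u : EuclideanSpace ℝ (Fin 1) × EuclideanSpace ℝ (Fin n)} (hf : DifferentiableAt ℝ f u.2)
    (i : Fin 1 ⊕ Fin n) :
    pderiv (productBasis n) i (fun y => f y.2) u = fderiv ℝ f u.2 (productBasis n i).2 := by
  have h1 := hf.hasFDerivAt.comp u (hasFDerivAt_snd (𝕜 := ℝ) (p := u))
  have h2 : (f ∘ Prod.snd) = fun y : EuclideanSpace ℝ (Fin 1) × EuclideanSpace ℝ (Fin n) =>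
    f y.2 := rfl
  rw [pderiv, ← h2, h1.fderiv]
  rfl

theorem pderiv_inl_comp_snd (f : EuclideanSpace ℝ (Fin n) → ℝ)
    {u : EuclideanSpace ℝ (Fin 1) × EuclideanSpace ℝ (Fin n)} (hf : DifferentiableAt ℝ f u.2) :
    pderiv (productBasis n) (Sum.inl 0) (fun y => f y.2) u = 0 := by
  rw [pderiv_comp_snd f hf, productBasis_inl, map_zero]

variable {c₁ : EuclideanSpace ℝ (Fin 1)} {c₂ : EuclideanSpace ℝ (Fin n)} (S : ContDiffBump c₁)
  (X : ContDiffBump c₂)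

/-- The product of two bump functions. -/
def bumpProd (u : EuclideanSpace ℝ (Fin 1) × EuclideanSpace ℝ (Fin n)) : ℝ := S u.1 * X u.2

theorem contDiff_bumpProd : ContDiff ℝ ∞ (bumpProd S X) :=
  (S.contDiff.comp contDiff_fst).mul (X.contDiff.comp contDiff_snd)

theorem bumpProd_eq_zero {u : EuclideanSpace ℝ (Fin 1) × EuclideanSpace ℝ (Fin n)}
    (hu : u ∉ Metric.closedBall c₁ S.rOut ×ˢ Metric.closedBall c₂ X.rOut) :
    bumpProd S X u = 0 := by
  by_contra h
  refine hu ⟨Metric.ball_subset_closedBall ?_, Metric.ball_subset_closedBall ?_⟩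
  · rw [← S.support_eq]; exact left_ne_zero_of_mul h
  · rw [← X.support_eq]; exact right_ne_zero_of_mul h

theorem hasCompactSupport_bumpProd : HasCompactSupport (bumpProd S X) :=
  HasCompactSupport.intro ((isCompact_closedBall _ _).prod (isCompact_closedBall _ _))
    fun _ hu => bumpProd_eq_zero S X hu

theorem tsupport_bumpProd :
    tsupport (bumpProd S X) ⊆ Metric.closedBall c₁ S.rOut ×ˢ Metric.closedBall c₂ X.rOut :=
  closure_minimal (Function.support_subset_iff'.2 fun _ hu => bumpProd_eq_zero S X hu)
    (Metric.isClosed_closedBall.prod Metric.isClosed_closedBall)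

theorem pderiv_bumpProd (u : EuclideanSpace ℝ (Fin 1) × EuclideanSpace ℝ (Fin n)) :
    pderiv (productBasis n) (Sum.inl 0) (bumpProd S X) u
      = fderiv ℝ S u.1 ((EuclideanSpace.basisFun (Fin 1) ℝ).toBasis 0) * X u.2 := by
  have hS : DifferentiableAt ℝ S u.1 :=
    (S.contDiff (n := 1)).contDiffAt.differentiableAt one_ne_zero
  have hX : DifferentiableAt ℝ X u.2 :=
    (X.contDiff (n := 1)).contDiffAt.differentiableAt one_ne_zero
  have h1 : pderiv (productBasis n) (Sum.inl 0) (bumpProd S X) u = _ :=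
    pderiv_mul (f := fun y : EuclideanSpace ℝ (Fin 1) × EuclideanSpace ℝ (Fin n) => S y.1)
      (g := fun y => X y.2) (hS.comp u differentiableAt_fst) (hX.comp u differentiableAt_snd)
      (Sum.inl 0)
  rw [h1, pderiv_comp_fst S hS, pderiv_inl_comp_snd X hX, productBasis_inl, mul_zero, add_zero]

theorem exists_pderiv_bumpProd_ne_zero :
    ∃ u, pderiv (productBasis n) (Sum.inl 0) (bumpProd S X) u ≠ 0 := by
  by_contra! h
  have hS : Differentiable ℝ S := (S.contDiff (n := 1)).differentiable one_ne_zero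
  have h1 : ∀ u, fderiv ℝ S u = 0 := fun u => by
    have h2 := h (u, c₂)
    rw [pderiv_bumpProd, X.eventuallyEq_one.eq_of_nhds, Pi.one_apply, mul_one] at h2
    refine ContinuousLinearMap.coe_injective
      ((EuclideanSpace.basisFun (Fin 1) ℝ).toBasis.ext fun i => ?_)
    rw [Subsingleton.elim i 0]
    exact h2
  have h3 := is_const_of_fderiv_eq_zero hS h1 c₁ (c₁ + S.rOut • EuclideanSpace.basisFun (Fin 1) ℝ 0)
  rw [S.eventuallyEq_one.eq_of_nhds, S.zero_of_le_dist] at h3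
  · exact one_ne_zero h3
  · rw [dist_eq_norm, add_sub_cancel_left, norm_smul, OrthonormalBasis.norm_eq_one,
      mul_one, Real.norm_eq_abs]
    exact le_abs_self _

variable {E : Type*} [NormedAddCommGroup E] [NormedSpace ℝ E] [FiniteDimensional ℝ E]
  {H : Type*} [TopologicalSpace H] {I : ModelWithCorners ℝ E H}
  {M : Type*} [TopologicalSpace M] [ChartedSpace H M] {x : M}

theorem SmoothBumpFunction.apply_extend_symm (f : SmoothBumpFunction I x) {u : E}
    (hu : u ∈ ((chartAt H x).extend I).target) :
    f (((chartAt H x).extend I).symm u) = f.toContDiffBump u := by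
  have h1 : ((chartAt H x).extend I).symm u ∈ (chartAt H x).source := by
    rw [← OpenPartialHomeomorph.extend_source (I := I)]
    exact ((chartAt H x).extend I).map_target hu
  have h2 := f.eqOn_source h1
  rw [h2, Function.comp_apply]
  exact congrArg f.toContDiffBump (((chartAt H x).extend I).right_inv hu)

theorem SmoothBumpFunction.closedBall_subset_target [I.Boundaryless] (f : SmoothBumpFunction I x) :
    Metric.closedBall (extChartAt I x x) f.rOut ⊆ ((chartAt H x).extend I).target := by
  have := f.closedBall_subset
  rwa [I.range_eq_univ, Set.inter_univ] at this

end Bump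
end

noncomputable section
set_option linter.unusedSectionVars false
set_option synthInstance.maxHeartbeats 200000

section NegativeAction

variable {n : ℕ} {N : Type*} [TopologicalSpace N] [T2Space N] [CompactSpace N]
  [ChartedSpace (EuclideanSpace ℝ (Fin n)) N] [IsManifold (𝓡 n) ∞ N]
  {g : BilinField (𝓡 n) N} {V : Matrix (Fin n) (Fin n) ℝ} {d : Fin n → ℝ}
  {z₀ : Circle} {x₀ : N} (f : SmoothBumpFunction (𝓡 1) z₀) (χ : SmoothBumpFunction (𝓡 n) x₀)
  {p q r s : ℕ} {σ : ℝ}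

theorem familyComponents_flowFamily
    {u : EuclideanSpace ℝ (Fin 1) × EuclideanSpace ℝ (Fin n)}
    (hu : u ∈ ((chartAt (EuclideanSpace ℝ (Fin 1)) z₀).extend (𝓡 1)).target
      ×ˢ ((chartAt (EuclideanSpace ℝ (Fin n)) x₀).extend (𝓡 n)).target) :
    familyComponents (flowFamily g (chartAt _ x₀) V d f χ) (chartAt _ z₀) (chartAt _ x₀) u
      = flowMetric V d (bumpProd f.toContDiffBump χ.toContDiffBump) (fun y =>
        chartComponents (EuclideanSpace.basisFun (Fin n) ℝ).toBasis g (chartAt _ x₀) y.2) u := by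
  have he₂ := IsManifold.chart_mem_maximalAtlas (I := 𝓡 n) (n := ∞) x₀
  rw [familyComponents, flowFamily, chartComponents_deformField he₂ hu.2, f.apply_extend_symm hu.1,
    χ.apply_extend_symm hu.2]
  rfl

/-- Where the deformation is trivial, the singular part of the curvature vanishes. -/
theorem singularCurvature_flowFamily_eq_zero (hg : IsSmoothMetric g p q) (hV : IsUnit V.det)
    (hσ : (σ = 1 ∧ r = p ∧ s = q + 1) ∨ (σ = -1 ∧ r = p + 1 ∧ s = q)) {y : Circle × N}
    (hy : y ∉ ((chartAt (EuclideanSpace ℝ (Fin 1)) z₀).prod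
      (chartAt (EuclideanSpace ℝ (Fin n)) x₀)).source) :
    singularCurvature σ (flowFamily g (chartAt _ x₀) V d f χ) y = 0 := by
  have he := IsManifold.chart_mem_maximalAtlas (I := 𝓡 n) (n := ∞) x₀
  have hs := isSmoothFamily_flowFamily (d := d) hg hV he f.contMDiff χ.contMDiff
    χ.tsupport_subset_chartAt_source
  have hγ := hasSignature_flowFamily (d := d) (f := f) hg hV he χ.tsupport_subset_chartAt_source
  have he₁ := IsManifold.chart_mem_maximalAtlas (I := 𝓡 1) (n := ∞) y.1
  have he₂ := IsManifold.chart_mem_maximalAtlas (I := 𝓡 n) (n := ∞) y.2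
  have hu : (extChartAt (𝓡 1) y.1 y.1, extChartAt (𝓡 n) y.2 y.2)
      ∈ ((chartAt (EuclideanSpace ℝ (Fin 1)) y.1).extend (𝓡 1)).target
        ×ˢ ((chartAt (EuclideanSpace ℝ (Fin n)) y.2).extend (𝓡 n)).target :=
    ⟨mem_extChartAt_target y.1, mem_extChartAt_target y.2⟩
  have hx : (((chartAt (EuclideanSpace ℝ (Fin 1)) y.1).prod
      (chartAt (EuclideanSpace ℝ (Fin n)) y.2)).extend ((𝓡 1).prod (𝓡 n))).symm
      (extChartAt (𝓡 1) y.1 y.1, extChartAt (𝓡 n) y.2 y.2) = y :=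
    Prod.ext (extChartAt_to_inv (I := 𝓡 1) y.1) (extChartAt_to_inv (I := 𝓡 n) y.2)
  have hzero : ∀ᶠ y' : Circle × N in 𝓝 y, f y'.1 * χ y'.2 = 0 := by
    by_cases h : y.1 ∈ (chartAt (EuclideanSpace ℝ (Fin 1)) z₀).source
    · have h2 : y.2 ∉ tsupport χ := fun h' => hy ⟨h, χ.tsupport_subset_chartAt_source h'⟩
      have h3 := (continuous_snd.tendsto y).eventually (notMem_tsupport_iff_eventuallyEq.1 h2)
      filter_upwards [h3] with y' hy'
      rw [hy', Pi.zero_apply, mul_zero]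
    · have h2 : y.1 ∉ tsupport f := fun h' => h (f.tsupport_subset_chartAt_source h')
      have h3 := (continuous_fst.tendsto y).eventually (notMem_tsupport_iff_eventuallyEq.1 h2)
      filter_upwards [h3] with y' hy'
      rw [hy', Pi.zero_apply, zero_mul]
  have hsymm : Tendsto (fun u : EuclideanSpace ℝ (Fin 1) × EuclideanSpace ℝ (Fin n) =>
      ((extChartAt (𝓡 1) y.1).symm u.1, (extChartAt (𝓡 n) y.2).symm u.2))
      (𝓝 (extChartAt (𝓡 1) y.1 y.1, extChartAt (𝓡 n) y.2 y.2)) (𝓝 y) := by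
    have h1 := continuousAt_extChartAt_symm (I := 𝓡 1) y.1
    have h2 := continuousAt_extChartAt_symm (I := 𝓡 n) y.2
    rw [ContinuousAt, extChartAt_to_inv] at h1 h2
    exact h1.prodMap_nhds h2
  have hev : ∀ᶠ u in 𝓝 (extChartAt (𝓡 1) y.1 y.1, extChartAt (𝓡 n) y.2 y.2),
      familyComponents (flowFamily g (chartAt _ x₀) V d f χ) (chartAt _ y.1) (chartAt _ y.2) u
        = chartComponents (EuclideanSpace.basisFun (Fin n) ℝ).toBasis g (chartAt _ y.2) u.2 := by
    filter_upwards [hsymm.eventually hzero] with u hu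
    have hu' : f (((chartAt (EuclideanSpace ℝ (Fin 1)) y.1).extend (𝓡 1)).symm u.1)
      * χ (((chartAt (EuclideanSpace ℝ (Fin n)) y.2).extend (𝓡 n)).symm u.2) = 0 := hu
    rw [familyComponents, chartComponents_eq, chartComponents_eq, formMatrix, formMatrix,
      chartForm_flowFamily_of_eq_zero hV hu']
  have key := hs.singularCurvature_eq hγ hσ he₁ he₂ hu
  rw [hx] at key
  rw [key, timeCurvature_eq_zero, mul_zero]
  refine (timeDeriv_congr hev).trans ?_
  filter_upwards [isOpen_prod_target.mem_nhds hu] with u hu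
  ext i j
  have h1 := ((hg.isMetricOn (EuclideanSpace.basisFun (Fin n) ℝ).toBasis he₂).contDiffOn_entry i
    j).contDiffAt ((chartAt _ y.2).isOpen_extend_target.mem_nhds hu.2)
  exact pderiv_inl_comp_snd _ (h1.differentiableAt (by simp))

variable [MeasurableSpace N] [BorelSpace N]

set_option maxHeartbeats 1000000 in
theorem integral_singularCurvature_neg (hg : IsSmoothMetric g p q) (hV : IsUnit V.det)
    (hσ : (σ = 1 ∧ r = p ∧ s = q + 1) ∨ (σ = -1 ∧ r = p + 1 ∧ s = q))
    (hneg : ∀ u ∈ Metric.closedBall (extChartAt (𝓡 n) x₀ x₀) χ.rOut, σ⁻¹ * actionForm V d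
      (chartComponents (EuclideanSpace.basisFun (Fin n) ℝ).toBasis g (chartAt _ x₀) u) < 0) :
    ∫ y, singularCurvature σ (flowFamily g (chartAt _ x₀) V d f χ) y
      ∂(volumeMeasure (productBasis n)
        (circleProductMetric (σ * 1 ^ 2) (flowFamily g (chartAt _ x₀) V d f χ))) < 0 := by
  have hBorel := borelSpace_circle_prod n N
  have he₁ := IsManifold.chart_mem_maximalAtlas (I := 𝓡 1) (n := ∞) z₀
  have he₂ := IsManifold.chart_mem_maximalAtlas (I := 𝓡 n) (n := ∞) x₀
  have hs := isSmoothFamily_flowFamily (d := d) hg hV he₂ f.contMDiff χ.contMDiff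
    χ.tsupport_subset_chartAt_source
  have hγ := hasSignature_flowFamily (d := d) (f := f) hg hV he₂ χ.tsupport_subset_chartAt_source
  have hatlas : (chartAt (EuclideanSpace ℝ (Fin 1)) z₀).prod
      (chartAt (EuclideanSpace ℝ (Fin n)) x₀) ∈ atlas (ModelProd (EuclideanSpace ℝ (Fin 1))
      (EuclideanSpace ℝ (Fin n))) (Circle × N) :=
    mem_image2_of_mem (chart_mem_atlas _ _) (chart_mem_atlas _ _)
  have hmet := hg.isMetricOn (EuclideanSpace.basisFun (Fin n) ℝ).toBasis he₂
  let G₀ : EuclideanSpace ℝ (Fin 1) × EuclideanSpace ℝ (Fin n) → Matrix (Fin n) (Fin n) ℝ :=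
    fun y => chartComponents (EuclideanSpace.basisFun (Fin n) ℝ).toBasis g (chartAt _ x₀) y.2
  let D : EuclideanSpace ℝ (Fin n) → ℝ := fun u => Real.sqrt
    |(chartComponents (EuclideanSpace.basisFun (Fin n) ℝ).toBasis g (chartAt _ x₀) u).det|
  have hGs : ∀ i j, ContDiffOn ℝ ∞ (fun y => G₀ y i j)
      (((chartAt (EuclideanSpace ℝ (Fin 1)) z₀).extend (𝓡 1)).target
        ×ˢ ((chartAt (EuclideanSpace ℝ (Fin n)) x₀).extend (𝓡 n)).target) := fun i j =>
    (hmet.contDiffOn_entry i j).comp contDiff_snd.contDiffOn fun _ hu => hu.2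
  have hDs : ContDiffOn ℝ ∞ D ((chartAt (EuclideanSpace ℝ (Fin n)) x₀).extend (𝓡 n)).target := by
    refine ContDiffOn.sqrt (fun u hu => ?_) fun u hu => abs_ne_zero.2 (hmet.det_ne_zero u hu)
    exact (contDiffAt_abs (hmet.det_ne_zero u hu)).comp_contDiffWithinAt u
      (contDiffOn_det hmet.contDiffOn_entry u hu)
  have hball : ∀ {u : EuclideanSpace ℝ (Fin 1) × EuclideanSpace ℝ (Fin n)},
      pderiv (productBasis n) (Sum.inl 0) (bumpProd f.toContDiffBump χ.toContDiffBump) u ≠ 0 →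
      u.2 ∈ Metric.closedBall (extChartAt (𝓡 n) x₀ x₀) χ.rOut := fun {u} hu => by
    rw [pderiv_bumpProd] at hu
    refine Metric.ball_subset_closedBall ?_
    rw [← χ.toContDiffBump.support_eq]
    exact right_ne_zero_of_mul hu
  have hmain := setIntegral_timeCurvature_neg (b := productBasis n) (σ := σ) (V := V) (d := d)
    (F := fun y => angleDensity (chartAt _ z₀) y.1 ^ 2) (G₀ := G₀) (D := fun y => D y.2)
    (τ := bumpProd f.toContDiffBump χ.toContDiffBump) hV
    ((hs.isBlockOn hγ he₁ he₂).congr fun u hu => (familyComponents_flowFamily f χ hu).symm)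
    (fun u hu => sq_pos_of_ne_zero (angleDensity_ne_zero he₁ hu.1))
    (contDiff_bumpProd _ _) (hasCompactSupport_bumpProd _ _)
    ((tsupport_bumpProd _ _).trans
      (prod_mono f.closedBall_subset_target χ.closedBall_subset_target))
    hGs
    (fun u hu => by
      ext i j
      exact pderiv_inl_comp_snd _ (((hmet.contDiffOn_entry i j).contDiffAt
        ((chartAt _ x₀).isOpen_extend_target.mem_nhds hu.2)).differentiableAt (by simp)))
    (fun u hu => hmet.det_ne_zero _ hu.2)
    (hDs.comp contDiff_snd.contDiffOn fun _ hu => hu.2)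
    (fun u hu => pderiv_inl_comp_snd _ ((hDs.contDiffAt
        ((chartAt _ x₀).isOpen_extend_target.mem_nhds hu.2)).differentiableAt (by simp)))
    (fun u hu => Real.sqrt_pos.2 (abs_pos.2 (hmet.det_ne_zero _ hu.2)))
    (fun u _ hu => hneg _ (hball hu))
    (exists_pderiv_bumpProd_ne_zero _ _)
  have h1 := hs.continuous_singularCurvature hγ hσ
  rw [← setIntegral_eq_integral_of_forall_compl_eq_zero
      (s := ((chartAt (EuclideanSpace ℝ (Fin 1)) z₀).prod
        (chartAt (EuclideanSpace ℝ (Fin n)) x₀)).source)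
      fun y hy => singularCurvature_flowFamily_eq_zero f χ hg hV hσ hy,
    setIntegral_volumeMeasure_source (productBasis n) (hs.isSmoothMetric hγ hσ one_pos) hatlas h1,
    extend_prod_target]
  refine lt_of_eq_of_lt (setIntegral_congr_fun isOpen_prod_target.measurableSet fun u hu => ?_)
    hmain
  have hσ1 : |σ| = 1 := by rcases hσ with h | h <;> rw [h.1] <;> norm_num
  rw [hs.singularCurvature_eq hγ hσ he₁ he₂ hu, timeCurvature_congr
    (Filter.mem_of_superset (isOpen_prod_target.mem_nhds hu) fun u hu =>
      familyComponents_flowFamily f χ hu), volumeDensity,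
    chartComponents_circleProductMetric he₁ he₂ hu, blockMetric_det,
    familyComponents_flowFamily f χ hu, det_flowMetric hV, abs_mul, abs_mul, abs_mul, hσ1, abs_mul,
    one_pow, abs_one, one_mul, one_mul, Real.sqrt_mul (abs_nonneg _), Real.sqrt_mul (abs_nonneg _),
    abs_of_nonneg (sq_nonneg (angleDensity _ _)), abs_of_nonneg (sq_nonneg (Real.exp _)),
    Real.sqrt_sq (Real.exp_pos _).le]

end NegativeAction

/-- On a nonempty compact manifold of dimension at least two, every metric can be deformed to a
circle of metrics for which the collapsing action has a negative leading coefficient. -/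
theorem exists_family_integral_neg {n : ℕ} (hn : 2 ≤ n) {N : Type*} [TopologicalSpace N]
    [T2Space N] [CompactSpace N] [Nonempty N] [ChartedSpace (EuclideanSpace ℝ (Fin n)) N]
    [IsManifold (𝓡 n) ∞ N] [MeasurableSpace N] [BorelSpace N] {p q r s : ℕ} (hpq : p + q = n)
    {g : BilinField (𝓡 n) N} (hg : IsSmoothMetric g p q) {σ : ℝ}
    (hσ : (σ = 1 ∧ r = p ∧ s = q + 1) ∨ (σ = -1 ∧ r = p + 1 ∧ s = q)) :
    ∃ γ : Circle → BilinField (𝓡 n) N, IsSmoothFamily γ ∧ (∀ z x, HasSignature (γ z x) p q) ∧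
      ∫ y, singularCurvature σ γ y
        ∂(volumeMeasure (productBasis n) (circleProductMetric (σ * 1 ^ 2) γ)) < 0 := by
  obtain ⟨x₀⟩ := ‹Nonempty N›
  have he := IsManifold.chart_mem_maximalAtlas (I := 𝓡 n) (n := ∞) x₀
  have hmet := hg.isMetricOn (EuclideanSpace.basisFun (Fin n) ℝ).toBasis he
  have hu₀ : extChartAt (𝓡 n) x₀ x₀ ∈ ((chartAt _ x₀).extend (𝓡 n)).target :=
    mem_extChartAt_target x₀
  have hT : HasSignature (V := EuclideanSpace ℝ (Fin n))
      (chartForm g (chartAt _ x₀) (extChartAt (𝓡 n) x₀ x₀)) p q := by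
    let L : EuclideanSpace ℝ (Fin n) ≃ₗ[ℝ] EuclideanSpace ℝ (Fin n) :=
      LinearEquiv.ofInjectiveEndo
        (chartFrame (𝓡 n) (chartAt _ x₀) (extChartAt (𝓡 n) x₀ x₀) : _ →ₗ[ℝ] _)
        (chartFrame_injective he hu₀)
    have hg' : HasSignature (V := EuclideanSpace ℝ (Fin n)) (modelForm g
        (((chartAt _ x₀).extend (𝓡 n)).symm (extChartAt (𝓡 n) x₀ x₀))) p q := hg.hasSignature _
    refine HasSignature.map hg' L.symm fun v w => ?_
    rw [chartForm_apply]
    change modelForm g _ (L (L.symm v)) (L (L.symm w)) = _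
    rw [L.apply_symm_apply, L.apply_symm_apply]
  obtain ⟨V, ς, hV, hς, hdiag⟩ :=
    hT.exists_diagonalize hpq (EuclideanSpace.basisFun (Fin n) ℝ).toBasis
  have hdiag' : V.transpose * chartComponents (EuclideanSpace.basisFun (Fin n) ℝ).toBasis g
      (chartAt _ x₀) (extChartAt (𝓡 n) x₀ x₀) * V = Matrix.diagonal ς := hdiag
  obtain ⟨d, hd1, hd2⟩ := exists_sum_eq hn 1 (-σ)
  have hσ0 : σ ≠ 0 := by rcases hσ with h | h <;> rw [h.1] <;> norm_num
  have hq : σ⁻¹ * actionForm V d (chartComponents (EuclideanSpace.basisFun (Fin n) ℝ).toBasis g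
      (chartAt _ x₀) (extChartAt (𝓡 n) x₀ x₀)) < 0 := by
    have h1 : actionForm V d (chartComponents (EuclideanSpace.basisFun (Fin n) ℝ).toBasis g
      (chartAt _ x₀) (extChartAt (𝓡 n) x₀ x₀)) = -8 * σ := by
      rw [actionForm_eq hV (S := Matrix.diagonal ς) _ ⟨ς, rfl⟩ hdiag', hd1, hd2]
      · ring
      · rw [Matrix.det_diagonal]
        exact (Finset.prod_ne_zero_iff.2 fun i _ => hς i).isUnit
    rw [h1, mul_comm, mul_assoc, mul_inv_cancel₀ hσ0]
    norm_num
  have hcont : ContinuousOn (fun u => σ⁻¹ * actionForm V d (chartComponents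
      (EuclideanSpace.basisFun (Fin n) ℝ).toBasis g (chartAt _ x₀) u))
      ((chartAt _ x₀).extend (𝓡 n)).target :=
    continuousOn_const.mul (contDiffOn_actionForm hmet.contDiffOn_entry hmet.det_ne_zero).continuousOn
  have hnhds := (hcont.continuousAt (hmet.isOpen.mem_nhds hu₀)).eventually (gt_mem_nhds hq)
  obtain ⟨ρ, hρ, hρsub⟩ := Metric.nhds_basis_closedBall.mem_iff.1
    (Filter.inter_mem (hmet.isOpen.mem_nhds hu₀) hnhds)
  let χ : SmoothBumpFunction (𝓡 n) x₀ :=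
    { rIn := ρ / 2
      rOut := ρ
      rIn_pos := half_pos hρ
      rIn_lt_rOut := half_lt_self hρ
      closedBall_subset := fun u hu => (hρsub hu.1).1 }
  obtain ⟨f⟩ : Nonempty (SmoothBumpFunction (𝓡 1) (1 : Circle)) := inferInstance
  exact ⟨flowFamily g (chartAt _ x₀) V d f χ,
    isSmoothFamily_flowFamily hg hV he f.contMDiff χ.contMDiff χ.tsupport_subset_chartAt_source,
    hasSignature_flowFamily hg hV he χ.tsupport_subset_chartAt_source,
    integral_singularCurvature_neg f χ hg hV hσ fun u hu => (hρsub hu).2⟩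
end

theorem mainTheorem6 (n : ℕ) (hn : 2 ≤ n)
    (N : Type*) [TopologicalSpace N] [T2Space N] [CompactSpace N] [Nonempty N]
    [ChartedSpace (EuclideanSpace ℝ (Fin n)) N] [IsManifold (𝓡 n) ∞ N]
    [MeasurableSpace N] [BorelSpace N]
    (p q : ℕ) (hpq : p + q = n)
    (hN : p = 0 ∨ q = 0 ∨ ∃ γ₀ : BilinField (𝓡 n) N, IsSmoothMetric γ₀ p q)
    (σ : ℝ) (r s : ℕ)
    (hσ : (σ = 1 ∧ r = p ∧ s = q + 1) ∨ (σ = -1 ∧ r = p + 1 ∧ s = q)) :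
    ∃ γ : Circle → BilinField (𝓡 n) N,
      (∀ t, IsSmoothMetric (γ t) p q) ∧
      (∀ ε ∈ Ioc (0 : ℝ) 1, IsSmoothMetric (circleProductMetric (σ * ε ^ 2) γ) r s) ∧
      UniformlyBoundedSmooth (productBasis n) (Ioc (0 : ℝ) 1)
        (fun ε => circleProductMetric (σ * ε ^ 2) γ) ∧
      (∀ ε ∈ Ioc (0 : ℝ) 1,
        Integrable (scalarCurvature (productBasis n) (circleProductMetric (σ * ε ^ 2) γ))
          (volumeMeasure (productBasis n) (circleProductMetric (σ * ε ^ 2) γ))) ∧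
      (∃ cm c : ℝ, cm < 0 ∧ ∀ ε ∈ Ioc (0 : ℝ) 1,
        einsteinHilbert (productBasis n) (circleProductMetric (σ * ε ^ 2) γ)
          = cm / ε + c * ε) ∧
      Tendsto (fun ε : ℝ =>
        einsteinHilbert (productBasis n) (circleProductMetric (σ * ε ^ 2) γ)) (𝓝[>] 0) atBot ∧
      (fun ε : ℝ => einsteinHilbert (productBasis n) (circleProductMetric (σ * ε ^ 2) γ))
        =O[𝓝[>] 0] (fun ε : ℝ => ε⁻¹) := by
  obtain ⟨γ₀, hγ₀⟩ := exists_isSmoothMetric hpq hN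
  obtain ⟨γ, hs, hγ, hneg⟩ := exists_family_integral_neg hn hpq hγ₀ hσ
  have hformula : ∀ ε ∈ Ioc (0 : ℝ) 1,
      einsteinHilbert (productBasis n) (circleProductMetric (σ * ε ^ 2) γ) = _ :=
    fun ε hε => hs.einsteinHilbert_eq hγ hσ hε.1
  exact ⟨γ, hs.isSmoothMetric_apply hγ, fun ε hε => hs.isSmoothMetric hγ hσ hε.1,
    hs.uniformlyBoundedSmooth σ,
    fun ε hε => hs.integrable_of_continuous hγ hσ
      ((hs.isSmoothMetric hγ hσ hε.1).continuous_scalarCurvature _) hε.1,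
    ⟨_, _, hneg, hformula⟩, tendsto_atBot_of_eq_div_add hformula hneg,
    isBigO_of_eq_div_add hformula⟩
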